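/- **Conventions.** Automata are transition-based. An NBA is a tuple $(Q,\iota,\delta,F)$ with transitions $\delta\subseteq Q\times\Sigma\times Q$ and accepting transitions $F\subseteq\delta$; the states are linearly ordered. A deterministic Emerson--Lei automaton (DELA) is a deterministic automaton whose transitions carry sets of colors in $\{0,\dots,k\}$, with an acceptance formula built from $\mathsf{Fin}(x)$ and $\mathsf{Inf}(x)$ by $\wedge,\vee$; deterministic parity automata (DPAs, the least color seen infinitely often is even) and deterministic Rabin automata (DRAs) are the special cases with the usual formulas. A maximal SCC is *inherently weak* if all of its cycles, or none of them, take an accepting transition; any other SCC contains an accepting transition and is called a DAC if it is deterministic inside and a NAC otherwise. **The divide-and-conquer construction.** For an NBA $A$ let $W$ be the set of states in inherently weak SCCs and $W_A\subseteq W$ the set of states in those of them that contain an accepting transition. A macrostate consists of * a pair $(P,O)$ with $P\subseteq W$ and $O\subseteq W_A$; * for each DAC $D$ a labelling $g_D:D\to\{1,\dots,|D|\}\cup\{\infty\}$; * for each NAC $N$ a labelling $t_N$ of $N$ by ascending lists over $\{1,\dots,2|N|\}$. Let $S$ be the set of currently reached states, and let the letter $a$ be read. * *Weak SCCs.* $P'=\delta(S,a)\cap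 W$; $O'=\delta(O,a)\cap W_A$ if $O\ne\emptyset$, and $O'=P'\cap W_A$ otherwise. The color $1$ is emitted iff $O=\emptyset$. * *DACs.* A state takes over the least number of its reached predecessors in $D$; the $i$-th state that is entered only from outside gets $|D|+i$; then the numbers are compressed to $1,2,\dots$. A number is bad if it is discontinued before the compression, and good if its run takes an accepting transition. * *NACs.* Every accepting transition inside $N$ appends a new number to the list; a state takes the least of its candidate lists, in the lexicographic order after padding with $\infty$; entered states get new one-element lists. Each list is then cut at its shortest prefix that is not itself the list of a state, if there is one, and the last number of this prefix is good; numbers that disappear are bad; then the numbers are compressed. * For each DAC and NAC $C$ the color $\min\{2\min B-1,\,2\min G\}$ is emitted, where $B$ and $G$ are the sets of bad and of good numbers, each with $|C|+1$ added. The colors of different SCCs are shifted into disjoint ranges. The acceptance formula is the disjunction of $\mathsf{Fin}(1)$ and of the (shifted) min-even parity conditions of the DACs and NACs. **Theorem.** There is a family $(A_n)_{n\in\mathbb N}$ of complete NBAs, $A_n$ with $n+2$ states and alphabet $\{0,\dots,n\}$, each limit-deterministic (there is a set $Q_D$ of states that is closed under successors and deterministic and contains source and target of every accepting transition), such that for every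 $n$: 1. each of the following constructions, applied to $A_n$ in its transition-based form, yields an automaton with at least $n!$ reachable macrostates: * Esparza et al. (for every admissible deterministic part $Q_D$), a DPA; * Redziejowski, a DPA; * Safra, both as a DRA on Safra trees with named nodes and as the DPA obtained from it with index appearance records; * Piterman, a DPA; * Kähler--Wilke (contracted reduced split trees with named and colored nodes), both as a DRA and as the DPA obtained from it with index appearance records; * Löding--Pirogov, a DPA, for every strategy of merging sets of ranked slices; 2. the divide-and-conquer construction applied to $A_n$ yields a DELA with at most $2^{n+2}$ macrostates (all macrostates are counted, reachable or not). -/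

import Mathlib

namespace BuchiDet

noncomputable section

/-! ## Automata -/

/-- A nondeterministic (transition-based) Büchi automaton over the alphabet `α` with set of states
`Q`. The transitions are the `(q, a, q')` with `q' ∈ δ q a`; the accepting ones are those with
`q' ∈ F q a`. -/
structure NBA (α Q : Type) where
  init : Q
  δ : Q → α → Finset Q
  F : Q → α → Finset Q
  F_subset : ∀ q a, F q a ⊆ δ q a

/-- Acceptance formulas over natural-number colors. -/
inductive AccFormula where
  | tt : AccFormula
  | ff : AccFormula
  | fin (x : ℕ) : AccFormula
  | inf (x : ℕ) : AccFormula
  | or (φ ψ : AccFormula) : AccFormula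
  | and (φ ψ : AccFormula) : AccFormula

/-- `φ.Sat M`: the set of colors `M` satisfies `φ`. -/
def AccFormula.Sat (M : Set ℕ) : AccFormula → Prop
  | .tt => True
  | .ff => False
  | .fin x => x ∉ M
  | .inf x => x ∈ M
  | .or φ ψ => φ.Sat M ∨ ψ.Sat M
  | .and φ ψ => φ.Sat M ∧ ψ.Sat M

def AccFormula.bigOr (l : List AccFormula) : AccFormula := l.foldr AccFormula.or AccFormula.ff

def AccFormula.bigAnd (l : List AccFormula) : AccFormula := l.foldr AccFormula.and AccFormula.tt

/-- A (complete) deterministic Emerson-Lei automaton. As it is deterministic, a transition is given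
by its source and its letter; it carries the set of colors `color s a ⊆ {0, …, k}`. -/
structure DELA (α : Type) where
  State : Type
  finite : Finite State
  init : State
  step : State → α → State
  k : ℕ
  color : State → α → Set ℕ
  color_le : ∀ s a, ∀ c ∈ color s a, c ≤ k
  acc : AccFormula

/-- The run over an `ω`-word. -/
def DELA.run {α : Type} (B : DELA α) (w : ℕ → α) : ℕ → B.State
  | 0 => B.init
  | i + 1 => B.step (B.run w i) (w i)

/-- The language: the colors of the transitions taken infinitely often satisfy the formula. -/
def DELA.language {α : Type} (B : DELA α) : Set (ℕ → α) :=
  {w | B.acc.Sat {c | ∃ s a, (∃ᶠ i in Filter.atTop, B.run w i = s ∧ w i = a) ∧ c ∈ B.color s a}}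

/-- The states that are reachable from the initial one. -/
def DELA.reachable {α : Type} (B : DELA α) : Set B.State :=
  {s | Relation.ReflTransGen (fun s t => ∃ a, t = B.step s a) B.init s}

/-- `⋁_{c = 0}^{k/2} (⋀_{i = 1}^{c} Fin(2i-1) ∧ Inf(2c))`: the least color is even. -/
def parityAcc (k : ℕ) : AccFormula :=
  .bigOr ((List.range (k / 2 + 1)).map fun c =>
    .and (.bigAnd ((List.range c).map fun i => .fin (2 * i + 1))) (.inf (2 * c)))

/-- `⋁_i (Fin(2i) ∧ Inf(2i+1))` for the colors `{0, …, k}`, where `k` is odd. -/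
def rabinAcc (k : ℕ) : AccFormula :=
  .bigOr ((List.range ((k + 1) / 2)).map fun i => .and (.fin (2 * i)) (.inf (2 * i + 1)))

/-- Deterministic parity automata. -/
def DELA.IsDPA {α : Type} (B : DELA α) : Prop := Even B.k ∧ B.acc = parityAcc B.k

/-- Deterministic Rabin automata. -/
def DELA.IsDRA {α : Type} (B : DELA α) : Prop := Odd B.k ∧ B.acc = rabinAcc B.k

/-! ## Notions about NBAs -/

namespace NBA

variable {α Q : Type}

def Complete (A : NBA α Q) : Prop := ∀ q a, (A.δ q a).Nonempty

/-- `D` witnesses that `A` is limit-deterministic (semi-deterministic): it is closed and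
deterministic, and all accepting transitions are inside `D`. -/
def IsLimitDeterministic (A : NBA α Q) (D : Finset Q) : Prop :=
  (∀ q ∈ D, ∀ a, (A.δ q a).card = 1 ∧ A.δ q a ⊆ D) ∧
    ∀ q a, (A.F q a).Nonempty → q ∈ D ∧ A.F q a ⊆ D

variable [DecidableEq Q]

/-- Successors of a set of states. -/
def post (A : NBA α Q) (S : Finset Q) (a : α) : Finset Q := S.biUnion fun q => A.δ q a

/-- Successors of a set of states through accepting transitions. -/
def accPost (A : NBA α Q) (S : Finset Q) (a : α) : Finset Q := S.biUnion fun q => A.F q a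

end NBA

lemma card_pos_of_nba {α Q : Type} [Fintype Q] (A : NBA α Q) : 0 < Fintype.card Q :=
  Fintype.card_pos_iff.2 ⟨A.init⟩

section SCC

variable {α Q : Type} (A : NBA α Q)

def Reach : Q → Q → Prop := Relation.ReflTransGen fun p q => ∃ a, q ∈ A.δ p a

/-- There is a cycle through `q` that takes no accepting transition. -/
def RejCycle (q : Q) : Prop := Relation.TransGen (fun p p' => ∃ a, p' ∈ A.δ p a ∧ p' ∉ A.F p a) q q

/-- There is a cycle through `q` that takes an accepting transition. -/
def AccCycle (q : Q) : Prop := ∃ p a p', p' ∈ A.F p a ∧ Reach A q p ∧ Reach A p' q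

end SCC

section Rest

variable {α Q : Type} [Fintype Q] [LinearOrder Q]

open scoped Classical in
/-- The maximal strongly connected component of `q`. -/
def scc (A : NBA α Q) (q : Q) : Finset Q := {p | Reach A q p ∧ Reach A p q}

/-- The component `C` contains an accepting transition. -/
def IsAccepting (A : NBA α Q) (C : Finset Q) : Prop := ∃ q ∈ C, ∃ a, ∃ q' ∈ A.F q a, q' ∈ C

/-- Every cycle through states of `C` takes an accepting transition, or none does. -/
def IsInherentlyWeak (A : NBA α Q) (C : Finset Q) : Prop :=
  (∀ q ∈ C, ¬ RejCycle A q) ∨ (∀ q ∈ C, ¬ AccCycle A q)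

def IsDeterministic (A : NBA α Q) (C : Finset Q) : Prop := ∀ q ∈ C, ∀ a, (A.δ q a ∩ C).card ≤ 1

/-- Deterministic accepting components. -/
def IsDAC (A : NBA α Q) (C : Finset Q) : Prop :=
  ¬ IsInherentlyWeak A C ∧ IsAccepting A C ∧ IsDeterministic A C

/-- Nondeterministic accepting components. -/
def IsNAC (A : NBA α Q) (C : Finset Q) : Prop :=
  ¬ IsInherentlyWeak A C ∧ IsAccepting A C ∧ ¬ IsDeterministic A C

open scoped Classical in
/-- The states in inherently weak components. -/
def weakStates (A : NBA α Q) : Finset Q := {q | IsInherentlyWeak A (scc A q)}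

open scoped Classical in
/-- The states in accepting inherently weak components. -/
def weakAccStates (A : NBA α Q) : Finset Q :=
  {q | IsInherentlyWeak A (scc A q) ∧ IsAccepting A (scc A q)}

/-- `q` is the least state of its component; components are listed by their least states. -/
def IsLeast (A : NBA α Q) (q : Q) : Prop := ∀ p ∈ scc A q, q ≤ p

open scoped Classical in
/-- The least states of the deterministic accepting components. -/
def dacs (A : NBA α Q) : Finset Q := {q | IsLeast A q ∧ IsDAC A (scc A q)}

open scoped Classical in
/-- The least states of the nondeterministic accepting components. -/
def nacs (A : NBA α Q) : Finset Q := {q | IsLeast A q ∧ IsNAC A (scc A q)}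

/-! ## Level labellings of a set of states by numbers

`D` is a set of states inside which `A` is deterministic. A labelling `g` gives to each state of `D`
a number in `{1, …, |D|}` (stored as an element of `Fin |D|`, that is, minus one) or `∞` (stored as
`none`; the state is currently not reached). -/

abbrev NumLabel (D : Finset Q) : Type := {q // q ∈ D} → Option (Fin D.card)

section Num

variable (A : NBA α Q) (D : Finset Q)

def NumLabel.val {D : Finset Q} (g : NumLabel D) (q : Q) : ℕ∞ :=
  if h : q ∈ D then
    match g ⟨q, h⟩ with
    | some i => ((i.val + 1 : ℕ) : ℕ∞)
    | none => ⊤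
  else ⊤

/-- The labelling in which only the initial state is reached, if it is in `D`. -/
def numInit : NumLabel D := fun q =>
  if q.1 = A.init then some ⟨0, Finset.card_pos.2 ⟨q.1, q.2⟩⟩ else none

/-- The reached predecessors in `D`. -/
def numPreds (g : NumLabel D) (a : α) (q' : Q) : Finset Q :=
  D.filter fun q => g.val q ≠ ⊤ ∧ q' ∈ A.δ q a

/-- The intermediate labelling on reading `a`, when `S` is the set of all reached states of `A`. -/
def numMid (S : Finset Q) (g : NumLabel D) (a : α) (q' : Q) : ℕ∞ :=
  if q' ∈ D ∧ q' ∈ A.post S a then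
    if numPreds A D g a q' = ∅ then
      ((D.card + (D.filter fun p =>
        p ∈ A.post S a ∧ numPreds A D g a p = ∅ ∧ p ≤ q').card : ℕ) : ℕ∞)
    else (numPreds A D g a q').inf g.val
  else ⊤

/-- The numbers used by the intermediate labelling. -/
def numMidValues (S : Finset Q) (g : NumLabel D) (a : α) : Finset ℕ∞ :=
  (D.filter fun q => numMid A D S g a q ≠ ⊤).image (numMid A D S g a)

/-- The successor labelling: each number is replaced by its position. -/
def numSucc (S : Finset Q) (g : NumLabel D) (a : α) : NumLabel D := fun q =>
  if h : numMid A D S g a q = ⊤ then none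
  else some ⟨((numMidValues A D S g a).filter fun v => v < numMid A D S g a q).card, by
    have hq : numMid A D S g a q ∈ numMidValues A D S g a :=
      Finset.mem_image_of_mem _ (Finset.mem_filter.2 ⟨q.2, h⟩)
    have hlt := Finset.card_lt_card ((Finset.filter_ssubset (p := fun v => v < numMid A D S g a q)).2
      ⟨_, hq, lt_irrefl (numMid A D S g a q)⟩)
    exact hlt.trans_le (Finset.card_image_le.trans (Finset.card_filter_le D _))⟩

/-- The color `min {2 min B - 1, 2 min G}` for the sets `B` and `G` of bad and good numbers. -/
def eventColor (B G : Set ℕ) : ℕ := min (2 * sInf B - 1) (2 * sInf G)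

/-- The labels that are discontinued. -/
def numBad (S : Finset Q) (g : NumLabel D) (a : α) : Set ℕ :=
  {k | k = D.card + 1 ∨ (∃ q ∈ D, g.val q = k) ∧ ¬ ∃ q ∈ D, numMid A D S g a q = k}

/-- The labels of runs that take an accepting transition. -/
def numGood (S : Finset Q) (g : NumLabel D) (a : α) : Set ℕ :=
  {k | k = D.card + 1 ∨ ∃ q, ∃ q' ∈ A.F q a, g.val q = k ∧ numMid A D S g a q' = k}

def numColor (S : Finset Q) (g : NumLabel D) (a : α) : ℕ :=
  eventColor (numBad A D S g a) (numGood A D S g a)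

end Num

/-! ## Level labellings of a set of states by lists of numbers

`N` is any set of states. A labelling gives to each state of `N` an ascending list of numbers in
`{1, …, 2|N|}`. Such a list is represented by the finite set of its entries, stored minus one. The
empty list means that the state is currently not reached. -/

abbrev ListLabel (N : Finset Q) : Type := {q // q ∈ N} → Finset (Fin (2 * N.card))

/-- The order of ascending lists that compares them lexicographically after padding with `∞`: at the
least number that is in exactly one of them, the smaller list is the one that has it. -/
def listLT (l m : Finset ℕ) : Prop := ∃ x ∈ l, x ∉ m ∧ ∀ y < x, y ∈ l ↔ y ∈ m

section Lst

variable (A : NBA α Q) (N : Finset Q)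

def ListLabel.val {N : Finset Q} (t : ListLabel N) (q : Q) : Finset ℕ :=
  if h : q ∈ N then (t ⟨q, h⟩).image (fun i : Fin (2 * N.card) => i.val + 1) else ∅

open scoped Classical in
/-- The labelling in which only the initial state is reached, with the list `[1]`, if it is in `N`. -/
def listInit : ListLabel N := fun q =>
  if q.1 = A.init then Finset.univ.filter fun i : Fin (2 * N.card) => i.val = 0 else ∅

/-- The numbers that occur in the lists. -/
def listUsed (t : ListLabel N) : Finset ℕ := N.biUnion t.val

/-- The `i`-th (from `i = 0`) unused number. -/
def listFresh (t : ListLabel N) (i : ℕ) : ℕ := Nat.nth (fun u => 1 ≤ u ∧ u ∉ listUsed N t) i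

/-- The reached predecessors in `N`. -/
def listPreds (t : ListLabel N) (a : α) (q' : Q) : Finset Q :=
  N.filter fun q => t.val q ≠ ∅ ∧ q' ∈ A.δ q a

/-- The accepting transitions inside `N` from reached states, as pairs (target, source). -/
def listAccEdges (t : ListLabel N) (a : α) : Finset (Q × Q) :=
  (N ×ˢ N).filter fun e => t.val e.2 ≠ ∅ ∧ e.1 ∈ A.F e.2 a

/-- The candidate for the list of `q'` that is due to its predecessor `q`: the list of `q`, extended
by an own new number if the transition is accepting. New numbers are taken in ascending order, the
transitions being ordered by target and then by source. -/
def listCand (t : ListLabel N) (a : α) (q' q : Q) : Finset ℕ :=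
  if q' ∈ A.F q a then
    insert (listFresh N t ((listAccEdges A N t a).filter fun e =>
      e.1 < q' ∨ e.1 = q' ∧ e.2 < q).card) (t.val q)
  else t.val q

/-- The states of `N` that are entered from outside. -/
def listEntering (S : Finset Q) (t : ListLabel N) (a : α) : Finset Q :=
  N.filter fun q' => q' ∈ A.post S a ∧ listPreds A N t a q' = ∅

open scoped Classical in
/-- The first intermediate labelling on reading `a`, when `S` is the set of all reached states of
`A`: the least of the candidates, or for an entered state a list with one further new number. -/
def listMid (S : Finset Q) (t : ListLabel N) (a : α) (q' : Q) : Finset ℕ :=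
  if q' ∈ listEntering A N S t a then
    {listFresh N t ((listAccEdges A N t a).card +
      ((listEntering A N S t a).filter (· < q')).card)}
  else if q' ∈ N then
    (((listPreds A N t a q').image (listCand A N t a q')).filter fun l =>
      ∀ m ∈ (listPreds A N t a q').image (listCand A N t a q'), m = l ∨ listLT l m).biUnion id
  else ∅

/-- The nonempty list `l` is the list of some state in the first intermediate labelling. -/
def IsMidList (S : Finset Q) (t : ListLabel N) (a : α) (l : Finset ℕ) : Prop :=
  l.Nonempty ∧ ∃ q ∈ N, listMid A N S t a q = l

open scoped Classical in
/-- The second intermediate labelling: a list some of whose prefixes is not a list of the first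
intermediate labelling is cut to the shortest such prefix. -/
def listCut (S : Finset Q) (t : ListLabel N) (a : α) (q : Q) : Finset ℕ :=
  (listMid A N S t a q).filter fun y => ∀ x ∈ listMid A N S t a q, x < y →
    IsMidList A N S t a ((listMid A N S t a q).filter (· ≤ x))

open scoped Classical in
/-- The successor labelling: each number is replaced by its position. -/
def listSucc (S : Finset Q) (t : ListLabel N) (a : α) : ListLabel N := fun q =>
  {i | ∃ v ∈ listCut A N S t a q,
    ((N.biUnion (listCut A N S t a)).filter (· ≤ v)).card = i.val + 1}

/-- The numbers that disappear. -/
def listBad (S : Finset Q) (t : ListLabel N) (a : α) : Set ℕ :=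
  {v | v = N.card + 1 ∨ v ∈ listUsed N t ∧ v ∉ N.biUnion (listMid A N S t a)}

/-- The numbers at which a list is cut. -/
def listGood (S : Finset Q) (t : ListLabel N) (a : α) : Set ℕ :=
  {v | v = N.card + 1 ∨ ∃ q ∈ N, v ∈ listCut A N S t a q ∧
    ¬ IsMidList A N S t a ((listMid A N S t a q).filter (· ≤ v))}

def listColor (S : Finset Q) (t : ListLabel N) (a : α) : ℕ :=
  eventColor (listBad A N S t a) (listGood A N S t a)

end Lst

lemma eventColor_le {B G : Set ℕ} {k : ℕ} (hG : k + 1 ∈ G) : eventColor B G ≤ 2 * k + 2 :=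
  (min_le_right _ _).trans (by have := Nat.sInf_le hG; omega)

/-! ## The divide-and-conquer construction -/

section Divide

variable (A : NBA α Q)

/-- Macrostates: a pair `(P, O)` for the inherently weak components, and a labelling for each
deterministic and for each nondeterministic accepting component. -/
abbrev MacroState : Type :=
  (Finset {q // q ∈ weakStates A} × Finset {q // q ∈ weakAccStates A}) ×
    ((i : {i // i ∈ dacs A}) → NumLabel (scc A i)) ×
    ((j : {j // j ∈ nacs A}) → ListLabel (scc A j))

variable {A}

def MacroState.P (m : MacroState A) : Finset Q := m.1.1.map (Function.Embedding.subtype _)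

def MacroState.O (m : MacroState A) : Finset Q := m.1.2.map (Function.Embedding.subtype _)

def MacroState.g (m : MacroState A) (i : {i // i ∈ dacs A}) : NumLabel (scc A i) := m.2.1 i

def MacroState.t (m : MacroState A) (j : {j // j ∈ nacs A}) : ListLabel (scc A j) := m.2.2 j

open scoped Classical in
/-- The set of all states of `A` that are currently reached. -/
def MacroState.reached (m : MacroState A) : Finset Q :=
  {q | q ∈ m.P ∨ (∃ i, (m.g i).val q ≠ ⊤) ∨ ∃ j, (m.t j).val q ≠ ∅}

variable (A)

def macroInit : MacroState A :=
  ((Finset.univ.filter fun q => q.1 = A.init, ∅), fun i => numInit A (scc A i),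
    fun j => listInit A (scc A j))

def macroStep (m : MacroState A) (a : α) : MacroState A :=
  ((Finset.univ.filter fun q => q.1 ∈ A.post m.reached a,
    if m.O = ∅ then Finset.univ.filter fun q => q.1 ∈ A.post m.reached a
    else Finset.univ.filter fun q => q.1 ∈ A.post m.O a),
    fun i => numSucc A (scc A i) m.reached (m.g i) a,
    fun j => listSucc A (scc A j) m.reached (m.t j) a)

/-- The number of colors used by the weak components and the components listed before the
deterministic accepting component of `i`. -/
def dacBase (i : Q) : ℕ :=
  2 + ∑ h ∈ (dacs A).filter (· < i), (2 * (scc A h).card + 1)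

def nacBase (j : Q) : ℕ :=
  2 + ∑ h ∈ dacs A, (2 * (scc A h).card + 1) +
    ∑ h ∈ (nacs A).filter (· < j), (2 * (scc A h).card + 1)

/-- The largest color. -/
def maxColor : ℕ :=
  2 + ∑ h ∈ dacs A, (2 * (scc A h).card + 1) + ∑ h ∈ nacs A, (2 * (scc A h).card + 1)

/-- `⋁_{c = 1}^{n} (⋀_{j = 1}^{c} Fin(2j - 1 + b) ∧ Inf(2c + b))`. -/
def shiftedParityAcc (b n : ℕ) : AccFormula :=
  .bigOr ((List.range n).map fun c =>
    .and (.bigAnd ((List.range (c + 1)).map fun j => .fin (2 * j + 1 + b))) (.inf (2 * (c + 1) + b)))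

/-- The deterministic Emerson-Lei automaton of the divide-and-conquer construction. -/
def divideDELA : DELA α where
  State := MacroState A
  finite := inferInstance
  init := macroInit A
  step := macroStep A
  k := maxColor A
  color m a := {c | c ≤ maxColor A ∧ ((c = 1 ∧ m.O = ∅) ∨
    (∃ i : {i // i ∈ dacs A}, c = numColor A (scc A i) m.reached (m.g i) a + dacBase A i) ∨
    ∃ j : {j // j ∈ nacs A}, c = listColor A (scc A j) m.reached (m.t j) a + nacBase A j)}
  color_le _ _ _ h := h.1
  acc := .or (.fin 1) (.or
    (.bigOr (((dacs A).sort (· ≤ ·)).map fun i => shiftedParityAcc (dacBase A i) (scc A i).card))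
    (.bigOr (((nacs A).sort (· ≤ ·)).map fun j => shiftedParityAcc (nacBase A j) (scc A j).card)))

end Divide

/-! ## The construction of Esparza et al. for limit-deterministic automata

The macrostates consist of the reached states outside of the deterministic part `D` and of a ranking
of the reached states inside `D`, by the time of entering `D`. -/

def esparzaDPA (A : NBA α Q) (D : Finset Q) : DELA α where
  State := Finset {q // q ∉ D} × NumLabel D
  finite := inferInstance
  init := (Finset.univ.filter fun q => q.1 = A.init, numInit A D)
  step m a :=
    (Finset.univ.filter fun q => q.1 ∈ A.post (m.1.map (Function.Embedding.subtype _)) a,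
      numSucc A D (m.1.map (Function.Embedding.subtype _) ∪ D.filter fun q => m.2.val q ≠ ⊤) m.2 a)
  k := 2 * D.card + 2
  color m a := {numColor A D
    (m.1.map (Function.Embedding.subtype _) ∪ D.filter fun q => m.2.val q ≠ ⊤) m.2 a}
  color_le m a c h := by
    rw [Set.mem_singleton_iff.1 h]; exact eventColor_le (Or.inl rfl)
  acc := parityAcc (2 * D.card + 2)

/-! ## The construction of Redziejowski

The macrostates are the Safra-Piterman trees in bracket notation: each reached state has the list of
the numbers of the brackets around it. -/

def redziejowskiDPA (A : NBA α Q) : DELA α where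
  State := ListLabel (Finset.univ : Finset Q)
  finite := inferInstance
  init := listInit A Finset.univ
  step t a := listSucc A Finset.univ (Finset.univ.filter fun q => t.val q ≠ ∅) t a
  k := 2 * Fintype.card Q + 2
  color t a := {listColor A Finset.univ (Finset.univ.filter fun q => t.val q ≠ ∅) t a}
  color_le t a c h := by
    rw [Set.mem_singleton_iff.1 h]; exact eventColor_le (Or.inl rfl)
  acc := parityAcc (2 * Fintype.card Q + 2)

/-! ## Safra's and Piterman's constructions -/

/-- Ordered trees whose nodes are named by elements of `N` and labelled by sets of states. The nodes
are the names with nonempty label; the other names are unused. -/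
structure OTree (N Q : Type) where
  label : N → Finset Q
  /-- `child u v`: the node `v` is a child of `u`. -/
  child : N → N → Prop
  /-- `older v w`: the node `v` is an older sibling of `w`. -/
  older : N → N → Prop

instance {N : Type} [Finite N] : Finite (OTree N Q) :=
  Finite.of_injective (fun T : OTree N Q => (T.label, T.child, T.older)) <| by
    rintro ⟨l, c, o⟩ ⟨l', c', o'⟩ h
    simp only [Prod.mk.injEq] at h
    obtain ⟨rfl, rfl, rfl⟩ := h
    rfl

namespace OTree

variable {N M : Type}

/-- Each label is replaced by its successors, and each node gets a youngest child, labelled by the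
successors through accepting transitions. The new child of `v` is `Sum.inr v`. -/
def expand (A : NBA α Q) (a : α) (T : OTree N Q) : OTree (N ⊕ N) Q where
  label
    | .inl v => A.post (T.label v) a
    | .inr v => A.accPost (T.label v) a
  child
    | .inl u, .inl v => T.child u v
    | .inl u, .inr v => u = v
    | .inr _, _ => False
  older
    | .inl v, .inl w => T.older v w
    | .inl v, .inr u => T.child u v
    | .inr _, _ => False

open scoped Classical in
/-- A state that is in a node and in an older sibling of it is removed from the node and its
descendants. -/
def horizontal (T : OTree N Q) : OTree N Q where
  label v := (T.label v).filter fun q =>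
    ∀ u w, Relation.ReflTransGen T.child u v → T.older w u → q ∉ T.label w
  child := T.child
  older := T.older

/-- The node `v` is the union of its children. -/
def Full (T : OTree N Q) (v : N) : Prop :=
  (T.label v).Nonempty ∧ ∀ q ∈ T.label v, ∃ w, T.child v w ∧ q ∈ T.label w

open scoped Classical in
/-- The descendants of full nodes are removed. -/
def vertical (T : OTree N Q) : OTree N Q where
  label v := if ∃ u, Relation.TransGen T.child u v ∧ T.Full u then ∅ else T.label v
  child := T.child
  older := T.older

open scoped Classical in
/-- Nodes get new names; `nm x k` says that the node `x` gets the name `k`. Empty nodes vanish. -/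
def rename (nm : N → M → Prop) (T : OTree N Q) : OTree M Q where
  label k := {q | ∃ x, nm x k ∧ q ∈ T.label x}
  child k l := ∃ x y, nm x k ∧ nm y l ∧ (T.label x).Nonempty ∧ (T.label y).Nonempty ∧ T.child x y
  older k l := ∃ x y, nm x k ∧ nm y l ∧ (T.label x).Nonempty ∧ (T.label y).Nonempty ∧ T.older x y

/-- All steps but the renaming. -/
def update (A : NBA α Q) (a : α) (T : OTree N Q) : OTree (N ⊕ N) Q :=
  (T.expand A a).horizontal.vertical

/-- The old node `v` is full, and it is not removed by the vertical merging. -/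
def Marked (A : NBA α Q) (a : α) (T : OTree N Q) (v : N) : Prop :=
  (T.expand A a).horizontal.Full (.inl v) ∧ ((T.update A a).label (.inl v)).Nonempty

/-- The tree that consists of a root with label `{q}`. -/
def single (n : ℕ) (q : Q) : OTree (Fin n) Q where
  label k := if k.val = 0 then {q} else ∅
  child _ _ := False
  older _ _ := False

end OTree

/-- A deterministic transition system with `m` Rabin pairs: a word is accepted if for some `i` only
finitely many transitions are bad for `i` and infinitely many are good for `i`. -/
structure RabinSystem (α : Type) where
  State : Type
  finite : Finite State
  init : State
  step : State → α → State
  m : ℕ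
  m_pos : 0 < m
  bad : State → α → Fin m → Prop
  good : State → α → Fin m → Prop

/-- The system as a deterministic Rabin automaton. -/
def RabinSystem.toDRA (R : RabinSystem α) : DELA α where
  State := R.State
  finite := R.finite
  init := R.init
  step := R.step
  k := 2 * R.m - 1
  color s a := {c | ∃ i : Fin R.m,
    (c = 2 * i.val ∧ R.bad s a i) ∨ (c = 2 * i.val + 1 ∧ R.good s a i)}
  color_le := by
    rintro s a c ⟨i, h | h⟩ <;> have := i.isLt <;> omega
  acc := rabinAcc (2 * R.m - 1)

open scoped Classical in
/-- The system as a deterministic parity automaton: the states are extended by an index appearance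
record, where indices move to the back when they are bad. -/
def RabinSystem.toDPA (R : RabinSystem α) : DELA α where
  State := R.State × {l : List (Fin R.m) // l.Nodup}
  finite := by have := R.finite; infer_instance
  init := (R.init, ⟨List.finRange R.m, List.nodup_finRange R.m⟩)
  step s a := (R.step s.1 a,
    ⟨s.2.1.filter (fun i => ¬ R.bad s.1 a i) ++ s.2.1.filter (fun i => R.bad s.1 a i), by
      refine List.Nodup.append (s.2.2.filter _) (s.2.2.filter _) ?_
      intro x hx hy
      simp only [List.mem_filter, decide_eq_true_eq] at hx hy
      exact hx.2 hy.2⟩)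
  k := 2 * R.m + 2
  color s a := {min (2 * s.2.1.findIdx (fun i => R.bad s.1 a i) + 1)
    (2 * s.2.1.findIdx (fun i => R.good s.1 a i) + 2)}
  color_le s a c h := by
    rw [Set.mem_singleton_iff.1 h]
    have h1 := List.findIdx_le_length (p := fun i => decide (R.good s.1 a i)) (xs := s.2.1)
    have h2 := s.2.2.length_le_card
    rw [Fintype.card_fin] at h2
    exact (min_le_right _ _).trans (by omega)
  acc := parityAcc (2 * R.m + 2)

/-- Safra's names: the surviving nodes keep their names, and the new child of a node gets an unused
one of the `2 |Q|` names; the `i`-th new child in the order of the parents gets the `i`-th one. -/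
def safraName (T : OTree (Fin (2 * Fintype.card Q)) Q) :
    Fin (2 * Fintype.card Q) ⊕ Fin (2 * Fintype.card Q) → Fin (2 * Fintype.card Q) → Prop
  | .inl v, k => k = v
  | .inr v, k => T.label k = ∅ ∧ (T.label v).Nonempty ∧
      (Finset.univ.filter fun u => u < v ∧ (T.label u).Nonempty).card =
        (Finset.univ.filter fun u => u < k ∧ T.label u = ∅).card

/-- Safra's construction: a name is bad if it is not used by the next tree. -/
def safra (A : NBA α Q) : RabinSystem α where
  State := OTree (Fin (2 * Fintype.card Q)) Q
  finite := inferInstance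
  init := .single _ A.init
  step T a := (T.update A a).rename (safraName T)
  m := 2 * Fintype.card Q
  m_pos := by have := card_pos_of_nba A; omega
  bad T a k := ((T.update A a).rename (safraName T)).label k = ∅
  good T a k := T.Marked A a k

open scoped Classical in
/-- Piterman's names: the surviving nodes are numbered consecutively by age. -/
def pitermanName {n : ℕ} (T : OTree (Fin n ⊕ Fin n) Q) (x : Fin n ⊕ Fin n) (k : Fin n) : Prop :=
  (T.label x).Nonempty ∧
    (Finset.univ.filter fun y => Sum.Lex (· < ·) (· < ·) y x ∧ (T.label y).Nonempty).card = k.val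

/-- Piterman's construction. -/
def pitermanDPA (A : NBA α Q) : DELA α where
  State := OTree (Fin (Fintype.card Q)) Q
  finite := inferInstance
  init := .single _ A.init
  step T a := (T.update A a).rename (pitermanName (T.update A a))
  k := 2 * Fintype.card Q + 2
  color T a := {eventColor
    {e | e = Fintype.card Q + 1 ∨ ∃ v : Fin (Fintype.card Q), e = v.val + 1 ∧
      (T.label v).Nonempty ∧ (T.update A a).label (.inl v) = ∅}
    {f | f = Fintype.card Q + 1 ∨ ∃ v : Fin (Fintype.card Q), f = v.val + 1 ∧ T.Marked A a v}}
  color_le T a c h := by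
    rw [Set.mem_singleton_iff.1 h]; exact eventColor_le (Or.inl rfl)
  acc := parityAcc (2 * Fintype.card Q + 2)

/-! ## The construction of Kähler and Wilke

The macrostate after a finite word is the part of the reduced split tree that is alive at the
current level, with its unary paths contracted, in the style of Muller and Schupp. A node is green
if its path was just extended by an accepting transition, yellow if it has ever been green, and red
otherwise. -/

inductive NodeColor where
  | red | yellow | green

instance : Finite NodeColor :=
  Finite.of_injective (fun c : NodeColor => match c with
    | .red => (0 : Fin 3) | .yellow => 1 | .green => 2) <| by
    rintro (_ | _ | _) (_ | _ | _) <;> simp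

/-- Binary trees whose nodes are named by elements of `N` and colored, and whose leaves are labelled
by sets of states; exactly the leaves have a nonempty label. -/
structure SplitTree (N Q : Type) where
  label : N → Finset Q
  /-- `lson u v`: the node `v` is the left son of `u`. -/
  lson : N → N → Prop
  /-- `rson u v`: the node `v` is the right son of `u`. -/
  rson : N → N → Prop
  color : N → NodeColor

instance {N : Type} [Finite N] : Finite (SplitTree N Q) :=
  Finite.of_injective (fun T : SplitTree N Q => (T.label, T.lson, T.rson, T.color)) <| by
    rintro ⟨l, c, o, f⟩ ⟨l', c', o', f'⟩ h
    simp only [Prod.mk.injEq] at h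
    obtain ⟨rfl, rfl, rfl, rfl⟩ := h
    rfl

namespace SplitTree

variable {N M : Type}

def son (T : SplitTree N Q) (u v : N) : Prop := T.lson u v ∨ T.rson u v

/-- `v` is a descendant of `u`, or `u` itself. -/
def desc (T : SplitTree N Q) : N → N → Prop := Relation.ReflTransGen T.son

/-- The name is used. -/
def Present (T : SplitTree N Q) (u : N) : Prop := (T.label u).Nonempty ∨ ∃ v, T.son u v

/-- Each leaf gets two sons: the left one (`true`) is labelled by the successors through accepting
transitions, the right one (`false`) by all successors. -/
def expand (A : NBA α Q) (a : α) (T : SplitTree N Q) : SplitTree (N ⊕ N × Bool) Q where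
  label
    | .inl _ => ∅
    | .inr (v, true) => A.accPost (T.label v) a
    | .inr (v, false) => A.post (T.label v) a
  lson
    | .inl u, .inl v => T.lson u v
    | .inl u, .inr (v, b) => u = v ∧ b = true ∧ (T.label u).Nonempty
    | .inr _, _ => False
  rson
    | .inl u, .inl v => T.rson u v
    | .inl u, .inr (v, b) => u = v ∧ b = false ∧ (T.label u).Nonempty
    | .inr _, _ => False
  color
    | .inl v => match T.color v with
      | .red => .red
      | _ => .yellow
    | .inr (_, true) => .green
    | .inr (_, false) => .red

/-- `x` is to the left of `y`. -/
def leftOf (T : SplitTree N Q) (x y : N) : Prop :=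
  ∃ u l r, T.lson u l ∧ T.rson u r ∧ T.desc l x ∧ T.desc r y

open scoped Classical in
/-- A state that occurs in several leaves is kept only in the leftmost one. -/
def reduce (T : SplitTree N Q) : SplitTree N Q where
  label x := (T.label x).filter fun q => ∀ y, T.leftOf y x → q ∉ T.label y
  lson := T.lson
  rson := T.rson
  color := T.color

/-- Some leaf below `x` is nonempty. -/
def Live (T : SplitTree N Q) (x : N) : Prop := ∃ y, T.desc x y ∧ (T.label y).Nonempty

/-- `y` is the only live son of `x`. -/
def unary (T : SplitTree N Q) (x y : N) : Prop :=
  T.son x y ∧ T.Live y ∧ ∀ z, T.son x z → T.Live z → z = y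

/-- The node `x` is live and it is not the only live son of its father. -/
def Kept (T : SplitTree N Q) (x : N) : Prop := T.Live x ∧ ¬ ∃ p, T.unary p x

open scoped Classical in
/-- Dead nodes are removed and unary paths are contracted to their topmost node, which becomes green
if one of the nodes contracted to it is green or yellow. -/
def contract (T : SplitTree N Q) : SplitTree N Q where
  label x := {q | T.Kept x ∧ ∃ y, Relation.ReflTransGen T.unary x y ∧ q ∈ T.label y}
  lson x z := T.Kept x ∧ T.Kept z ∧ ∃ y, Relation.ReflTransGen T.unary x y ∧ T.lson y z
  rson x z := T.Kept x ∧ T.Kept z ∧ ∃ y, Relation.ReflTransGen T.unary x y ∧ T.rson y z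
  color x :=
    if T.Kept x then
      if ∃ y, Relation.TransGen T.unary x y ∧ T.color y ≠ .red then .green else T.color x
    else .red

open scoped Classical in
/-- Nodes get new names; `nm x k` says that the node `x` gets the name `k`. -/
def rename (nm : N → M → Prop) (T : SplitTree N Q) : SplitTree M Q where
  label k := {q | ∃ x, nm x k ∧ q ∈ T.label x}
  lson k l := ∃ x y, nm x k ∧ nm y l ∧ T.lson x y
  rson k l := ∃ x y, nm x k ∧ nm y l ∧ T.rson x y
  color k :=
    if ∃ x, nm x k ∧ T.color x = .green then .green
    else if ∃ x, nm x k ∧ T.color x = .yellow then .yellow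
    else .red

open scoped Classical in
/-- The surviving nodes keep their names, and the new sons of the leaves get unused names, in the
order of the leaves and the left son before the right one. -/
def name {n : ℕ} (T : SplitTree (Fin n) Q) : Fin n ⊕ Fin n × Bool → Fin n → Prop
  | .inl v, k => k = v
  | .inr (v, b), k => ¬ T.Present k ∧ (T.label v).Nonempty ∧
      2 * (Finset.univ.filter fun u => u < v ∧ (T.label u).Nonempty).card +
          (if b then 0 else 1) =
        (Finset.univ.filter fun u => u < k ∧ ¬ T.Present u).card

def next {n : ℕ} (A : NBA α Q) (a : α) (T : SplitTree (Fin n) Q) : SplitTree (Fin n) Q :=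
  (T.expand A a).reduce.contract.rename T.name

end SplitTree

/-- The construction of Kähler and Wilke: a name is bad if it is not used by the next tree, and good
if it is green there. -/
def kahlerWilke (A : NBA α Q) : RabinSystem α where
  State := SplitTree (Fin (4 * Fintype.card Q)) Q
  finite := inferInstance
  init :=
    { label := fun k => if k.val = 0 then {A.init} else ∅
      lson := fun _ _ => False
      rson := fun _ _ => False
      color := fun _ => .red }
  step T a := T.next A a
  m := 4 * Fintype.card Q
  m_pos := by have := card_pos_of_nba A; omega
  bad T a k := ¬ (T.next A a).Present k
  good T a k := (T.next A a).color k = .green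

/-! ## The construction of Löding and Pirogov

The macrostates are ranked slices: tuples of disjoint nonempty sets of states with distinct ranks.
On reading a letter each set is split into its successors through accepting transitions (left) and
the other ones (right), which takes over the rank; then neighboring sets may be merged. -/

/-- `set r` is the set with rank `r` (empty if the rank is unused); `before r s` says that it is to
the left of the set with rank `s`. -/
structure Slice (N Q : Type) where
  set : N → Finset Q
  before : N → N → Prop

instance {N : Type} [Finite N] : Finite (Slice N Q) :=
  Finite.of_injective (fun T : Slice N Q => (T.set, T.before)) <| by
    rintro ⟨l, c⟩ ⟨l', c'⟩ h
    simp only [Prod.mk.injEq] at h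
    obtain ⟨rfl, rfl⟩ := h
    rfl

namespace Slice

variable {N : Type}

open scoped Classical in
/-- The split slice: `Sum.inr r` is the left part and `Sum.inl r` the right part of the set with
rank `r`. A state that occurs in several sets is kept only in the leftmost one. -/
def split (A : NBA α Q) (a : α) (T : Slice N Q) : Slice (N ⊕ N) Q where
  set
    | .inl r => (A.post (T.set r) a).filter fun q =>
        q ∉ A.accPost (T.set r) a ∧ ∀ s, T.before s r → q ∉ A.post (T.set s) a
    | .inr r => (A.accPost (T.set r) a).filter fun q =>
        ∀ s, T.before s r → q ∉ A.post (T.set s) a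
  before
    | .inl r, .inl s => T.before r s
    | .inl r, .inr s => T.before r s
    | .inr r, .inl s => r = s ∨ T.before r s
    | .inr r, .inr s => T.before r s

variable [LT N]

/-- `x` has smaller rank than `y` in the split slice: right parts keep the ranks; left parts get
larger ranks, from left to right. -/
def rankLT (T : Slice N Q) : N ⊕ N → N ⊕ N → Prop
  | .inl r, .inl s => r < s
  | .inl _, .inr _ => True
  | .inr _, .inl _ => False
  | .inr r, .inr s => T.before r s

/-- `y` is in the subtree of `x`: it is `x`, or it is to the left of `x`, and all sets from `y` on
and before `x` have larger rank than `x`. -/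
def subtree (A : NBA α Q) (a : α) (T : Slice N Q) (x y : N ⊕ N) : Prop :=
  y = x ∨ (T.split A a).before y x ∧
    ∀ z, (z = y ∨ (T.split A a).before y z) → (T.split A a).before z x → T.rankLT x z

/-- Some set in the subtree of `x` is nonempty. -/
def Alive (A : NBA α Q) (a : α) (T : Slice N Q) (x : N ⊕ N) : Prop :=
  ∃ y, T.subtree A a x y ∧ ((T.split A a).set y).Nonempty

/-- The old rank `r` dies. -/
def Bad (A : NBA α Q) (a : α) (T : Slice N Q) (r : N) : Prop :=
  (T.set r).Nonempty ∧ ¬ T.Alive A a (.inl r)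

/-- The set with the old rank `r` gets empty, but its subtree does not. -/
def Good (A : NBA α Q) (a : α) (T : Slice N Q) (r : N) : Prop :=
  (T.set r).Nonempty ∧ (T.split A a).set (.inl r) = ∅ ∧ T.Alive A a (.inl r)

/-- The relation `m` is an admissible merging: it is an equivalence relation on the alive sets with
convex classes, the union of each class is nonempty, and, for the least bad or good rank `k`, each
merged class consists of sets with rank larger than `k`, or of such sets and, at its right end, the
set with rank `k` itself. -/
structure Admissible (A : NBA α Q) (a : α) (T : Slice N Q) (m : N ⊕ N → N ⊕ N → Prop) : Prop where
  refl : ∀ x, T.Alive A a x → m x x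
  symm : ∀ x y, T.Alive A a x → T.Alive A a y → m x y → m y x
  trans : ∀ x y z, T.Alive A a x → T.Alive A a y → T.Alive A a z → m x y → m y z → m x z
  convex : ∀ x y z, T.Alive A a x → T.Alive A a y → T.Alive A a z → m x z →
    (T.split A a).before x y → (T.split A a).before y z → m x y
  nonempty : ∀ x, T.Alive A a x → ∃ y, T.Alive A a y ∧ m x y ∧ ((T.split A a).set y).Nonempty
  rank : ∀ x y, T.Alive A a x → T.Alive A a y → m x y → (T.split A a).before x y →
    ∃ r, (T.Bad A a r ∨ T.Good A a r) ∧ T.rankLT (.inl r) x ∧ (y = .inl r ∨ T.rankLT (.inl r) y)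

/-- The default merging, which collapses the subtrees of the good ranks. -/
def collapse (A : NBA α Q) (a : α) (T : Slice N Q) (x y : N ⊕ N) : Prop :=
  x = y ∨ ∃ r, T.Good A a r ∧ T.subtree A a (.inl r) x ∧ T.subtree A a (.inl r) y

/-- The merging that is done, when `m` is proposed: `m` if it is admissible. -/
def merging (A : NBA α Q) (a : α) (T : Slice N Q) (m : N ⊕ N → N ⊕ N → Prop) (x y : N ⊕ N) : Prop :=
  (T.Admissible A a m ∧ m x y) ∨ (¬ T.Admissible A a m ∧ T.collapse A a x y)

/-- `x` has the least rank in its class. -/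
def ClassMin (A : NBA α Q) (a : α) (T : Slice N Q) (m : N ⊕ N → N ⊕ N → Prop) (x : N ⊕ N) : Prop :=
  T.Alive A a x ∧ ∀ y, T.Alive A a y → T.merging A a m x y → y = x ∨ T.rankLT x y

/-- The class of `z` gets the new rank `k`: the classes are ranked by the least rank in them. -/
def NewRank {n : ℕ} (A : NBA α Q) (a : α) (T : Slice (Fin n) Q)
    (m : Fin n ⊕ Fin n → Fin n ⊕ Fin n → Prop) (z : Fin n ⊕ Fin n) (k : Fin n) : Prop :=
  T.Alive A a z ∧ ∃ x, T.ClassMin A a m x ∧ T.merging A a m x z ∧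
    {y | T.ClassMin A a m y ∧ T.rankLT y x}.ncard = k.val

open scoped Classical in
def next {n : ℕ} (A : NBA α Q) (a : α) (T : Slice (Fin n) Q)
    (m : Fin n ⊕ Fin n → Fin n ⊕ Fin n → Prop) : Slice (Fin n) Q where
  set k := {q | ∃ z, T.NewRank A a m z k ∧ q ∈ (T.split A a).set z}
  before k l := k ≠ l ∧ ∃ z w, T.NewRank A a m z k ∧ T.NewRank A a m w l ∧ (T.split A a).before z w

end Slice

/-- A merging strategy: it proposes a merging for each ranked slice and each letter. -/
abbrev MergeStrategy (α Q : Type) [Fintype Q] : Type :=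
  Slice (Fin (Fintype.card Q)) Q → α →
    Fin (Fintype.card Q) ⊕ Fin (Fintype.card Q) → Fin (Fintype.card Q) ⊕ Fin (Fintype.card Q) → Prop

/-- The instance of the construction of Löding and Pirogov for a merging strategy. -/
def lodingPirogovDPA (A : NBA α Q) (σ : MergeStrategy α Q) : DELA α where
  State := Slice (Fin (Fintype.card Q)) Q
  finite := inferInstance
  init :=
    { set := fun k => if k.val = 0 then {A.init} else ∅
      before := fun _ _ => False }
  step T a := T.next A a (σ T a)
  k := 2 * Fintype.card Q + 2
  color T a := {eventColor
    {e | e = Fintype.card Q + 1 ∨ ∃ r : Fin (Fintype.card Q), e = r.val + 1 ∧ T.Bad A a r}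
    {f | f = Fintype.card Q + 1 ∨ ∃ r : Fin (Fintype.card Q), f = r.val + 1 ∧ T.Good A a r}}
  color_le T a c h := by
    rw [Set.mem_singleton_iff.1 h]; exact eventColor_le (Or.inl rfl)
  acc := parityAcc (2 * Fintype.card Q + 2)

end Rest

end

end BuchiDet

/-! The automaton `permNBA n` consists of the initial state `0`, an inert state `1` and the states
`loopState i` for `i < n`. On the letter `0` the initial state spreads to all states. On `i + 1` it
stays and also moves to `loopState i`, whose self-loop is the only accepting transition with that
letter. All other transitions are rejecting self-loops.

Lower bounds. For a permutation of `Fin n`, read the letters `i + 1` in its order, after one letter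
`0` in all constructions except that of Esparza et al. Each letter singles out one loop state from
the set that contains `0`, and it changes nothing else. The classical constructions must rank what
they single out, so the macrostate records the whole permutation: as the time of entering the
deterministic part (`EsparzaInv`), as the second number of a list (`ListInv`), as the age of a child
of the root (`StarInv`, for Safra and Piterman), as the left-to-right order of the leaves
(`CombInv`), or as a rank (`SliceInv`). These shapes are stable because nothing is ever merged, cut
or removed. In the tree and slice constructions the state `0` stays behind in the root or special
set and is in no set that is split off. Hence that set is never exhausted, there are no full nodes
and no empty sets, and for Löding and Pirogov no bad or good ranks, so that the merging strategy has
no influence. `factorial_le_ncard_reachable` turns such an invariant into `n!` distinct reachable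
states. The index appearance records only refine the Rabin automata, so those bounds carry over to
the parity automata by projection (`RabinSystem.ncard_reachable_toDRA_le`).

Upper bound. All maximal strongly connected components are singletons (`permNBA_scc`). Divide and
conquer therefore never ranks two loop states against each other, and each state contributes at most
one binary choice to a macrostate (`permNBA_card_macroState`). -/

namespace BuchiDet

/-! ## Counting reachable states -/

section Counting

/-- If reading letters that belong to a duplicate-free list produces states from which the order of
the list can be read off, then there are at least `n!` reachable states. -/
lemma factorial_le_ncard_reachable {α : Type} {n : ℕ} (B : DELA α) (e : Fin n → α)
    (s₀ : B.State) (h₀ : s₀ ∈ B.reachable) (Inv : List (Fin n) → B.State → Prop)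
    (R : B.State → Fin n → Fin n → Prop) (hinit : Inv [] s₀)
    (hstep : ∀ l i s, l.Nodup → i ∉ l → Inv l s → Inv (l ++ [i]) (B.step s (e i)))
    (hR : ∀ l s, l.Nodup → Inv l s → l.Pairwise (R s))
    (hasymm : ∀ l s, l.Nodup → Inv l s → ∀ i j, R s i j → ¬ R s j i) :
    n.factorial ≤ B.reachable.ncard := by
  have := B.finite
  have key : ∀ l : List (Fin n), l.Nodup → ∃ s ∈ B.reachable, Inv l s := by
    intro l
    induction l using List.reverseRecOn with
    | nil => exact fun _ => ⟨s₀, h₀, hinit⟩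
    | append_singleton l i ih =>
      intro hl
      rw [← List.concat_eq_append, List.nodup_concat] at hl
      obtain ⟨s, hs, hi⟩ := ih hl.2
      exact ⟨_, Relation.ReflTransGen.tail hs ⟨e i, rfl⟩, hstep l i s hl.2 hl.1 hi⟩
  have hnd : ∀ σ : Equiv.Perm (Fin n), (List.ofFn σ).Nodup := fun σ =>
    List.nodup_ofFn.2 σ.injective
  choose f hf using fun σ : Equiv.Perm (Fin n) => key _ (hnd σ)
  have hinj : Function.Injective f := by
    intro σ τ h
    -- Both lists enumerate all of `Fin n`, so each is a rearrangement of the other. Being sorted by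
    -- the same asymmetric relation then makes them equal; transitivity is not needed.
    have hp : (List.ofFn σ).Perm (List.ofFn τ) := by
      refine (List.perm_ext_iff_of_nodup (hnd σ) (hnd τ)).2 fun a => ?_
      simp only [List.mem_ofFn]
      exact ⟨fun _ => τ.surjective a, fun _ => σ.surjective a⟩
    have h1 := hR _ _ (hnd σ) (hf σ).2
    have h2 := hR _ _ (hnd τ) (hf τ).2
    rw [← h] at h2
    have := hp.eq_of_pairwise
      (fun i j _ _ hij hji => absurd hji (hasymm _ _ (hnd σ) (hf σ).2 i j hij)) h1 h2
    exact Equiv.coe_fn_injective (List.ofFn_injective this)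
  calc n.factorial = Nat.card (Equiv.Perm (Fin n)) := by simp [Fintype.card_perm]
    _ = (Set.range f).ncard := by
      rw [← Set.image_univ, Set.ncard_image_of_injective _ hinj, Set.ncard_univ]
    _ ≤ B.reachable.ncard := Set.ncard_le_ncard (by rintro _ ⟨σ, rfl⟩; exact (hf σ).1)
      (Set.toFinite _)

lemma DELA.init_mem_reachable {α : Type} (B : DELA α) : B.init ∈ B.reachable :=
  Relation.ReflTransGen.refl

lemma DELA.step_init_mem_reachable {α : Type} (B : DELA α) (a : α) :
    B.step B.init a ∈ B.reachable :=
  Relation.ReflTransGen.single ⟨a, rfl⟩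

/-- The index appearance records do not identify states. -/
lemma RabinSystem.ncard_reachable_toDRA_le {α : Type} (R : RabinSystem α) :
    R.toDRA.reachable.ncard ≤ R.toDPA.reachable.ncard := by
  have hfin : R.toDPA.reachable.Finite :=
    @Set.toFinite _ _ (@Subtype.finite _ R.toDPA.finite _)
  have h : R.toDRA.reachable ⊆ Prod.fst '' R.toDPA.reachable := by
    intro s hs
    induction hs with
    | refl => exact ⟨R.toDPA.init, Relation.ReflTransGen.refl, rfl⟩
    | tail _ h ih =>
      obtain ⟨a, rfl⟩ := h
      obtain ⟨t, ht, rfl⟩ := ih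
      exact ⟨_, Relation.ReflTransGen.tail ht ⟨a, rfl⟩, rfl⟩
  exact (Set.ncard_le_ncard h (hfin.image _)).trans (Set.ncard_image_le hfin)

lemma RabinSystem.isDRA_toDRA {α : Type} (R : RabinSystem α) : R.toDRA.IsDRA :=
  -- The truncated difference `2 * R.m - 1` is odd only because `R.m` is positive.
  ⟨⟨R.m - 1, by have := R.m_pos; change 2 * R.m - 1 = _; omega⟩, rfl⟩

lemma RabinSystem.isDPA_toDPA {α : Type} (R : RabinSystem α) : R.toDPA.IsDPA :=
  ⟨⟨R.m + 1, by change 2 * R.m + 2 = _; omega⟩, rfl⟩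

end Counting

/-! ## The family of automata -/

/-- The initial state `0` goes to all states on the letter `0` and can enter the state `a + 1` on
the letter `a`. All other states have self-loops only; the one at `a + 1` is accepting exactly on
the letter `a`, for `a ≠ 0`. -/
def permNBA (n : ℕ) : NBA (Fin (n + 1)) (Fin (n + 2)) where
  init := 0
  δ q a := if q = 0 then if a = 0 then Finset.univ else {0, a.succ} else {q}
  F q a := if a ≠ 0 ∧ q = a.succ then {q} else ∅
  F_subset q a := by
    split_ifs with h h1 h2 h3 <;> simp_all

section Family

variable {n : ℕ}

/-- The state that has an accepting loop on the letter `i + 1`. -/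
abbrev loopState (i : Fin n) : Fin (n + 2) := i.succ.succ

lemma permNBA_δ_zero_zero : (permNBA n).δ 0 0 = Finset.univ := rfl

lemma permNBA_δ_zero_succ (i : Fin n) : (permNBA n).δ 0 i.succ = {0, loopState i} := by
  simp [permNBA]

lemma permNBA_δ_of_ne {q : Fin (n + 2)} (hq : q ≠ 0) (a : Fin (n + 1)) :
    (permNBA n).δ q a = {q} := by
  simp [permNBA, hq]

lemma self_mem_permNBA_δ (q : Fin (n + 2)) (a : Fin (n + 1)) : q ∈ (permNBA n).δ q a := by
  by_cases hq : q = 0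
  · subst hq
    simp only [permNBA, if_true]
    split_ifs <;> simp
  · simp [permNBA_δ_of_ne hq]

lemma permNBA_F_zero (q : Fin (n + 2)) : (permNBA n).F q 0 = ∅ := by simp [permNBA]

lemma permNBA_F_succ (q : Fin (n + 2)) (i : Fin n) :
    (permNBA n).F q i.succ = if q = loopState i then {q} else ∅ := by
  simp [permNBA]

lemma mem_permNBA_F {p q : Fin (n + 2)} {a : Fin (n + 1)} :
    q ∈ (permNBA n).F p a ↔ a ≠ 0 ∧ p = a.succ ∧ q = p := by
  simp only [permNBA]
  split_ifs with h
  · simp [h]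
  · simp only [Finset.notMem_empty, false_iff]
    tauto

lemma permNBA_complete (n : ℕ) : (permNBA n).Complete := fun q a => ⟨q, self_mem_permNBA_δ q a⟩

lemma permNBA_isLimitDeterministic (n : ℕ) :
    (permNBA n).IsLimitDeterministic (Finset.univ.erase 0) := by
  refine ⟨fun q hq a => ?_, fun q a h => ?_⟩
  · rw [permNBA_δ_of_ne (Finset.ne_of_mem_erase hq)]
    simpa using hq
  · obtain ⟨p, hp⟩ := h
    have hq : q ≠ 0 := by
      rw [(mem_permNBA_F.1 hp).2.1]; exact Fin.succ_ne_zero _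
    refine ⟨by simp [hq], fun r hr => ?_⟩
    rw [(mem_permNBA_F.1 hr).2.2]
    simp [hq]

/-- On the letter `0` the state `0` has `n + 2 ≥ 2` successors. Together with `loopState_mem` this
determines every admissible part up to the state `1`, which is not reached on words without the
letter `0`. -/
lemma NBA.IsLimitDeterministic.zero_notMem {D : Finset (Fin (n + 2))}
    (hD : (permNBA n).IsLimitDeterministic D) : 0 ∉ D := by
  intro h
  have := (hD.1 0 h 0).1
  rw [permNBA_δ_zero_zero, Finset.card_univ, Fintype.card_fin] at this
  omega

lemma NBA.IsLimitDeterministic.loopState_mem {D : Finset (Fin (n + 2))}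
    (hD : (permNBA n).IsLimitDeterministic D) (i : Fin n) : loopState i ∈ D :=
  (hD.2 (loopState i) i.succ ⟨loopState i, by simp [permNBA_F_succ]⟩).1

/-! ### Successors of sets of states -/

lemma permNBA_post_zero {S : Finset (Fin (n + 2))} (h : 0 ∈ S) :
    (permNBA n).post S 0 = Finset.univ :=
  Finset.eq_univ_of_forall fun q =>
    Finset.mem_biUnion.2 ⟨0, h, by simp [permNBA_δ_zero_zero]⟩

lemma mem_permNBA_post_succ {S : Finset (Fin (n + 2))} (i : Fin n) {q : Fin (n + 2)} :
    q ∈ (permNBA n).post S i.succ ↔ q ∈ S ∨ 0 ∈ S ∧ q = loopState i := by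
  simp only [NBA.post, Finset.mem_biUnion]
  constructor
  · rintro ⟨p, hp, hq⟩
    by_cases h0 : p = 0
    · subst h0
      rw [permNBA_δ_zero_succ, Finset.mem_insert, Finset.mem_singleton] at hq
      rcases hq with rfl | rfl
      · exact Or.inl hp
      · exact Or.inr ⟨hp, rfl⟩
    · rw [permNBA_δ_of_ne h0, Finset.mem_singleton] at hq
      exact Or.inl (hq ▸ hp)
  · rintro (h | ⟨h, rfl⟩)
    · exact ⟨q, h, self_mem_permNBA_δ q _⟩
    · exact ⟨0, h, by simp [permNBA_δ_zero_succ]⟩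

/-- Apart from self-loops, the letter `i + 1` only has the transition from `0` to `loopState i`.
This is why the letters of a permutation leave the sets in a macrostate unchanged, up to what is
split off through accepting transitions. -/
lemma permNBA_post_succ {S : Finset (Fin (n + 2))} {i : Fin n} (h : 0 ∈ S → loopState i ∈ S) :
    (permNBA n).post S i.succ = S := by
  ext q
  rw [mem_permNBA_post_succ]
  exact ⟨by rintro (h1 | ⟨h1, rfl⟩); exacts [h1, h h1], Or.inl⟩

lemma permNBA_accPost_zero (S : Finset (Fin (n + 2))) : (permNBA n).accPost S 0 = ∅ := by
  ext q; simp [NBA.accPost, permNBA_F_zero]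

lemma mem_permNBA_accPost_succ {S : Finset (Fin (n + 2))} {i : Fin n} {q : Fin (n + 2)} :
    q ∈ (permNBA n).accPost S i.succ ↔ q = loopState i ∧ loopState i ∈ S := by
  simp only [NBA.accPost, Finset.mem_biUnion, mem_permNBA_F]
  constructor
  · rintro ⟨p, hp, -, rfl, rfl⟩
    exact ⟨rfl, hp⟩
  · rintro ⟨rfl, h⟩
    exact ⟨_, h, Fin.succ_ne_zero _, rfl, rfl⟩

lemma permNBA_accPost_of_mem {S : Finset (Fin (n + 2))} {i : Fin n} (h : loopState i ∈ S) :
    (permNBA n).accPost S i.succ = {loopState i} := by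
  ext q; simp [mem_permNBA_accPost_succ, h]

lemma permNBA_accPost_of_notMem {S : Finset (Fin (n + 2))} {i : Fin n} (h : loopState i ∉ S) :
    (permNBA n).accPost S i.succ = ∅ := by
  ext q; simp [mem_permNBA_accPost_succ, h]

/-! ### The divide-and-conquer construction -/

/-- Every transition that is not a self-loop leaves `0`, and no other state leads back to `0`. Hence
no two states are mutually reachable. -/
lemma permNBA_reach {p q : Fin (n + 2)} (h : Reach (permNBA n) p q) : p = 0 ∨ q = p := by
  induction h with
  | refl => exact Or.inr rfl
  | tail _ h ih =>
    obtain ⟨a, ha⟩ := h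
    rcases ih with h0 | ih
    · exact Or.inl h0
    · rw [ih] at ha
      by_cases h0 : p = 0
      · exact Or.inl h0
      · rw [permNBA_δ_of_ne h0, Finset.mem_singleton] at ha
        exact Or.inr ha

lemma permNBA_scc (q : Fin (n + 2)) : scc (permNBA n) q = {q} := by
  ext p
  simp only [scc, Finset.mem_filter, Finset.mem_univ, true_and, Finset.mem_singleton]
  constructor
  · rintro ⟨h1, h2⟩
    have h1 := permNBA_reach h1
    have h2 := permNBA_reach h2
    grind
  · rintro rfl
    exact ⟨Relation.ReflTransGen.refl, Relation.ReflTransGen.refl⟩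

/-- The component of an accepting transition is a single loop state. It also has a rejecting
self-loop, on the letter `0`, so its cycles are of both kinds. -/
lemma permNBA_weakAccStates : weakAccStates (permNBA n) = ∅ := by
  ext q
  simp only [weakAccStates, Finset.mem_filter, Finset.mem_univ, true_and, Finset.notMem_empty,
    iff_false, not_and, permNBA_scc]
  rintro hw ⟨p, hp, a, p', hF, -⟩
  rw [Finset.mem_singleton] at hp
  subst hp
  obtain ⟨ha, rfl, rfl⟩ := mem_permNBA_F.1 hF
  rcases hw with h | h
  · refine h _ (Finset.mem_singleton_self _) (Relation.TransGen.single ⟨0, ?_, ?_⟩)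
    · exact self_mem_permNBA_δ _ _
    · simp [permNBA_F_zero]
  · exact h _ (Finset.mem_singleton_self _)
      ⟨_, a, _, hF, Relation.ReflTransGen.refl, Relation.ReflTransGen.refl⟩

/-- A singleton component leaves room for only one internal successor per letter. -/
lemma permNBA_nacs : nacs (permNBA n) = ∅ := by
  classical
  refine Finset.eq_empty_of_forall_notMem fun q hq => ?_
  obtain ⟨-, -, -, h⟩ := (Finset.mem_filter.1 hq).2
  rw [permNBA_scc] at h
  exact h fun p _ a => (Finset.card_le_card Finset.inter_subset_right).trans (by simp)

/-- What remains of a macrostate is a subset `P` of the weak states and, for each deterministic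
accepting component, a labelling of a singleton, which is either the number `1` or `∞`. A state
cannot be weak and represent a DAC at the same time, so the number of binary choices is at most the
number of states. -/
lemma permNBA_card_macroState :
    Nat.card (MacroState (permNBA n)) ≤ 2 ^ (n + 2) := by
  have hN : IsEmpty {j // j ∈ nacs (permNBA n)} := 
    Finset.isEmpty_coe_sort.2 permNBA_nacs
  have hW : IsEmpty {j // j ∈ weakAccStates (permNBA n)} := 
    Finset.isEmpty_coe_sort.2 permNBA_weakAccStates
  have hdisj : Disjoint (weakStates (permNBA n)) (dacs (permNBA n)) := by
    rw [Finset.disjoint_left]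
    intro q hq hq'
    classical
    exact (Finset.mem_filter.1 hq').2.2.1 (Finset.mem_filter.1 hq).2
  have hcard : (weakStates (permNBA n)).card + (dacs (permNBA n)).card ≤ n + 2 := by
    rw [← Finset.card_union_of_disjoint hdisj]
    exact (Finset.card_le_univ _).trans (by simp)
  have hd : ∀ i : {i // i ∈ dacs (permNBA n)},
      Nat.card (NumLabel (scc (permNBA n) i)) = 2 := by
    intro i
    rw [permNBA_scc]
    simp
  rw [Nat.card_prod, Nat.card_prod, Nat.card_prod, Nat.card_pi, Nat.card_pi,
    Finset.prod_congr rfl fun i _ => hd i, Finset.prod_const, Finset.univ_eq_empty (α := {j // j ∈ nacs (permNBA n)}),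
    Finset.prod_empty]
  simp only [Nat.card_eq_fintype_card, Fintype.card_finset, Fintype.card_coe, Finset.card_univ,
    permNBA_weakAccStates, Finset.card_empty, pow_zero, mul_one]
  rw [← pow_add]
  exact Nat.pow_le_pow_right (by norm_num) hcard

end Family

/-! ## The construction of Esparza et al. -/

section NumLabel

variable {α Q : Type} [LinearOrder Q] (A : NBA α Q) (D : Finset Q)

lemma numSucc_val {S : Finset Q} {g : NumLabel D} {a : α} {q : Q} (hq : q ∈ D)
    (h : numMid A D S g a q ≠ ⊤) :
    (numSucc A D S g a).val q =
      ((((numMidValues A D S g a).filter fun v => v < numMid A D S g a q).card + 1 : ℕ) : ℕ∞) := by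
  simp [NumLabel.val, hq, numSucc, h]

lemma numSucc_val_ne_top_iff {S : Finset Q} {g : NumLabel D} {a : α} {q : Q} (hq : q ∈ D) :
    (numSucc A D S g a).val q ≠ ⊤ ↔ numMid A D S g a q ≠ ⊤ := by
  by_cases h : numMid A D S g a q = ⊤
  · simp [NumLabel.val, hq, numSucc, h]
  · rw [numSucc_val A D hq h]
    exact ⟨fun _ => h, fun _ => ENat.natCast_ne_top _⟩

/-- The new number counts the smaller used numbers, and the number of `p` is counted for `q` but not
for `p` itself. So compression preserves strict order. -/
lemma numSucc_val_lt {S : Finset Q} {g : NumLabel D} {a : α} {p q : Q} (hp : p ∈ D) (hq : q ∈ D)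
    (h : numMid A D S g a p < numMid A D S g a q) (hq' : numMid A D S g a q ≠ ⊤) :
    (numSucc A D S g a).val p < (numSucc A D S g a).val q := by
  rw [numSucc_val A D hp h.ne_top, numSucc_val A D hq hq', Nat.cast_lt, Nat.succ_lt_succ_iff]
  refine Finset.card_lt_card (Finset.ssubset_iff_of_subset ?_ |>.2
    ⟨numMid A D S g a p, ?_, ?_⟩)
  · exact Finset.monotone_filter_right _ fun v _ hv => lt_trans hv h
  · exact Finset.mem_filter.2
      ⟨Finset.mem_image_of_mem _ (Finset.mem_filter.2 ⟨hp, h.ne_top⟩), h⟩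
  · exact fun hm => lt_irrefl _ (Finset.mem_filter.1 hm).2

lemma NumLabel.val_le {g : NumLabel D} {q : Q} (h : g.val q ≠ ⊤) : g.val q ≤ D.card := by
  unfold NumLabel.val at h ⊢
  split_ifs with hq
  · rw [dif_pos hq] at h
    split
    · rename_i i _
      exact Nat.cast_le.2 i.isLt
    · rename_i hn
      simp [hn] at h
  · rw [dif_neg hq] at h
    exact absurd rfl h

/-- A state without other predecessors in `D` than itself keeps its number. -/
lemma numMid_eq_val {S : Finset Q} {g : NumLabel D} {a : α} {q : Q} (hq : q ∈ D)
    (hS : q ∈ A.post S a) (h : numPreds A D g a q = {q}) : numMid A D S g a q = g.val q := by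
  simp [numMid, hq, hS, h]

lemma numMid_eq_top {S : Finset Q} {g : NumLabel D} {a : α} {q : Q} (hS : q ∉ A.post S a) :
    numMid A D S g a q = ⊤ := by
  simp [numMid, hS]

/-- A state that is entered from outside gets a number larger than all old ones. -/
lemma card_lt_numMid {S : Finset Q} {g : NumLabel D} {a : α} {q : Q} (hq : q ∈ D)
    (hS : q ∈ A.post S a) (h : numPreds A D g a q = ∅) :
    (D.card : ℕ∞) < numMid A D S g a q ∧ numMid A D S g a q ≠ ⊤ := by
  rw [numMid, if_pos ⟨hq, hS⟩, if_pos h]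
  refine ⟨?_, ENat.natCast_ne_top _⟩
  rw [Nat.cast_lt]
  have : 0 < (D.filter fun p => p ∈ A.post S a ∧ numPreds A D g a p = ∅ ∧ p ≤ q).card :=
    Finset.card_pos.2 ⟨q, Finset.mem_filter.2 ⟨hq, hS, h, le_rfl⟩⟩
  omega

end NumLabel

section Esparza

variable {n : ℕ} {D : Finset (Fin (n + 2))}

/-- A part without `0` has only self-loops inside, so runs in it never merge and only a self-loop
can hand over a number. -/
lemma permNBA_numPreds (h0 : 0 ∉ D) {g : NumLabel D} {a : Fin (n + 1)} {q : Fin (n + 2)}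
    (hq : q ∈ D) : numPreds (permNBA n) D g a q = if g.val q = ⊤ then ∅ else {q} := by
  ext p
  simp only [numPreds, Finset.mem_filter]
  by_cases hp : p = 0
  · subst hp
    have : q ≠ 0 := by rintro rfl; exact h0 hq
    split_ifs <;> simp [h0, this.symm]
  · rw [permNBA_δ_of_ne hp]
    split_ifs with h
    · simp only [Finset.mem_singleton, Finset.notMem_empty, iff_false]
      rintro ⟨-, h1, rfl⟩
      exact h1 h
    · simp only [Finset.mem_singleton]
      exact ⟨fun h => h.2.2.symm, by rintro rfl; exact ⟨hq, h, rfl⟩⟩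

/-- After the letters of `l`, the reached states are the initial state and the states of `l`, ranked
as in `l`. -/
structure EsparzaInv (D : Finset (Fin (n + 2))) (l : List (Fin n))
    (m : (esparzaDPA (permNBA n) D).State) : Prop where
  outside : Finset.map (Function.Embedding.subtype _) m.1 = {0}
  reached : ∀ q ∈ D, m.2.val q ≠ ⊤ ↔ ∃ i ∈ l, q = loopState i
  ranked : l.Pairwise fun i j => m.2.val (loopState i) < m.2.val (loopState j)

lemma esparzaInv_init (hD : (permNBA n).IsLimitDeterministic D) :
    EsparzaInv D [] (esparzaDPA (permNBA n) D).init where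
  outside := by
    ext q
    have := hD.zero_notMem
    simp only [esparzaDPA, permNBA, Finset.mem_map, Finset.mem_filter, Finset.mem_univ, true_and,
      Function.Embedding.subtype_apply, Finset.mem_singleton]
    exact ⟨by rintro ⟨p, hp, rfl⟩; exact hp, by rintro rfl; exact ⟨⟨0, this⟩, rfl, rfl⟩⟩
  reached q hq := by
    have : q ≠ 0 := by rintro rfl; exact hD.zero_notMem hq
    simp [esparzaDPA, NumLabel.val, numInit, permNBA, hq, this]
  ranked := List.Pairwise.nil

lemma EsparzaInv.step (hD : (permNBA n).IsLimitDeterministic D) {l : List (Fin n)} {i : Fin n}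
    {m : (esparzaDPA (permNBA n) D).State} (hi : i ∉ l) (h : EsparzaInv D l m) :
    EsparzaInv D (l ++ [i]) ((esparzaDPA (permNBA n) D).step m i.succ) := by
  have h0 := hD.zero_notMem
  have hS : ∀ q, q ∈ (permNBA n).post (Finset.map (Function.Embedding.subtype _) m.1 ∪
      D.filter fun q => m.2.val q ≠ ⊤) i.succ ↔ q = 0 ∨ ∃ j ∈ l ++ [i], q = loopState j := by
    intro q
    rw [mem_permNBA_post_succ, h.outside]
    have : q ∈ D ∧ m.2.val q ≠ ⊤ ↔ ∃ j ∈ l, q = loopState j :=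
      ⟨fun hq => (h.reached q hq.1).1 hq.2, by
        rintro ⟨j, hj, rfl⟩
        exact ⟨hD.loopState_mem j, (h.reached _ (hD.loopState_mem j)).2 ⟨j, hj, rfl⟩⟩⟩
    simp only [Finset.mem_union, Finset.mem_singleton, Finset.mem_filter, this, List.mem_append,
      List.mem_singleton]
    grind
  set S := Finset.map (Function.Embedding.subtype _) m.1 ∪ D.filter fun q => m.2.val q ≠ ⊤
  have hold : ∀ j ∈ l, numMid (permNBA n) D S m.2 i.succ (loopState j) = m.2.val (loopState j) ∧
      m.2.val (loopState j) ≠ ⊤ := by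
    intro j hj
    have hjD := hD.loopState_mem j
    have hjt := (h.reached _ hjD).2 ⟨j, hj, rfl⟩
    refine ⟨numMid_eq_val _ _ hjD ((hS _).2 (Or.inr ⟨j, by simp [hj], rfl⟩)) ?_, hjt⟩
    rw [permNBA_numPreds h0 hjD, if_neg hjt]
  -- As `i ∉ l`, the state `loopState i` has no number yet. It is entered from `0`, outside of `D`,
  -- and so ranks behind all old numbers, which are at most `D.card`.
  have hnew : (D.card : ℕ∞) < numMid (permNBA n) D S m.2 i.succ (loopState i) ∧
      numMid (permNBA n) D S m.2 i.succ (loopState i) ≠ ⊤ := by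
    have hiD := hD.loopState_mem i
    refine card_lt_numMid _ _ hiD ((hS _).2 (Or.inr ⟨i, by simp, rfl⟩)) ?_
    rw [permNBA_numPreds h0 hiD, if_pos]
    by_contra hc
    obtain ⟨j, hj, he⟩ := (h.reached _ hiD).1 hc
    exact hi (by simpa using (Fin.succ_injective _ (Fin.succ_injective _ he)) ▸ hj)
  refine ⟨?_, fun q hq => ?_, ?_⟩
  · ext q
    have hi := hD.loopState_mem i
    change q ∈ Finset.map _ (Finset.univ.filter fun q : {q // q ∉ D} =>
      q.1 ∈ (permNBA n).post (Finset.map (Function.Embedding.subtype _) m.1) i.succ) ↔ _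
    rw [h.outside]
    simp only [Finset.mem_map, Finset.mem_filter, Finset.mem_univ, true_and, mem_permNBA_post_succ,
      Function.Embedding.subtype_apply, Finset.mem_singleton]
    constructor
    · rintro ⟨p, hp | hp, rfl⟩
      · exact hp
      · exact absurd (hp ▸ hi) p.2
    · rintro rfl
      exact ⟨⟨0, h0⟩, Or.inl rfl, rfl⟩
  · refine (numSucc_val_ne_top_iff _ _ hq).trans ⟨fun hc => ?_, ?_⟩
    · by_contra hne
      refine hc (numMid_eq_top _ _ fun hm => ?_)
      rcases (hS q).1 hm with rfl | h1
      · exact h0 hq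
      · exact hne h1
    · rintro ⟨j, hj, rfl⟩
      rcases List.mem_append.1 hj with hj | hj
      · rw [(hold j hj).1]
        exact (hold j hj).2
      · rw [List.mem_singleton.1 hj]
        exact hnew.2
  · rw [List.pairwise_append]
    refine ⟨h.ranked.imp_of_mem fun {j k} hj hk hjk => ?_, List.pairwise_singleton _ _,
      fun j hj k hk => ?_⟩
    · refine numSucc_val_lt _ _ (hD.loopState_mem j) (hD.loopState_mem k) ?_ ?_
      · rwa [(hold j hj).1, (hold k hk).1]
      · rw [(hold k hk).1]
        exact (hold k hk).2
    · rw [List.mem_singleton.1 hk]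
      refine numSucc_val_lt _ _ (hD.loopState_mem j) (hD.loopState_mem i) ?_ hnew.2
      rw [(hold j hj).1]
      exact (NumLabel.val_le _ (hold j hj).2).trans_lt hnew.1

/-- The letters are read from the initial state, without a leading letter `0`: the permutation is
recorded by the times of entry, and the letter `0` would let in all loop states at once. -/
lemma esparzaDPA_factorial_le (hD : (permNBA n).IsLimitDeterministic D) :
    n.factorial ≤ (esparzaDPA (permNBA n) D).reachable.ncard :=
  factorial_le_ncard_reachable _ Fin.succ _ (DELA.init_mem_reachable _) (EsparzaInv D)
    (fun m i j => NumLabel.val m.2 (loopState i) < NumLabel.val m.2 (loopState j))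
    (esparzaInv_init hD) (fun _ _ _ _ hi h => h.step hD hi) (fun _ _ _ h => h.ranked)
    (fun _ _ _ _ _ _ h => h.not_gt)

lemma esparzaDPA_isDPA {α Q : Type} [Fintype Q] [LinearOrder Q] (A : NBA α Q) (D : Finset Q) :
    (esparzaDPA A D).IsDPA :=
  ⟨⟨D.card + 1, by change 2 * D.card + 2 = _; omega⟩, rfl⟩

end Esparza

/-! ## The construction of Redziejowski -/

section ListLabel

/-- At the smaller of two opposite witnesses the lists would have to differ and to agree. -/
lemma listLT_asymm {l m : Finset ℕ} (h : listLT l m) : ¬ listLT m l := by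
  rintro ⟨y, hy, hy', hb⟩
  obtain ⟨x, hx, hx', ha⟩ := h
  rcases lt_trichotomy x y with hxy | rfl | hxy
  · exact hx' ((hb x hxy).2 hx)
  · exact hx' hy
  · exact hy' ((ha y hxy).2 hy)

variable {α Q : Type} [LinearOrder Q] (A : NBA α Q) (N : Finset Q)

/-- If the used numbers form an interval, then the numbers are not changed by the compression. -/
lemma listSucc_val {S : Finset Q} {t : ListLabel N} {a : α} {k : ℕ}
    (hU : N.biUnion (listCut A N S t a) = Finset.Icc 1 k) (hk : k ≤ 2 * N.card) {q : Q}
    (hq : q ∈ N) : (listSucc A N S t a).val q = listCut A N S t a q := by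
  have hcard : ∀ w ∈ listCut A N S t a q,
      ((N.biUnion (listCut A N S t a)).filter (· ≤ w)).card = w ∧ 1 ≤ w ∧ w ≤ k := by
    intro w hw
    have hw' : w ∈ Finset.Icc 1 k := hU ▸ Finset.mem_biUnion.2 ⟨q, hq, hw⟩
    rw [Finset.mem_Icc] at hw'
    refine ⟨?_, hw'⟩
    rw [hU]
    have : (Finset.Icc 1 k).filter (· ≤ w) = Finset.Icc 1 w := by
      ext v
      simp only [Finset.mem_filter, Finset.mem_Icc]
      omega
    rw [this, Nat.card_Icc]
    omega
  ext v
  simp only [ListLabel.val, hq, dif_pos, listSucc, Finset.mem_image, Finset.mem_filter,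
    Finset.mem_univ, true_and]
  constructor
  · rintro ⟨i, ⟨w, hw, hi⟩, rfl⟩
    rw [(hcard w hw).1] at hi
    exact hi ▸ hw
  · intro hv
    obtain ⟨h1, h2, h3⟩ := hcard v hv
    -- Entries are stored minus one, and `1 ≤ v` makes the subtraction harmless.
    exact ⟨⟨v - 1, by omega⟩, ⟨v, hv, by rw [h1]; dsimp only; omega⟩, by dsimp only; omega⟩

/-- `listMid` is a union over all least candidates. By asymmetry of `listLT` all of them are the
same list, so exhibiting one least candidate suffices. -/
lemma listMid_eq {S : Finset Q} {t : ListLabel N} {a : α} {p q : Q} (hq : q ∈ N)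
    (hp : p ∈ listPreds A N t a q)
    (h : ∀ p' ∈ listPreds A N t a q, listCand A N t a q p' = listCand A N t a q p ∨
      listLT (listCand A N t a q p) (listCand A N t a q p')) :
    listMid A N S t a q = listCand A N t a q p := by
  have hne : q ∉ listEntering A N S t a := fun he => by
    rw [(Finset.mem_filter.1 he).2.2] at hp
    exact Finset.notMem_empty _ hp
  rw [listMid, if_neg hne, if_pos hq]
  ext v
  simp only [Finset.mem_biUnion, Finset.mem_filter, Finset.mem_image, id]
  constructor
  · rintro ⟨_, ⟨⟨p', hp', rfl⟩, hmin⟩, hv⟩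
    rcases hmin _ ⟨p, hp, rfl⟩ with h1 | h1
    · exact h1 ▸ hv
    · rcases h p' hp' with h2 | h2
      · exact h2 ▸ hv
      · exact absurd h1 (listLT_asymm h2)
  · intro hv
    refine ⟨_, ⟨⟨p, hp, rfl⟩, ?_⟩, hv⟩
    rintro _ ⟨p', hp', rfl⟩
    exact h p' hp'

lemma listFresh_zero {t : ListLabel N} {k : ℕ} (h : listUsed N t = Finset.Icc 1 k) :
    listFresh N t 0 = k + 1 := by
  rw [listFresh, Nat.nth_zero, h]
  refine le_antisymm (Nat.sInf_le (by simp)) (le_csInf ⟨k + 1, by simp⟩ fun v hv => ?_)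
  simp only [Finset.mem_Icc, Set.mem_ofPred_eq] at hv
  omega

end ListLabel

section Redziejowski

variable {n : ℕ}

/-- The state of the `k`-th entry of `l` has the list `[1, k + 2]`, all other states have `[1]`. -/
structure ListInv (l : List (Fin n)) (f : Fin (n + 2) → Finset ℕ) : Prop where
  other : ∀ q, (∀ j ∈ l, q ≠ loopState j) → f q = {1}
  entry : ∀ j ∈ l, f (loopState j) = {1, l.idxOf j + 2}

lemma ListInv.zero {l : List (Fin n)} {f : Fin (n + 2) → Finset ℕ} (h : ListInv l f) :
    f 0 = {1} :=
  h.other 0 fun _ _ => (Fin.succ_ne_zero _).symm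

lemma ListInv.nonempty {l : List (Fin n)} {f : Fin (n + 2) → Finset ℕ} (h : ListInv l f)
    (q : Fin (n + 2)) : (f q).Nonempty := by
  by_cases hq : ∃ j ∈ l, q = loopState j
  · obtain ⟨j, hj, rfl⟩ := hq
    rw [h.entry j hj]
    exact Finset.insert_nonempty _ _
  · push Not at hq
    rw [h.other q hq]
    exact Finset.singleton_nonempty _

/-- The absence of gaps has two uses: the next fresh number is `l.length + 2`, and compression
changes nothing. -/
lemma ListInv.biUnion {l : List (Fin n)} (hl : l.Nodup) {f : Fin (n + 2) → Finset ℕ}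
    (h : ListInv l f) : Finset.univ.biUnion f = Finset.Icc 1 (l.length + 1) := by
  ext v
  simp only [Finset.mem_biUnion, Finset.mem_univ, true_and, Finset.mem_Icc]
  constructor
  · rintro ⟨q, hq⟩
    by_cases hj : ∃ j ∈ l, q = loopState j
    · obtain ⟨j, hj, rfl⟩ := hj
      rw [h.entry j hj, Finset.mem_insert, Finset.mem_singleton] at hq
      have := List.idxOf_lt_length_iff.2 hj
      omega
    · push Not at hj
      rw [h.other q hj, Finset.mem_singleton] at hq
      omega
  · rintro ⟨h1, h2⟩
    rcases h1.eq_or_lt with rfl | h1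
    · exact ⟨0, by simp [h.zero]⟩
    · have hlt : v - 2 < l.length := by omega
      refine ⟨loopState l[v - 2], ?_⟩
      rw [h.entry _ (List.getElem_mem hlt), List.Nodup.idxOf_getElem hl]
      simp only [Finset.mem_insert, Finset.mem_singleton]
      omega

/-- The only proper nonempty prefix of any list is `[1]`, and this is the list of the state `0`, so
no list is cut. The used numbers form an interval, so none is renumbered. -/
lemma ListInv.succ_of_mid {A : NBA (Fin (n + 1)) (Fin (n + 2))} {l : List (Fin n)} (hl : l.Nodup)
    {S : Finset (Fin (n + 2))} {t : ListLabel (Finset.univ : Finset (Fin (n + 2)))}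
    {a : Fin (n + 1)} (h : ListInv l (listMid A Finset.univ S t a)) :
    ListInv l (listSucc A Finset.univ S t a).val := by
  have hcut : listCut A Finset.univ S t a = listMid A Finset.univ S t a := by
    classical
    funext q
    refine Finset.filter_true_of_mem fun y hy x hx hxy => ?_
    have : (listMid A Finset.univ S t a q).filter (· ≤ x) = {1} := by
      by_cases hq : ∃ j ∈ l, q = loopState j
      · obtain ⟨j, hj, rfl⟩ := hq
        rw [h.entry j hj] at hx hy ⊢
        ext v
        simp only [Finset.mem_filter, Finset.mem_insert, Finset.mem_singleton] at hx hy ⊢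
        omega
      · push Not at hq
        rw [h.other q hq, Finset.mem_singleton] at hx hy
        omega
    rw [this]
    exact ⟨Finset.singleton_nonempty _, 0, Finset.mem_univ _, h.zero⟩
  have hval : (listSucc A Finset.univ S t a).val = listMid A Finset.univ S t a := by
    funext q
    rw [listSucc_val A Finset.univ (k := l.length + 1) _ _ (Finset.mem_univ q), hcut]
    · rw [hcut]
      exact h.biUnion hl
    · have := hl.length_le_card
      rw [Fintype.card_fin] at this
      rw [Finset.card_univ, Fintype.card_fin]
      omega
  rwa [hval]

/-- The letter `0` has no accepting transitions, so every state inherits the list `[1]` from the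
state `0`, the only reached predecessor. -/
lemma listInv_redziejowski_init :
    ListInv [] ((redziejowskiDPA (permNBA n)).step (redziejowskiDPA (permNBA n)).init 0).val := by
  refine ListInv.succ_of_mid List.nodup_nil ⟨fun q _ => ?_, by simp⟩
  have h0 : (listInit (permNBA n) Finset.univ).val 0 = {1} := by
    ext v
    simp only [ListLabel.val, listInit, permNBA, Finset.mem_univ, dif_pos, if_true,
      Finset.mem_image, Finset.mem_filter, true_and, Finset.mem_singleton]
    constructor
    · rintro ⟨i, hi, rfl⟩
      omega
    · rintro rfl
      exact ⟨⟨0, by simp⟩, rfl, rfl⟩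
  have hne : ∀ q, q ≠ 0 → (listInit (permNBA n) Finset.univ).val q = ∅ := by
    intro q hq
    simp only [ListLabel.val, listInit, permNBA, hq, Finset.mem_univ, dif_pos, if_false]
    exact Finset.image_empty _
  have hp : ∀ p, p ∈ listPreds (permNBA n) Finset.univ (listInit (permNBA n) Finset.univ) 0 q ↔
      p = 0 := by
    intro p
    simp only [listPreds, Finset.mem_filter, Finset.mem_univ, true_and]
    refine ⟨fun h => by_contra fun hc => h.1 (hne p hc), ?_⟩
    rintro rfl
    rw [h0, permNBA_δ_zero_zero]
    simp
  refine (listMid_eq _ _ (Finset.mem_univ q) ((hp 0).2 rfl) fun p' hp' => ?_).trans ?_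
  · rw [(hp p').1 hp']
    exact Or.inl rfl
  · rw [listCand, permNBA_F_zero, if_neg (Finset.notMem_empty _), h0]

lemma ListInv.step {l : List (Fin n)} (hl : l.Nodup) {i : Fin n} (hi : i ∉ l)
    {t : (redziejowskiDPA (permNBA n)).State} (h : ListInv l (ListLabel.val t)) :
    ListInv (l ++ [i]) (ListLabel.val ((redziejowskiDPA (permNBA n)).step t i.succ)) := by
  have hl' : (l ++ [i]).Nodup := by
    rw [← List.concat_eq_append, List.nodup_concat]
    exact ⟨hi, hl⟩
  have hi1 : ListLabel.val t (loopState i) = {1} := h.other _ fun j hj he =>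
    hi ((Fin.succ_injective _ (Fin.succ_injective _ he)) ▸ hj)
  have hp : ∀ p q, p ∈ listPreds (permNBA n) Finset.univ t i.succ q ↔
      p = q ∨ p = 0 ∧ q = loopState i := by
    intro p q
    simp only [listPreds, Finset.mem_filter, Finset.mem_univ, true_and]
    have := (h.nonempty p).ne_empty
    by_cases hp : p = 0
    · subst hp
      simp only [permNBA_δ_zero_succ, Finset.mem_insert, Finset.mem_singleton]
      grind
    · rw [permNBA_δ_of_ne hp, Finset.mem_singleton]
      grind
  -- The only accepting transition with this letter is the loop at `loopState i`. No accepting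
  -- transition precedes it, so it receives the first fresh number.
  have hedges : (listAccEdges (permNBA n) Finset.univ t i.succ).filter (fun e =>
      e.1 < loopState i ∨ e.1 = loopState i ∧ e.2 < loopState i) = ∅ := by
    refine Finset.filter_false_of_mem fun e he => ?_
    obtain ⟨-, h1, h2⟩ := mem_permNBA_F.1 (Finset.mem_filter.1 he).2.2
    rw [h2, h1]
    simp
  have hcand : ∀ p q, p = q ∧ q = loopState i ∨
      listCand (permNBA n) Finset.univ t i.succ q p = ListLabel.val t p := by
    intro p q
    by_cases hF : q ∈ (permNBA n).F p i.succ
    · obtain ⟨-, rfl, rfl⟩ := mem_permNBA_F.1 hF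
      exact Or.inl ⟨rfl, rfl⟩
    · exact Or.inr (if_neg hF)
  have hmid : ∀ q, q ≠ loopState i → listMid (permNBA n) Finset.univ
      (Finset.univ.filter fun q => ListLabel.val t q ≠ ∅) t i.succ q = ListLabel.val t q := by
    intro q hq
    refine (listMid_eq _ _ (Finset.mem_univ q) ((hp q q).2 (Or.inl rfl)) fun p' hp' => ?_).trans ?_
    · rcases (hp p' q).1 hp' with rfl | h1
      · exact Or.inl rfl
      · exact absurd h1.2 hq
    · exact (hcand q q).resolve_left fun h => hq h.2
  have hmidi : listMid (permNBA n) Finset.univ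
      (Finset.univ.filter fun q => ListLabel.val t q ≠ ∅) t i.succ (loopState i) =
      {1, l.length + 2} := by
    have hc : listCand (permNBA n) Finset.univ t i.succ (loopState i) (loopState i) =
        {1, l.length + 2} := by
      refine (if_pos (by simp [permNBA_F_succ])).trans ?_
      rw [hedges, Finset.card_empty,
        listFresh_zero _ (h.biUnion hl), hi1, Finset.pair_comm]
    refine (listMid_eq _ _ (Finset.mem_univ _) ((hp _ _).2 (Or.inl rfl)) fun p' hp' => ?_).trans hc
    -- The competing candidate is the list `[1]` of the state `0`. Padding with `∞` makes the longer
    -- list the smaller one, so the loop wins.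
    rcases (hp p' _).1 hp' with rfl | ⟨rfl, -⟩
    · exact Or.inl rfl
    · right
      rw [hc, (hcand 0 (loopState i)).resolve_left fun h => Fin.succ_ne_zero _ h.1.symm, h.zero]
      refine ⟨l.length + 2, by simp, by simp, fun y hy => ?_⟩
      simp only [Finset.mem_insert, Finset.mem_singleton]
      omega
  refine ListInv.succ_of_mid hl' ⟨fun q hq => ?_, fun j hj => ?_⟩
  · refine (hmid q (hq i (by simp))).trans (h.other q fun j hj => hq j (by simp [hj]))
  · rcases List.mem_append.1 hj with hj | hj
    · rw [List.idxOf_append_of_mem hj, ← h.entry j hj]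
      refine hmid _ fun he => hi ?_
      exact (Fin.succ_injective _ (Fin.succ_injective _ he)) ▸ hj
    · rw [List.mem_singleton.1 hj, List.idxOf_append_of_notMem hi]
      simpa using hmidi

lemma ListInv.pairwise {l : List (Fin n)} (hl : l.Nodup) {f : Fin (n + 2) → Finset ℕ}
    (h : ListInv l f) : l.Pairwise fun i j =>
      ∃ u v, u < v ∧ f (loopState i) = {1, u + 2} ∧ f (loopState j) = {1, v + 2} := by
  rw [List.pairwise_iff_getElem]
  intro u v hu hv huv
  refine ⟨u, v, huv, ?_, ?_⟩
  · rw [h.entry _ (List.getElem_mem hu), List.Nodup.idxOf_getElem hl]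
  · rw [h.entry _ (List.getElem_mem hv), List.Nodup.idxOf_getElem hl]

lemma redziejowskiDPA_factorial_le (n : ℕ) :
    n.factorial ≤ (redziejowskiDPA (permNBA n)).reachable.ncard := by
  refine factorial_le_ncard_reachable _ Fin.succ _ (DELA.step_init_mem_reachable _ 0)
    (fun l t => ListInv l (ListLabel.val t)) (fun t i j => ∃ u v, u < v ∧
      ListLabel.val t (loopState i) = {1, u + 2} ∧ ListLabel.val t (loopState j) = {1, v + 2})
    listInv_redziejowski_init (fun _ _ _ hl hi h => h.step hl hi) (fun _ _ hl h => h.pairwise hl) ?_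
  rintro _ t - - i j ⟨u, v, huv, hi, hj⟩ ⟨u', v', huv', hj', hi'⟩
  -- Because `x + 2` is never `1`, the set determines `x`.
  have hpair : ∀ x y : ℕ, ({1, x + 2} : Finset ℕ) = {1, y + 2} → x = y := by
    intro x y hxy
    have : x + 2 ∈ ({1, y + 2} : Finset ℕ) := hxy ▸ by simp
    simp only [Finset.mem_insert, Finset.mem_singleton] at this
    omega
  have h1 := hpair _ _ (hi.symm.trans hi')
  have h2 := hpair _ _ (hj.symm.trans hj')
  omega

lemma redziejowskiDPA_isDPA {α Q : Type} [Fintype Q] [LinearOrder Q] (A : NBA α Q) :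
    (redziejowskiDPA A).IsDPA :=
  ⟨⟨Fintype.card Q + 1, by change 2 * Fintype.card Q + 2 = _; omega⟩, rfl⟩

end Redziejowski

/-! ## Positions in a finite linear order -/

section Position

variable {N : Type} [Fintype N] (r : N → N → Prop) [IsStrictTotalOrder N r] [DecidableRel r]
  (P : N → Prop) [DecidablePred P]

/-- The order is a parameter `r`, since Piterman's numbering uses a lexicographic order on a sum
type, whereas the names of Safra and of Kähler and Wilke go by `<`. -/
lemma card_filter_rel_lt {x y : N} (hx : P x) (h : r x y) :
    (Finset.univ.filter fun u => r u x ∧ P u).card <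
      (Finset.univ.filter fun u => r u y ∧ P u).card := by
  refine Finset.card_lt_card ((Finset.ssubset_iff_of_subset fun u hu => ?_).2 ⟨x, ?_, ?_⟩)
  · simp only [Finset.mem_filter, Finset.mem_univ, true_and] at hu ⊢
    exact ⟨_root_.trans hu.1 h, hu.2⟩
  · simp [h, hx]
  · simp [irrefl x]

lemma eq_of_card_filter_rel_eq {x y : N} (hx : P x) (hy : P y)
    (h : (Finset.univ.filter fun u => r u x ∧ P u).card =
      (Finset.univ.filter fun u => r u y ∧ P u).card) : x = y := by
  rcases trichotomous (r := r) x y with hxy | rfl | hxy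
  · exact absurd h (card_filter_rel_lt r P hx hxy).ne
  · rfl
  · exact absurd h (card_filter_rel_lt r P hy hxy).ne'

lemma card_filter_rel_lt_card {x : N} (hx : P x) :
    (Finset.univ.filter fun u => r u x ∧ P u).card < (Finset.univ.filter P).card := by
  refine Finset.card_lt_card ((Finset.ssubset_iff_of_subset fun u hu => ?_).2 ⟨x, ?_, ?_⟩)
  · simp only [Finset.mem_filter, Finset.mem_univ, true_and] at hu ⊢
    exact hu.2
  · simp [hx]
  · simp [irrefl x]

/-- Every number smaller than the number of elements is a position. -/
lemma exists_card_filter_rel_eq {j : ℕ} (hj : j < (Finset.univ.filter P).card) :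
    ∃ k, P k ∧ (Finset.univ.filter fun u => r u k ∧ P u).card = j := by
  -- Distinct elements have distinct positions, all below the cardinality, so by counting the
  -- positions exhaust the range.
  obtain ⟨k, hk, rfl⟩ := Finset.surj_on_of_inj_on_of_card_le (s := Finset.univ.filter P)
    (t := Finset.range (Finset.univ.filter P).card)
    (fun k _ => (Finset.univ.filter fun u => r u k ∧ P u).card)
    (fun k hk => Finset.mem_range.2 (card_filter_rel_lt_card r P (Finset.mem_filter.1 hk).2))
    (fun x y hx hy h => eq_of_card_filter_rel_eq r P (Finset.mem_filter.1 hx).2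
      (Finset.mem_filter.1 hy).2 h) (by simp) j (Finset.mem_range.2 hj)
  exact ⟨k, (Finset.mem_filter.1 hk).2, rfl⟩

end Position

/-! ## Safra's and Piterman's constructions -/

namespace OTree

section General

variable {Q N : Type}

lemma horizontal_eq_self {T : OTree N Q} (h : ∀ u v w, Relation.ReflTransGen T.child u v →
    T.older w u → ∀ q ∈ T.label v, q ∉ T.label w) : T.horizontal = T := by
  classical
  have : T.horizontal.label = T.label := by
    funext v
    exact Finset.filter_true_of_mem fun q hq u w h1 h2 => h u v w h1 h2 q hq
  cases T
  simpa [horizontal] using this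

lemma vertical_eq_self {T : OTree N Q} (h : ∀ u, ¬ T.Full u) : T.vertical = T := by
  have : T.vertical.label = T.label := by
    funext v
    exact if_neg fun ⟨u, _, hu⟩ => h u hu
  cases T
  simpa [vertical] using this

end General

variable {n : ℕ} {N M : Type}

/-- Up to empty nodes, the tree consists of the root `r`, labelled by the set of all states, and of
its children `node j`, labelled by `{loopState j}`, for the entries `j` of `l` in this order. -/
structure StarInv (l : List (Fin n)) (T : OTree N (Fin (n + 2))) (r : N) (node : Fin n → N) :
    Prop where
  root : T.label r = Finset.univ
  entry : ∀ j ∈ l, T.label (node j) = {loopState j}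
  cover : ∀ v, (T.label v).Nonempty → v = r ∨ ∃ j ∈ l, v = node j
  child : ∀ u v, (T.label u).Nonempty → (T.label v).Nonempty → (T.child u v ↔ u = r ∧ v ≠ r)
  older : ∀ u v, (T.label u).Nonempty → (T.label v).Nonempty →
    (T.older u v ↔ ∃ i j, [i, j].Sublist l ∧ u = node i ∧ v = node j)

/-- Empty nodes are isolated. -/
structure Reduced (T : OTree N (Fin (n + 2))) : Prop where
  child : ∀ u v, T.child u v → (T.label u).Nonempty ∧ (T.label v).Nonempty
  older : ∀ u v, T.older u v → (T.label u).Nonempty ∧ (T.label v).Nonempty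

lemma univ_ne_singleton (q : Fin (n + 2)) : (Finset.univ : Finset (Fin (n + 2))) ≠ {q} := by
  intro h
  have := congrArg Finset.card h
  simp at this

namespace StarInv

variable {l : List (Fin n)} {T : OTree N (Fin (n + 2))} {r : N} {node : Fin n → N}

lemma node_ne_root (h : StarInv l T r node) {j : Fin n} (hj : j ∈ l) : node j ≠ r := fun he =>
  univ_ne_singleton _ (h.root.symm.trans (he ▸ h.entry j hj))

lemma node_injOn (h : StarInv l T r node) {i j : Fin n} (hi : i ∈ l) (hj : j ∈ l)
    (he : node i = node j) : i = j := by
  have := (h.entry i hi).symm.trans (he ▸ h.entry j hj)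
  exact Fin.succ_injective _ (Fin.succ_injective _ (Finset.singleton_injective this))

lemma root_nonempty (h : StarInv l T r node) : (T.label r).Nonempty :=
  h.root ▸ Finset.univ_nonempty

lemma node_nonempty (h : StarInv l T r node) {j : Fin n} (hj : j ∈ l) :
    (T.label (node j)).Nonempty :=
  h.entry j hj ▸ Finset.singleton_nonempty _

lemma card_nonempty_le [Fintype N] (h : StarInv l T r node) :
    (Finset.univ.filter fun v => (T.label v).Nonempty).card ≤ l.length + 1 := by
  classical
  calc _ ≤ (insert r (l.toFinset.image node)).card := Finset.card_le_card fun v hv => by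
        rcases h.cover v (Finset.mem_filter.1 hv).2 with rfl | ⟨j, hj, rfl⟩
        · simp
        · exact Finset.mem_insert_of_mem (Finset.mem_image_of_mem _ (by simpa using hj))
    _ ≤ (l.toFinset.image node).card + 1 := Finset.card_insert_le _ _
    _ ≤ l.length + 1 := by
        have := Finset.card_image_le (s := l.toFinset) (f := node)
        have := l.toFinset_card_le
        omega

/-- The shape of a star does not depend on names, as long as they are assigned injectively to the
nonempty nodes; this serves both Safra and Piterman. The tree is reduced afterwards because
`OTree.rename` drops all relations that involve empty nodes. -/
lemma rename (h : StarInv l T r node) {nm : N → M → Prop} {f : N → M}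
    (hf : ∀ x, (T.label x).Nonempty → ∀ k, nm x k ↔ k = f x)
    (hinj : ∀ x y, (T.label x).Nonempty → (T.label y).Nonempty → f x = f y → x = y) :
    StarInv l (T.rename nm) (f r) (f ∘ node) ∧ (T.rename nm).Reduced := by
  have hlab : ∀ x, (T.label x).Nonempty → (T.rename nm).label (f x) = T.label x := by
    intro x hx
    ext q
    simp only [OTree.rename, Finset.mem_filter, Finset.mem_univ, true_and]
    constructor
    · rintro ⟨y, hy, hq⟩
      have := (hf y ⟨q, hq⟩ _).1 hy
      rwa [hinj x y hx ⟨q, hq⟩ this]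
    · exact fun hq => ⟨x, (hf x hx _).2 rfl, hq⟩
  have hex : ∀ k, ((T.rename nm).label k).Nonempty → ∃ x, (T.label x).Nonempty ∧ k = f x := by
    rintro k ⟨q, hq⟩
    simp only [OTree.rename, Finset.mem_filter, Finset.mem_univ, true_and] at hq
    obtain ⟨x, hx, hq⟩ := hq
    exact ⟨x, ⟨q, hq⟩, (hf x ⟨q, hq⟩ _).1 hx⟩
  refine ⟨⟨?_, fun j hj => ?_, fun k hk => ?_, fun k m hk hm => ?_, fun k m hk hm => ?_⟩,
    ⟨?_, ?_⟩⟩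
  · rw [hlab r h.root_nonempty, h.root]
  · rw [Function.comp_apply, hlab _ (h.node_nonempty hj), h.entry j hj]
  · obtain ⟨x, hx, rfl⟩ := hex k hk
    rcases h.cover x hx with rfl | ⟨j, hj, rfl⟩
    · exact Or.inl rfl
    · exact Or.inr ⟨j, hj, rfl⟩
  · obtain ⟨x, hx, rfl⟩ := hex k hk
    obtain ⟨y, hy, rfl⟩ := hex m hm
    have h1 : (T.rename nm).child (f x) (f y) ↔ T.child x y := by
      constructor
      · rintro ⟨x', y', hx', hy', hxe, hye, hc⟩
        rwa [hinj x x' hx hxe ((hf x' hxe _).1 hx'), hinj y y' hy hye ((hf y' hye _).1 hy')]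
      · exact fun hc => ⟨x, y, (hf x hx _).2 rfl, (hf y hy _).2 rfl, hx, hy, hc⟩
    rw [h1, h.child x y hx hy]
    constructor
    · rintro ⟨rfl, hne⟩
      exact ⟨rfl, fun he => hne (hinj _ _ hy hx he)⟩
    · rintro ⟨h2, h3⟩
      exact ⟨hinj _ _ hx h.root_nonempty h2, fun he => h3 (he ▸ rfl)⟩
  · obtain ⟨x, hx, rfl⟩ := hex k hk
    obtain ⟨y, hy, rfl⟩ := hex m hm
    have h1 : (T.rename nm).older (f x) (f y) ↔ T.older x y := by
      constructor
      · rintro ⟨x', y', hx', hy', hxe, hye, hc⟩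
        rwa [hinj x x' hx hxe ((hf x' hxe _).1 hx'), hinj y y' hy hye ((hf y' hye _).1 hy')]
      · exact fun hc => ⟨x, y, (hf x hx _).2 rfl, (hf y hy _).2 rfl, hx, hy, hc⟩
    rw [h1, h.older x y hx hy]
    constructor
    · rintro ⟨i, j, hs, rfl, rfl⟩
      exact ⟨i, j, hs, rfl, rfl⟩
    · rintro ⟨i, j, hs, h2, h3⟩
      exact ⟨i, j, hs, hinj _ _ hx (h.node_nonempty (hs.subset (by simp))) h2,
        hinj _ _ hy (h.node_nonempty (hs.subset (by simp))) h3⟩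
  · rintro k m ⟨x, y, hx, hy, hxe, hye, -⟩
    rw [(hf x hxe k).1 hx, (hf y hye m).1 hy, hlab x hxe, hlab y hye]
    exact ⟨hxe, hye⟩
  · rintro k m ⟨x, y, hx, hy, hxe, hye, -⟩
    rw [(hf x hxe k).1 hx, (hf y hye m).1 hy, hlab x hxe, hlab y hye]
    exact ⟨hxe, hye⟩

end StarInv

/-- For two entries, being a sublist means occurring in this order; a new last entry comes after all
others. This form matches the age order of siblings. -/
lemma pair_sublist_append_singleton {α : Type} {l : List α} {i a b : α} :
    [a, b].Sublist (l ++ [i]) ↔ [a, b].Sublist l ∨ a ∈ l ∧ b = i := by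
  rw [List.sublist_append_iff]
  constructor
  · rintro ⟨l₁, l₂, he, h1, h2⟩
    rcases l₁ with _ | ⟨x, _ | ⟨y, l₁⟩⟩
    · have := h2.length_le
      rw [List.nil_append] at he
      simp [← he] at this
    · simp only [List.cons_append, List.nil_append, List.cons.injEq] at he
      obtain ⟨rfl, rfl⟩ := he
      exact Or.inr ⟨by simpa using h1, by simpa using h2⟩
    · simp only [List.cons_append, List.cons.injEq] at he
      obtain ⟨rfl, rfl, he⟩ := he
      have := (List.append_eq_nil_iff.1 he.symm).1
      exact Or.inl (this ▸ h1)
  · rintro (h | ⟨h, rfl⟩)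
    · exact ⟨[a, b], [], by simp, h, by simp⟩
    · exact ⟨[a], [b], by simp, by simpa using h, by simp⟩

/-- The children are the states that have been split off from the root, by age. -/
def IsStar (l : List (Fin n)) (T : OTree N (Fin (n + 2))) : Prop :=
  (∃ r node, StarInv l T r node) ∧ T.Reduced

/-- On the first letter of a permutation word, all states are reached. -/
lemma starInv_update_single {m : ℕ} (hm : 0 < m) :
    StarInv [] ((single m 0).update (permNBA n) 0) (.inl ⟨0, hm⟩) fun _ => .inl ⟨0, hm⟩ := by
  have hr : ∀ u, ((single m 0).expand (permNBA n) 0).label u =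
      if u = .inl ⟨0, hm⟩ then Finset.univ else ∅ := by
    rintro (u | u)
    · change (permNBA n).post (if u.val = 0 then {0} else ∅) 0 = _
      by_cases hu : u.val = 0
      · rw [if_pos hu, permNBA_post_zero (by simp), if_pos (congrArg _ (Fin.ext hu))]
      · rw [if_neg hu, if_neg, NBA.post, Finset.biUnion_empty]
        rintro h
        exact hu (by rw [Sum.inl.inj h])
    · change (permNBA n).accPost _ 0 = _
      rw [permNBA_accPost_zero, if_neg (by simp)]
  have hc : ∀ u v, ((single m (0 : Fin (n + 2))).expand (permNBA n) 0).child u v → ∃ w, v = .inr w := by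
    rintro (u | u) (v | v) h
    · exact h.elim
    · exact ⟨v, rfl⟩
    · exact h.elim
    · exact h.elim
  have ho : ∀ u v, ¬ ((single m (0 : Fin (n + 2))).expand (permNBA n) 0).older u v := by
    rintro (u | u) (v | v) h <;> exact h.elim
  have hu : (single m 0).update (permNBA n) 0 = (single m 0).expand (permNBA n) 0 := by
    rw [update, horizontal_eq_self fun u v w _ h => absurd h (ho w u), vertical_eq_self]
    rintro u ⟨⟨q, hq⟩, h⟩
    obtain ⟨w, hw, hqw⟩ := h q hq
    obtain ⟨w, rfl⟩ := hc u w hw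
    rw [hr, if_neg (by simp)] at hqw
    exact Finset.notMem_empty _ hqw
  have hne : ∀ u, (((single m 0).expand (permNBA n) 0).label u).Nonempty → u = .inl ⟨0, hm⟩ := by
    intro u hu
    by_contra hc
    rw [hr, if_neg hc] at hu
    exact Finset.not_nonempty_empty hu
  rw [hu]
  refine ⟨by rw [hr, if_pos rfl], by simp, fun v hv => Or.inl (hne v hv), fun u v hu hv => ?_,
    fun u v hu hv => iff_of_false (ho u v) (by simp)⟩
  refine iff_of_false (fun h => ?_) fun h => h.2 (hne v hv)
  obtain ⟨w, rfl⟩ := hc u v h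
  exact absurd (hne _ hv) (by simp)

/-- All old labels persist, and only the root contains `loopState i`, as `i ∉ l`; so its new child
is the only nonempty one. Siblings carry different loop states, hence the horizontal step removes
nothing. The root contains `0`, which none of its children does, and the other nodes have no
nonempty children, so no node is full and the vertical step removes nothing either. -/
lemma StarInv.update {l : List (Fin n)} {T : OTree N (Fin (n + 2))} {r : N} {node : Fin n → N}
    (h : StarInv l T r node) (hT : T.Reduced) (hl : l.Nodup) {i : Fin n} (hi : i ∉ l) :
    StarInv (l ++ [i]) (T.update (permNBA n) i.succ) (.inl r)
      (fun j => if j = i then .inr r else .inl (node j)) := by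
  classical
  have hli : ∀ j ∈ l, loopState j ≠ loopState i := fun j hj he =>
    hi ((Fin.succ_injective _ (Fin.succ_injective _ he)) ▸ hj)
  have hlab : ∀ v, v = r ∨ (∃ j ∈ l, v = node j ∧ T.label v = {loopState j}) ∨ T.label v = ∅ := by
    intro v
    rcases (T.label v).eq_empty_or_nonempty with he | hne
    · exact Or.inr (Or.inr he)
    · rcases h.cover v hne with rfl | ⟨j, hj, rfl⟩
      · exact Or.inl rfl
      · exact Or.inr (Or.inl ⟨j, hj, rfl, h.entry j hj⟩)
  have hinl : ∀ v, (T.expand (permNBA n) i.succ).label (.inl v) = T.label v := by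
    intro v
    refine permNBA_post_succ fun h0 => ?_
    rcases hlab v with rfl | ⟨j, hj, -, he⟩ | he
    · simp [h.root]
    · rw [he, Finset.mem_singleton] at h0
      exact absurd h0.symm (Fin.succ_ne_zero _)
    · simp [he] at h0
  have hinr : ∀ v, (T.expand (permNBA n) i.succ).label (.inr v) =
      if v = r then {loopState i} else ∅ := by
    intro v
    change (permNBA n).accPost (T.label v) i.succ = _
    split_ifs with hv
    · exact permNBA_accPost_of_mem (by simp [hv, h.root])
    · refine permNBA_accPost_of_notMem fun hm => ?_
      rcases hlab v with rfl | ⟨j, hj, -, he⟩ | he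
      · exact hv rfl
      · rw [he, Finset.mem_singleton] at hm
        exact hli j hj hm.symm
      · simp [he] at hm
  have hinrne : ∀ v, ((T.expand (permNBA n) i.succ).label (.inr v)).Nonempty → v = r := by
    intro v hv
    by_contra hc
    rw [hinr, if_neg hc] at hv
    exact Finset.not_nonempty_empty hv
  have hold : ∀ w v, T.older w v → ∃ a ∈ l, ∃ b ∈ l, a ≠ b ∧ w = node a ∧ v = node b := by
    intro w v hwv
    obtain ⟨h1, h2⟩ := hT.older w v hwv
    obtain ⟨a, b, hs, rfl, rfl⟩ := (h.older w v h1 h2).1 hwv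
    exact ⟨a, hs.subset (by simp), b, hs.subset (by simp),
      by simpa using hs.nodup hl, rfl, rfl⟩
  have hch : ∀ u v, T.child u v → u = r ∧ ∃ j ∈ l, v = node j := by
    intro u v huv
    obtain ⟨h1, h2⟩ := hT.child u v huv
    obtain ⟨rfl, h3⟩ := (h.child u v h1 h2).1 huv
    exact ⟨rfl, (h.cover v h2).resolve_left h3⟩
  have hhor : (T.expand (permNBA n) i.succ).horizontal = T.expand (permNBA n) i.succ := by
    refine horizontal_eq_self fun u v w huv hwu q hq hqw => ?_
    rcases w with w | w
    swap
    · rcases u with u | u <;> exact hwu.elim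
    have hwa : ∃ a ∈ l, w = node a := by
      rcases u with u | u
      · obtain ⟨a, ha, -, -, -, rfl, -⟩ := hold w u hwu
        exact ⟨a, ha, rfl⟩
      · exact (hch u w hwu).2
    obtain ⟨a, ha, rfl⟩ := hwa
    rw [hinl, h.entry a ha, Finset.mem_singleton] at hqw
    subst hqw
    rcases Relation.ReflTransGen.cases_head huv with rfl | ⟨x, hux, hxv⟩
    · rcases u with u | u
      · obtain ⟨a', ha', b, hb, hab, hae, rfl⟩ := hold _ u hwu
        rw [hinl, h.entry b hb, Finset.mem_singleton] at hq
        rw [← Fin.succ_injective _ (Fin.succ_injective _ hq)] at hab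
        exact hab (h.node_injOn ha' ha hae.symm)
      · rw [hinr] at hq
        split_ifs at hq
        · exact hli a ha (Finset.mem_singleton.1 hq)
        · exact Finset.notMem_empty _ hq
    -- A node with an older sibling is not the root, so at most its own new child lies below it, and
    -- that child is empty.
    · rcases u with u | u
      · obtain ⟨-, -, b, hb, -, -, rfl⟩ := hold _ u hwu
        rcases x with x | x
        · exact h.node_ne_root hb (hch _ x hux).1
        · rcases Relation.ReflTransGen.cases_head hxv with rfl | ⟨y, hxy, -⟩
          · have hx : node b = x := hux
            subst hx
            rw [hinr, if_neg (h.node_ne_root hb)] at hq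
            exact Finset.notMem_empty _ hq
          · rcases y with y | y <;> exact hxy.elim
      · rcases x with x | x <;> exact hux.elim
  have hupd : T.update (permNBA n) i.succ = T.expand (permNBA n) i.succ := by
    rw [OTree.update, hhor, vertical_eq_self]
    rintro (u | u) ⟨hne, hfull⟩
    · rw [hinl] at hne
      rcases h.cover u hne with rfl | ⟨j, hj, rfl⟩
      · obtain ⟨w, hw, h0⟩ := hfull 0 (by simp [hinl, h.root])
        rcases w with w | w
        · obtain ⟨j, hj, rfl⟩ := (hch _ w hw).2
          rw [hinl, h.entry j hj, Finset.mem_singleton] at h0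
          exact Fin.succ_ne_zero _ h0.symm
        · rw [hinr] at h0
          split_ifs at h0
          · exact Fin.succ_ne_zero _ (Finset.mem_singleton.1 h0).symm
          · exact Finset.notMem_empty _ h0
      · obtain ⟨w, hw, h0⟩ := hfull (loopState j) (by simp [hinl, h.entry j hj])
        rcases w with w | w
        · exact h.node_ne_root hj (hch _ w hw).1
        · have hw' : node j = w := hw
          subst hw'
          rw [hinr, if_neg (h.node_ne_root hj)] at h0
          exact Finset.notMem_empty _ h0
    · obtain ⟨q, hq⟩ := hne
      obtain ⟨w, hw, -⟩ := hfull q hq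
      rcases w with w | w <;> exact hw.elim
  have hmem : ∀ j ∈ l, j ≠ i := fun j hj he => hi (he ▸ hj)
  rw [hupd]
  refine ⟨(hinl r).trans h.root, fun j hj => ?_, ?_, ?_, ?_⟩
  · by_cases hji : j = i
    · simp only [hji, if_true, hinr]
    · simp only [if_neg hji, hinl]
      exact h.entry j (by simpa [hji] using hj)
  · rintro (v | v) hv
    · rw [hinl] at hv
      rcases h.cover v hv with rfl | ⟨j, hj, rfl⟩
      · exact Or.inl rfl
      · exact Or.inr ⟨j, by simp [hj], by simp [hmem j hj]⟩
    · rw [hinrne v hv]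
      exact Or.inr ⟨i, by simp, by simp⟩
  · rintro (u | u) (v | v) hu hv
    · rw [hinl] at hu hv
      exact (h.child u v hu hv).trans (by simp)
    · rw [hinrne v hv]
      simp only [Sum.inl.injEq, ne_eq, reduceCtorEq, not_false_eq_true, and_true]
      exact Iff.rfl
    · simp only [reduceCtorEq, false_and, iff_false]
      exact id
    · simp only [reduceCtorEq, false_and, iff_false]
      exact id
  · have hleft : ∀ a b, [a, b].Sublist l → a ≠ i ∧ b ≠ i := fun a b hs =>
      ⟨hmem a (hs.subset (by simp)), hmem b (hs.subset (by simp))⟩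
    rintro (u | u) (v | v) hu hv
    · rw [hinl] at hu hv
      refine (h.older u v hu hv).trans ⟨?_, ?_⟩
      · rintro ⟨a, b, hs, rfl, rfl⟩
        obtain ⟨h1, h2⟩ := hleft a b hs
        exact ⟨a, b, pair_sublist_append_singleton.2 (Or.inl hs), by simp [h1], by simp [h2]⟩
      · rintro ⟨a, b, hs, h1, h2⟩
        rcases pair_sublist_append_singleton.1 hs with hs | ⟨-, rfl⟩
        · obtain ⟨h3, h4⟩ := hleft a b hs
          rw [if_neg h3] at h1
          rw [if_neg h4] at h2
          exact ⟨a, b, hs, Sum.inl.inj h1, Sum.inl.inj h2⟩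
        · simp at h2
    · rw [hinl] at hu
      rw [hinrne v hv]
      change T.child r u ↔ _
      rw [h.child r u h.root_nonempty hu]
      constructor
      · rintro ⟨-, hur⟩
        obtain ⟨j, hj, rfl⟩ := (h.cover u hu).resolve_left hur
        exact ⟨j, i, pair_sublist_append_singleton.2 (Or.inr ⟨hj, rfl⟩), by simp [hmem j hj],
          by simp⟩
      · rintro ⟨a, b, hs, h1, h2⟩
        rcases pair_sublist_append_singleton.1 hs with hs | ⟨ha, rfl⟩
        · rw [if_neg (hleft a b hs).2] at h2
          exact absurd h2 (by simp)
        · rw [if_neg (hmem a ha)] at h1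
          rw [Sum.inl.inj h1]
          exact ⟨rfl, h.node_ne_root ha⟩
    all_goals
      refine iff_of_false id ?_
      rintro ⟨a, b, hs, h1, -⟩
      have ha : a ∈ l := by
        rcases pair_sublist_append_singleton.1 hs with hs | hs
        · exact hs.subset (by simp)
        · exact hs.1
      rw [if_neg (hmem a ha)] at h1
      simp at h1

/-- The tree says that `i` has been split off before `j`. -/
def Before (T : OTree N (Fin (n + 2))) (i j : Fin n) : Prop :=
  ∃ u v, T.label u = {loopState i} ∧ T.label v = {loopState j} ∧ T.older u v

lemma IsStar.pairwise {l : List (Fin n)} {T : OTree N (Fin (n + 2))} (h : IsStar l T) :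
    l.Pairwise T.Before := by
  obtain ⟨⟨r, node, h⟩, -⟩ := h
  rw [List.pairwise_iff_forall_sublist]
  intro i j hs
  have hi : i ∈ l := hs.subset (by simp)
  have hj : j ∈ l := hs.subset (by simp)
  exact ⟨node i, node j, h.entry i hi, h.entry j hj,
    (h.older _ _ (h.node_nonempty hi) (h.node_nonempty hj)).2 ⟨i, j, hs, rfl, rfl⟩⟩

/-- `Before` mentions only labels. Labels identify the entries of `l`, so it amounts to the order of
occurrence in `l`, which is strict without duplicates. -/
lemma IsStar.before_asymm {l : List (Fin n)} (hl : l.Nodup) {T : OTree N (Fin (n + 2))}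
    (h : IsStar l T) (i j : Fin n) (hij : T.Before i j) : ¬ T.Before j i := by
  obtain ⟨⟨r, node, h⟩, -⟩ := h
  have key : ∀ i j, T.Before i j → [i, j].Sublist l := by
    rintro i j ⟨u, v, hu, hv, huv⟩
    obtain ⟨a, b, hs, rfl, rfl⟩ := (h.older u v (hu ▸ Finset.singleton_nonempty _)
      (hv ▸ Finset.singleton_nonempty _)).1 huv
    rw [h.entry a (hs.subset (by simp))] at hu
    rw [h.entry b (hs.subset (by simp))] at hv
    have h1 := Fin.succ_injective _ (Fin.succ_injective _ (Finset.singleton_injective hu))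
    have h2 := Fin.succ_injective _ (Fin.succ_injective _ (Finset.singleton_injective hv))
    rwa [← h1, ← h2]
  intro hji
  have h1 := key i j hij
  have h2 := key j i hji
  have hp : l.Pairwise fun a b => l.idxOf a < l.idxOf b := by
    rw [List.pairwise_iff_getElem]
    intro a b ha hb hab
    rwa [List.Nodup.idxOf_getElem hl, List.Nodup.idxOf_getElem hl]
  rw [List.pairwise_iff_forall_sublist] at hp
  exact lt_asymm (hp h1) (hp h2)

/-! ### Names -/

section Names

variable {α Q : Type} [Fintype Q] [LinearOrder Q]

/-- At most half of the `2 |Q|` names are in use, so the free ones suffice for one new child per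
nonempty node. Old and new names cannot collide, since a new name was unused, and new names are
distinct since they copy the distinct positions of the parents. -/
lemma exists_safraName (A : NBA α Q) (a : α) (T : OTree (Fin (2 * Fintype.card Q)) Q)
    (hcard : (Finset.univ.filter fun v => (T.label v).Nonempty).card ≤ Fintype.card Q)
    (h : ∀ v, ((T.update A a).label (.inr v)).Nonempty → (T.label v).Nonempty)
    (h' : ∀ v, ((T.update A a).label (.inl v)).Nonempty → (T.label v).Nonempty) :
    ∃ f : Fin (2 * Fintype.card Q) ⊕ Fin (2 * Fintype.card Q) → Fin (2 * Fintype.card Q),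
      (∀ x, ((T.update A a).label x).Nonempty → ∀ k, safraName T x k ↔ k = f x) ∧
      ∀ x y, ((T.update A a).label x).Nonempty → ((T.update A a).label y).Nonempty →
        f x = f y → x = y := by
  have hempty : Fintype.card Q ≤ (Finset.univ.filter fun v => T.label v = ∅).card := by
    have := Finset.card_filter_add_card_filter_not (s := Finset.univ)
      (fun v => (T.label v).Nonempty)
    simp only [Finset.not_nonempty_iff_eq_empty, Finset.card_univ, Fintype.card_fin] at this
    omega
  have key : ∀ x, ∃ k, ((T.update A a).label x).Nonempty →
      safraName T x k ∧ ∀ k', safraName T x k' → k' = k := by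
    rintro (v | v)
    · exact ⟨v, fun _ => ⟨rfl, fun _ h => h⟩⟩
    · by_cases hv : (T.label v).Nonempty
      · obtain ⟨k, hk, he⟩ := exists_card_filter_rel_eq (· < ·) (fun u => T.label u = ∅)
          ((card_filter_rel_lt_card (· < ·) (fun u => (T.label u).Nonempty) hv).trans_le
            (hcard.trans hempty))
        refine ⟨k, fun _ => ⟨⟨hk, hv, he.symm⟩, ?_⟩⟩
        rintro k' ⟨hk', -, he'⟩
        exact eq_of_card_filter_rel_eq (· < ·) (fun u => T.label u = ∅) hk' hk
          (he'.symm.trans he.symm)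
      · exact ⟨v, fun hne => absurd (h v hne) hv⟩
  choose f hf using key
  refine ⟨f, fun x hx k => ⟨(hf x hx).2 k, by rintro rfl; exact (hf x hx).1⟩,
    fun x y hx hy hxy => ?_⟩
  have h1 := (hf x hx).1
  have h2 := (hf y hy).1
  rw [hxy] at h1
  rcases x with x | x <;> rcases y with y | y
  · exact congrArg _ (h1.symm.trans h2)
  · have h1 : f (.inr y) = x := h1
    rw [h1] at h2
    exact absurd h2.1 (h' x hx).ne_empty
  · have h2 : f (.inr x) = y := hxy.trans h2
    rw [← hxy, h2] at h1
    exact absurd h1.1 (h' y hy).ne_empty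
  · exact congrArg _ (eq_of_card_filter_rel_eq (· < ·) (fun u => (T.label u).Nonempty) h1.2.1 h2.2.1
      (h1.2.2.trans h2.2.2.symm))

end Names

/-- A nonempty node has fewer than `m` nonempty nodes before it, so its position is itself an
admissible name. -/
lemma exists_pitermanName {Q : Type} {m : ℕ} (T : OTree (Fin m ⊕ Fin m) Q)
    (hcard : (Finset.univ.filter fun v => (T.label v).Nonempty).card ≤ m) :
    ∃ f : Fin m ⊕ Fin m → Fin m,
      (∀ x, (T.label x).Nonempty → ∀ k, pitermanName T x k ↔ k = f x) ∧
      ∀ x y, (T.label x).Nonempty → (T.label y).Nonempty → f x = f y → x = y := by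
  classical
  have : IsStrictTotalOrder (Fin m ⊕ Fin m) (Sum.Lex (· < ·) (· < ·)) := {}
  have hlt : ∀ x, (T.label x).Nonempty → (Finset.univ.filter fun y =>
      Sum.Lex (· < ·) (· < ·) y x ∧ (T.label y).Nonempty).card < m := fun x hx =>
    (card_filter_rel_lt_card (Sum.Lex (· < ·) (· < ·)) (fun u => (T.label u).Nonempty) hx).trans_le
      hcard
  -- The value at empty nodes is irrelevant; the underlying old node merely supplies some element of
  -- `Fin m`.
  refine ⟨fun x => if hx : (T.label x).Nonempty then ⟨_, hlt x hx⟩ else Sum.elim id id x,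
    fun x hx k => ?_, fun x y hx hy hxy => ?_⟩
  · simp only [dif_pos hx, Fin.ext_iff]
    unfold pitermanName
    constructor
    · rintro ⟨-, h⟩
      rw [← h]
    · intro h
      refine ⟨hx, ?_⟩
      rw [h]
  · simp only [hx, hy, dif_pos, Fin.mk.injEq] at hxy
    exact eq_of_card_filter_rel_eq (Sum.Lex (· < ·) (· < ·)) (fun u => (T.label u).Nonempty) hx hy
      hxy

end OTree

open OTree

section SafraPiterman

variable {n : ℕ}

lemma isStar_safra_init :
    IsStar [] ((safra (permNBA n)).toDRA.step (safra (permNBA n)).toDRA.init 0) := by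
  have h := starInv_update_single (n := n) (m := 2 * Fintype.card (Fin (n + 2))) (by simp)
  have hne : ∀ x, (((single (2 * Fintype.card (Fin (n + 2))) 0).update (permNBA n) 0).label
      x).Nonempty → x = .inl ⟨0, by simp⟩ := fun x hx =>
    (h.cover x hx).resolve_right (by simp)
  have hz : ((single (2 * Fintype.card (Fin (n + 2))) (0 : Fin (n + 2))).label
      ⟨0, by simp⟩).Nonempty := by simp [single]
  obtain ⟨f, hf, hinj⟩ := exists_safraName (permNBA n) 0
    (single (2 * Fintype.card (Fin (n + 2))) 0) (by
      refine (Finset.card_le_one.2 fun x hx y hy => ?_).trans (by simp)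
      have : ∀ z ∈ Finset.univ.filter fun v => ((single (2 * Fintype.card (Fin (n + 2)))
          (0 : Fin (n + 2))).label v).Nonempty, z.val = 0 := by
        intro z hz
        by_contra hc
        rw [Finset.mem_filter] at hz
        have h0 := hz.2
        simp only [single, if_neg hc] at h0
        exact Finset.not_nonempty_empty h0
      exact Fin.ext ((this x hx).trans (this y hy).symm))
    (fun v hv => absurd (hne _ hv) (by simp))
    (fun v hv => by rw [Sum.inl.inj (hne _ hv)]; exact hz)
  exact ⟨⟨_, _, (h.rename hf hinj).1⟩, (h.rename hf hinj).2⟩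

lemma isStar_safra_step {l : List (Fin n)} (hl : l.Nodup) {i : Fin n} (hi : i ∉ l)
    {T : (safra (permNBA n)).toDRA.State} (h : IsStar l T) :
    IsStar (l ++ [i]) ((safra (permNBA n)).toDRA.step T i.succ) := by
  obtain ⟨⟨r, node, h⟩, hT⟩ := h
  have h' := h.update hT hl hi
  have hc : ∀ x, ((OTree.update (permNBA n) i.succ T).label x).Nonempty →
      (OTree.label T (Sum.elim id id x)).Nonempty := by
    intro x hx
    rcases h'.cover x hx with rfl | ⟨j, hj, rfl⟩
    · exact h.root_nonempty
    · by_cases hji : j = i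
      · simpa [hji] using h.root_nonempty
      · simpa [hji] using h.node_nonempty (j := j) (by simpa [hji] using hj)
  obtain ⟨f, hf, hinj⟩ := exists_safraName (permNBA n) i.succ T (by
      have := h.card_nonempty_le
      have := hl.length_le_card
      rw [Fintype.card_fin] at this
      have := Fintype.card_fin (n + 2)
      omega) (fun v hv => hc _ hv) (fun v hv => hc _ hv)
  exact ⟨⟨_, _, (h'.rename hf hinj).1⟩, (h'.rename hf hinj).2⟩

lemma safra_toDRA_factorial_le (n : ℕ) :
    n.factorial ≤ (safra (permNBA n)).toDRA.reachable.ncard :=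
  factorial_le_ncard_reachable _ Fin.succ _ (DELA.step_init_mem_reachable _ 0)
    (fun l T => IsStar l T) (fun T => Before T) isStar_safra_init
    (fun _ _ _ hl hi h => isStar_safra_step hl hi h) (fun _ _ _ h => h.pairwise)
    (fun _ _ hl h => h.before_asymm hl)

lemma isStar_piterman_init :
    IsStar [] ((pitermanDPA (permNBA n)).step (pitermanDPA (permNBA n)).init 0) := by
  have h := starInv_update_single (n := n) (m := Fintype.card (Fin (n + 2))) (by simp)
  obtain ⟨f, hf, hinj⟩ := exists_pitermanName _ (h.card_nonempty_le.trans (by simp))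
  exact ⟨⟨_, _, (h.rename hf hinj).1⟩, (h.rename hf hinj).2⟩

lemma isStar_piterman_step {l : List (Fin n)} (hl : l.Nodup) {i : Fin n} (hi : i ∉ l)
    {T : (pitermanDPA (permNBA n)).State} (h : IsStar l T) :
    IsStar (l ++ [i]) ((pitermanDPA (permNBA n)).step T i.succ) := by
  obtain ⟨⟨r, node, h⟩, hT⟩ := h
  have h' := h.update hT hl hi
  obtain ⟨f, hf, hinj⟩ := exists_pitermanName _ (h'.card_nonempty_le.trans (by
    have := hl.length_le_card
    rw [Fintype.card_fin] at this ⊢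
    simp only [List.length_append, List.length_singleton]
    omega))
  exact ⟨⟨_, _, (h'.rename hf hinj).1⟩, (h'.rename hf hinj).2⟩

lemma pitermanDPA_factorial_le (n : ℕ) :
    n.factorial ≤ (pitermanDPA (permNBA n)).reachable.ncard :=
  factorial_le_ncard_reachable _ Fin.succ _ (DELA.step_init_mem_reachable _ 0)
    (fun l T => IsStar l T) (fun T => Before T) isStar_piterman_init
    (fun _ _ _ hl hi h => isStar_piterman_step hl hi h) (fun _ _ _ h => h.pairwise)
    (fun _ _ hl h => h.before_asymm hl)

lemma pitermanDPA_isDPA {α Q : Type} [Fintype Q] [LinearOrder Q] (A : NBA α Q) :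
    (pitermanDPA A).IsDPA :=
  ⟨⟨Fintype.card Q + 1, by change 2 * Fintype.card Q + 2 = _; omega⟩, rfl⟩

end SafraPiterman

/-! ## The construction of Kähler and Wilke -/

namespace SplitTree

/-! ### Proper split trees and the splitting of one leaf -/

section General

variable {N Q : Type}

/-- A binary tree in which exactly the leaves have nonempty labels, and in which the leaves are
strictly ordered from left to right. -/
structure Proper (T : SplitTree N Q) : Prop where
  leaf : ∀ u v, (T.label u).Nonempty → ¬ T.son u v
  live : ∀ u v, T.son u v → T.Live v
  sibling : ∀ u v, T.son u v → ∃ w, w ≠ v ∧ T.son u w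
  asymm : ∀ x y, (T.label x).Nonempty → (T.label y).Nonempty → T.leftOf x y → ¬ T.leftOf y x

lemma Proper.present_iff_live {T : SplitTree N Q} (hT : T.Proper) {u : N} :
    T.Present u ↔ T.Live u := by
  constructor
  · rintro (h | ⟨v, h⟩)
    · exact ⟨u, Relation.ReflTransGen.refl, h⟩
    · obtain ⟨y, hy, hne⟩ := hT.live u v h
      exact ⟨y, hy.head h, hne⟩
  · rintro ⟨y, hy, hne⟩
    rcases Relation.ReflTransGen.cases_head hy with rfl | ⟨v, h, -⟩
    · exact Or.inl hne
    · exact Or.inr ⟨v, h⟩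

/-- The leaf `s` of `T` is replaced by an inner node with the sons `k` and `m`. -/
structure IsSplit (T T' : SplitTree N Q) (s : N) (K M : Finset Q) (k m : N) : Prop where
  label : ∀ v q, q ∈ T'.label v ↔ v ≠ s ∧ q ∈ T.label v ∨ v = k ∧ q ∈ K ∨ v = m ∧ q ∈ M
  lson : ∀ u v, T'.lson u v ↔ T.lson u v ∨ u = s ∧ v = k
  rson : ∀ u v, T'.rson u v ↔ T.rson u v ∨ u = s ∧ v = m
  nonempty : (T.label s).Nonempty
  nonempty_left : K.Nonempty
  nonempty_right : M.Nonempty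
  left_new : ¬ T.Present k
  right_new : ¬ T.Present m
  ne : k ≠ m

namespace IsSplit

variable {T T' : SplitTree N Q} {s k m : N} {K M : Finset Q}

lemma son (h : IsSplit T T' s K M k m) (u v : N) :
    T'.son u v ↔ T.son u v ∨ u = s ∧ (v = k ∨ v = m) := by
  simp only [SplitTree.son, h.lson, h.rson]
  tauto

/-- A path from a son to `x` would make `x` itself a son; sons are live, and live names are used. -/
lemma not_desc (hT : T.Proper) {u v x : N} (hx : ¬ T.Present x) (hu : T.son v u) :
    ¬ T.desc u x := by
  intro hd
  have : T.son v u → T.Present x := by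
    intro _
    rcases Relation.ReflTransGen.cases_tail hd with rfl | ⟨p, -, hp⟩
    · exact hT.present_iff_live.2 (hT.live v _ hu)
    · exact hT.present_iff_live.2 (hT.live p _ hp)
  exact hx (this hu)

lemma desc_mono (h : IsSplit T T' s K M k m) {u x : N} (hd : T.desc u x) : T'.desc u x :=
  Relation.ReflTransGen.mono (fun u v huv => (h.son u v).2 (Or.inl huv)) _ _ hd

/-- The names `k` and `m` were unused, so they have no sons in the new tree. A new path is thus an
old one, possibly extended by a final edge from `s`. -/
lemma desc_cases (h : IsSplit T T' s K M k m) {u x : N} (hd : T'.desc u x) :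
    T.desc u x ∨ (x = k ∨ x = m) ∧ T.desc u s := by
  induction hd with
  | refl => exact Or.inl Relation.ReflTransGen.refl
  | @tail y x _ hyx ih =>
    rcases (h.son y x).1 hyx with hs | ⟨rfl, hx⟩
    · rcases ih with ih | ⟨rfl | rfl, -⟩
      · exact Or.inl (ih.tail hs)
      · exact absurd (Or.inr ⟨x, hs⟩) h.left_new
      · exact absurd (Or.inr ⟨x, hs⟩) h.right_new
    · refine Or.inr ⟨hx, ?_⟩
      rcases ih with ih | ⟨rfl | rfl, ih⟩
      · exact ih
      · exact ih
      · exact ih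

lemma not_desc_of_new (h : IsSplit T T' s K M k m) {u x : N} (hu : u = k ∨ u = m)
    (hd : T'.desc u x) : x = u := by
  rcases Relation.ReflTransGen.cases_head hd with rfl | ⟨v, hv, -⟩
  · rfl
  · exfalso
    rcases (h.son u v).1 hv with hs | ⟨rfl, -⟩
    · rcases hu with rfl | rfl
      · exact h.left_new (Or.inr ⟨v, hs⟩)
      · exact h.right_new (Or.inr ⟨v, hs⟩)
    · rcases hu with rfl | rfl
      · exact h.left_new (Or.inl h.nonempty)
      · exact h.right_new (Or.inl h.nonempty)

lemma leftOf_mono (h : IsSplit T T' s K M k m) {x y : N} (hxy : T.leftOf x y) : T'.leftOf x y := by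
  obtain ⟨u, l, r, hl, hr, hx, hy⟩ := hxy
  exact ⟨u, l, r, (h.lson _ _).2 (Or.inl hl), (h.rson _ _).2 (Or.inl hr), h.desc_mono hx,
    h.desc_mono hy⟩

lemma leftOf_new (h : IsSplit T T' s K M k m) {x y : N} (hy : y = k ∨ y = m)
    (hxy : T.leftOf x s) : T'.leftOf x y := by
  obtain ⟨u, l, r, hl, hr, hx, hs⟩ := hxy
  exact ⟨u, l, r, (h.lson _ _).2 (Or.inl hl), (h.rson _ _).2 (Or.inl hr), h.desc_mono hx,
    (h.desc_mono hs).tail ((h.son _ _).2 (Or.inr ⟨rfl, hy⟩))⟩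

lemma leftOf_sons (h : IsSplit T T' s K M k m) : T'.leftOf k m :=
  ⟨s, k, m, (h.lson _ _).2 (Or.inr ⟨rfl, rfl⟩), (h.rson _ _).2 (Or.inr ⟨rfl, rfl⟩),
    Relation.ReflTransGen.refl, Relation.ReflTransGen.refl⟩

lemma nonempty_cases (h : IsSplit T T' s K M k m) {x : N} (hx : (T'.label x).Nonempty) :
    (x ≠ s ∧ x ≠ k ∧ x ≠ m ∧ (T.label x).Nonempty) ∨ x = k ∨ x = m := by
  obtain ⟨q, hq⟩ := hx
  rcases (h.label x q).1 hq with ⟨h1, h2⟩ | ⟨h1, -⟩ | ⟨h1, -⟩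
  · refine Or.inl ⟨h1, ?_, ?_, q, h2⟩
    · rintro rfl
      exact h.left_new (Or.inl ⟨q, h2⟩)
    · rintro rfl
      exact h.right_new (Or.inl ⟨q, h2⟩)
  · exact Or.inr (Or.inl h1)
  · exact Or.inr (Or.inr h1)

open scoped Classical in
/-- The leaf of the old tree above a leaf of the new tree. -/
noncomputable def above (s k m x : N) : N := if x = k ∨ x = m then s else x

lemma above_nonempty (h : IsSplit T T' s K M k m) {x : N} (hx : (T'.label x).Nonempty) :
    (T.label (above s k m x)).Nonempty := by
  unfold above
  split_ifs with hc
  · exact h.nonempty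
  · rcases h.nonempty_cases hx with h1 | h1
    · exact h1.2.2.2
    · exact absurd h1 hc

/-- Since `s` was a leaf, the branching node is either an old inner node or `s` with its two new
sons. In the first case the paths to `k` and `m` can be cut back to `s`. -/
lemma leftOf_cases (h : IsSplit T T' s K M k m) (hT : T.Proper) {x y : N} (hxy : T'.leftOf x y) :
    T.leftOf (above s k m x) (above s k m y) ∨ x = k ∧ y = m := by
  obtain ⟨u, l, r, hl, hr, hx, hy⟩ := hxy
  rcases (h.lson _ _).1 hl with hl | ⟨rfl, rfl⟩ <;> rcases (h.rson _ _).1 hr with hr | ⟨hu, rfl⟩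
  · left
    have key : ∀ l x, T.son u l → T'.desc l x → T.desc l (above s k m x) := by
      intro l x hl hx
      rcases h.desc_cases hx with hx | ⟨hx, hs⟩
      · unfold above
        rw [if_neg]
        · exact hx
        · rintro (rfl | rfl)
          · exact not_desc hT h.left_new hl hx
          · exact not_desc hT h.right_new hl hx
      · unfold above
        rwa [if_pos hx]
    exact ⟨u, l, r, hl, hr, key l x (Or.inl hl) hx, key r y (Or.inr hr) hy⟩
  · subst hu
    exact absurd (Or.inl hl) (hT.leaf u l h.nonempty)
  · exact absurd (Or.inr hr) (hT.leaf u r h.nonempty)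
  · exact Or.inr ⟨h.not_desc_of_new (Or.inl rfl) hx, h.not_desc_of_new (Or.inr rfl) hy⟩

lemma label_nonempty_left (h : IsSplit T T' s K M k m) : (T'.label k).Nonempty := by
  obtain ⟨q, hq⟩ := h.nonempty_left
  exact ⟨q, (h.label k q).2 (Or.inr (Or.inl ⟨rfl, hq⟩))⟩

lemma label_nonempty_right (h : IsSplit T T' s K M k m) : (T'.label m).Nonempty := by
  obtain ⟨q, hq⟩ := h.nonempty_right
  exact ⟨q, (h.label m q).2 (Or.inr (Or.inr ⟨rfl, hq⟩))⟩

lemma proper (h : IsSplit T T' s K M k m) (hT : T.Proper) : T'.Proper where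
  leaf u v hu hs := by
    rcases h.nonempty_cases hu with ⟨h1, -, -, h2⟩ | h1
    · rcases (h.son u v).1 hs with h3 | h3
      · exact hT.leaf u v h2 h3
      · exact h1 h3.1
    · have := h.not_desc_of_new h1 (Relation.ReflTransGen.single hs)
      subst this
      rcases (h.son v v).1 hs with h3 | ⟨rfl, -⟩
      · rcases h1 with rfl | rfl
        · exact h.left_new (Or.inr ⟨_, h3⟩)
        · exact h.right_new (Or.inr ⟨_, h3⟩)
      · rcases h1 with rfl | rfl
        · exact h.left_new (Or.inl h.nonempty)
        · exact h.right_new (Or.inl h.nonempty)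
  live u v hs := by
    rcases (h.son u v).1 hs with h1 | ⟨-, rfl | rfl⟩
    · obtain ⟨y, hy, q, hq⟩ := hT.live u v h1
      by_cases hys : y = s
      · subst hys
        exact ⟨k, (h.desc_mono hy).tail ((h.son _ _).2 (Or.inr ⟨rfl, Or.inl rfl⟩)),
          h.label_nonempty_left⟩
      · exact ⟨y, h.desc_mono hy, q, (h.label y q).2 (Or.inl ⟨hys, hq⟩)⟩
    · exact ⟨v, Relation.ReflTransGen.refl, h.label_nonempty_left⟩
    · exact ⟨v, Relation.ReflTransGen.refl, h.label_nonempty_right⟩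
  sibling u v hs := by
    rcases (h.son u v).1 hs with h1 | ⟨rfl, rfl | rfl⟩
    · obtain ⟨w, hw, hs⟩ := hT.sibling u v h1
      exact ⟨w, hw, (h.son _ _).2 (Or.inl hs)⟩
    · exact ⟨m, h.ne.symm, (h.son _ _).2 (Or.inr ⟨rfl, Or.inr rfl⟩)⟩
    · exact ⟨k, h.ne, (h.son _ _).2 (Or.inr ⟨rfl, Or.inl rfl⟩)⟩
  -- Both relations are pulled back along `above`. Only the pair of the new sons is lost there: it
  -- collapses to `s` twice, and `s` is not to the left of itself.
  asymm x y hx hy hxy hyx := by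
    have hx' := h.above_nonempty hx
    have hy' := h.above_nonempty hy
    have hkm : ∀ x y, x = k → y = m → ¬ T.leftOf (above s k m y) (above s k m x) := by
      rintro x y rfl rfl hl
      simp only [above, true_or, or_true, if_true] at hl
      exact hT.asymm s s h.nonempty h.nonempty hl hl
    rcases h.leftOf_cases hT hxy with h1 | ⟨h1, h2⟩ <;>
      rcases h.leftOf_cases hT hyx with h3 | ⟨h3, h4⟩
    · exact hT.asymm _ _ hx' hy' h1 h3
    · exact hkm _ _ h3 h4 h1
    · exact hkm _ _ h1 h2 h3
    · exact h.ne (h1.symm.trans h4)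

end IsSplit

lemma reduce_subset {T : SplitTree N Q} (x : N) : T.reduce.label x ⊆ T.label x := by
  classical
  exact Finset.filter_subset _ _

lemma mem_reduce {T : SplitTree N Q} {x : N} {q : Q} :
    q ∈ T.reduce.label x ↔ q ∈ T.label x ∧ ∀ y, T.leftOf y x → q ∉ T.label y := by
  classical
  exact Finset.mem_filter

end General

/-! ### One step of the split tree, up to contraction -/

section Step

variable {α Q N : Type} [LinearOrder Q] {A : NBA α Q} {a : α} {T : SplitTree N Q}

lemma son_expand_inr {u v : N} {b : Bool} :
    (T.expand A a).son (.inl u) (.inr (v, b)) ↔ u = v ∧ (T.label u).Nonempty := by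
  simp only [son, expand]
  cases b <;> simp

lemma not_son_expand {x : N × Bool} {y : N ⊕ N × Bool} : ¬ (T.expand A a).son (.inr x) y := by
  rintro (h | h) <;> exact h

lemma desc_expand_inr {x : N × Bool} {y : N ⊕ N × Bool} (h : (T.expand A a).desc (.inr x) y) :
    y = .inr x := by
  rcases Relation.ReflTransGen.cases_head h with h | ⟨z, h, -⟩
  · exact h.symm
  · exact absurd h not_son_expand

lemma desc_expand_inl {u v : N} (h : T.desc u v) : (T.expand A a).desc (.inl u) (.inl v) := by
  induction h with
  | refl => exact Relation.ReflTransGen.refl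
  | tail _ h ih => exact ih.tail h

lemma desc_expand_cases {u : N} {y : N ⊕ N × Bool} (h : (T.expand A a).desc (.inl u) y) :
    (∃ v, y = .inl v ∧ T.desc u v) ∨ ∃ v b, y = .inr (v, b) ∧ T.desc u v ∧ (T.label v).Nonempty := by
  induction h with
  | refl => exact Or.inl ⟨u, rfl, Relation.ReflTransGen.refl⟩
  | @tail x y _ hxy ih =>
    rcases ih with ⟨v, rfl, hv⟩ | ⟨v, b, rfl, -⟩
    · rcases y with y | ⟨y, b⟩
      · exact Or.inl ⟨y, rfl, hv.tail hxy⟩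
      · obtain ⟨rfl, hne⟩ := son_expand_inr.1 hxy
        exact Or.inr ⟨v, b, rfl, hv, hne⟩
    · exact absurd hxy not_son_expand

lemma leftOf_expand_cases (hT : T.Proper) {v w : N} {b c : Bool}
    (h : (T.expand A a).leftOf (.inr (v, b)) (.inr (w, c))) :
    T.leftOf v w ∨ v = w ∧ b = true ∧ c = false := by
  obtain ⟨p, l, r, hl, hr, hx, hy⟩ := h
  rcases p with p | p
  swap
  · exact hl.elim
  rcases l with l | ⟨l, b'⟩ <;> rcases r with r | ⟨r, c'⟩
  · left
    rcases desc_expand_cases hx with ⟨_, h1, -⟩ | ⟨v', b', h1, h2, -⟩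
    · simp at h1
    rcases desc_expand_cases hy with ⟨_, h3, -⟩ | ⟨w', c', h3, h4, -⟩
    · simp at h3
    simp only [Sum.inr.injEq, Prod.mk.injEq] at h1 h3
    obtain ⟨⟨rfl, -⟩, rfl, -⟩ := And.intro h1 h3
    exact ⟨p, l, r, hl, hr, h2, h4⟩
  · exact absurd (Or.inl hl) (hT.leaf p l hr.2.2)
  · exact absurd (Or.inr hr) (hT.leaf p r hl.2.2)
  · right
    have h1 := desc_expand_inr hx
    have h2 := desc_expand_inr hy
    obtain ⟨rfl, rfl, -⟩ := hl
    obtain ⟨rfl, rfl, -⟩ := hr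
    simp only [Sum.inr.injEq, Prod.mk.injEq] at h1 h2
    exact ⟨h1.1.trans h2.1.symm, h1.2, h2.2⟩

lemma leftOf_expand_sons {v : N} (h : (T.label v).Nonempty) :
    (T.expand A a).leftOf (.inr (v, true)) (.inr (v, false)) :=
  ⟨.inl v, .inr (v, true), .inr (v, false), ⟨rfl, rfl, h⟩, ⟨rfl, rfl, h⟩, Relation.ReflTransGen.refl,
    Relation.ReflTransGen.refl⟩

lemma nonempty_of_expand {v : N} {b : Bool} (h : ((T.expand A a).label (.inr (v, b))).Nonempty) :
    (T.label v).Nonempty := by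
  obtain ⟨q, hq⟩ := h
  cases b <;> obtain ⟨p, hp, -⟩ := Finset.mem_biUnion.1 hq <;> exact ⟨p, hp⟩

variable (A a T) in
/-- Both sons of the leaf `v` are nonempty, provided that the right one is. -/
def Splits (v : N) : Prop := ((T.expand A a).reduce.label (.inr (v, true))).Nonempty

lemma Splits.nonempty {v : N} (h : T.Splits A a v) : (T.label v).Nonempty :=
  nonempty_of_expand (h.mono (reduce_subset _))

lemma live_reduce_inr {x : N × Bool} :
    (T.expand A a).reduce.Live (.inr x) ↔ ((T.expand A a).reduce.label (.inr x)).Nonempty := by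
  constructor
  · rintro ⟨y, hy, hne⟩
    rwa [desc_expand_inr (T := T) (A := A) (a := a) hy] at hne
  · exact fun h => ⟨_, Relation.ReflTransGen.refl, h⟩

/-- By `hR` every leaf retains a state in its right son, so no old node dies. This is what confines
the contraction to the last level. -/
lemma live_reduce_inl (hR : ∀ v, (T.label v).Nonempty →
    ((T.expand A a).reduce.label (.inr (v, false))).Nonempty) {u : N} :
    (T.expand A a).reduce.Live (.inl u) ↔ T.Live u := by
  constructor
  · rintro ⟨y, hy, hne⟩
    rcases desc_expand_cases (T := T) (A := A) (a := a) hy with ⟨v, rfl, -⟩ | ⟨v, b, rfl, h, hv⟩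
    · exact absurd (hne.mono (reduce_subset _)) Finset.not_nonempty_empty
    · exact ⟨v, h, hv⟩
  · rintro ⟨v, h, hv⟩
    exact ⟨.inr (v, false), (desc_expand_inl (A := A) (a := a) h).tail
      (son_expand_inr.2 ⟨rfl, hv⟩), hR v hv⟩

lemma son_reduce_inr {u v : N} {b : Bool} :
    (T.expand A a).reduce.son (.inl u) (.inr (v, b)) ↔ u = v ∧ (T.label u).Nonempty :=
  son_expand_inr (A := A) (a := a)

lemma not_son_reduce {x : N × Bool} {y : N ⊕ N × Bool} :
    ¬ (T.expand A a).reduce.son (.inr x) y :=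
  not_son_expand (A := A) (a := a) (T := T) (x := x) (y := y)

/-- Only leaves that are not split have a single live son. -/
lemma unary_reduce_iff (hT : T.Proper) (hR : ∀ v, (T.label v).Nonempty →
    ((T.expand A a).reduce.label (.inr (v, false))).Nonempty) {x y : N ⊕ N × Bool} :
    (T.expand A a).reduce.unary x y ↔
      ∃ v, x = .inl v ∧ y = .inr (v, false) ∧ (T.label v).Nonempty ∧ ¬ T.Splits A a v := by
  constructor
  · rintro ⟨hs, hl, huniq⟩
    rcases x with u | x
    swap
    · exact absurd hs not_son_reduce
    rcases y with v | ⟨v, b⟩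
    · exfalso
      obtain ⟨w, hw, hs'⟩ := hT.sibling u v hs
      exact hw (Sum.inl.inj (huniq (.inl w) hs' ((live_reduce_inl hR).2 (hT.live u w hs'))))
    · obtain ⟨rfl, hne⟩ := son_reduce_inr.1 hs
      have hright := huniq (.inr (u, false)) (son_reduce_inr.2 ⟨rfl, hne⟩)
        (live_reduce_inr.2 (hR u hne))
      refine ⟨u, rfl, hright.symm, hne, fun hsp => ?_⟩
      have hleft := huniq (.inr (u, true)) (son_reduce_inr.2 ⟨rfl, hne⟩) (live_reduce_inr.2 hsp)
      simpa using hleft.trans hright.symm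
  · rintro ⟨v, rfl, rfl, hne, hns⟩
    refine ⟨son_reduce_inr.2 ⟨rfl, hne⟩, live_reduce_inr.2 (hR v hne), fun z hz hlz => ?_⟩
    rcases z with w | ⟨w, b⟩
    · exact absurd hz (hT.leaf v w hne)
    · obtain ⟨rfl, -⟩ := son_reduce_inr.1 hz
      cases b
      · rfl
      · exact absurd (live_reduce_inr.1 hlz) hns

lemma kept_reduce_inl (hT : T.Proper) (hR : ∀ v, (T.label v).Nonempty →
    ((T.expand A a).reduce.label (.inr (v, false))).Nonempty) {u : N} :
    (T.expand A a).reduce.Kept (.inl u) ↔ T.Live u := by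
  rw [Kept, live_reduce_inl hR, and_iff_left]
  rintro ⟨p, hp⟩
  obtain ⟨v, -, h, -⟩ := (unary_reduce_iff hT hR).1 hp
  simp at h

lemma kept_reduce_inr (hT : T.Proper) (hR : ∀ v, (T.label v).Nonempty →
    ((T.expand A a).reduce.label (.inr (v, false))).Nonempty) {v : N} {b : Bool} :
    (T.expand A a).reduce.Kept (.inr (v, b)) ↔ T.Splits A a v := by
  rw [Kept, live_reduce_inr]
  constructor
  · rintro ⟨hne, hu⟩
    cases b
    · by_contra hns
      exact hu ⟨_, (unary_reduce_iff hT hR).2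
        ⟨v, rfl, rfl, nonempty_of_expand (hne.mono (reduce_subset _)), hns⟩⟩
    · exact hne
  · refine fun h => ⟨?_, ?_⟩
    · cases b
      · exact hR v h.nonempty
      · exact h
    · rintro ⟨p, hp⟩
      obtain ⟨w, -, he, -, hns⟩ := (unary_reduce_iff hT hR).1 hp
      simp only [Sum.inr.injEq, Prod.mk.injEq] at he
      exact hns (he.1 ▸ h)

/-- Unary edges end in new sons, from which no edges leave, so unary paths have at most one edge. -/
lemma unary_path (hT : T.Proper) (hR : ∀ v, (T.label v).Nonempty →
    ((T.expand A a).reduce.label (.inr (v, false))).Nonempty) {x y : N ⊕ N × Bool} :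
    Relation.ReflTransGen (T.expand A a).reduce.unary x y ↔ y = x ∨
      ∃ v, x = .inl v ∧ y = .inr (v, false) ∧ (T.label v).Nonempty ∧ ¬ T.Splits A a v := by
  constructor
  · intro h
    rcases Relation.ReflTransGen.cases_head h with h | ⟨z, h, hz⟩
    · exact Or.inl h.symm
    · right
      obtain ⟨v, rfl, rfl, hne, hns⟩ := (unary_reduce_iff hT hR).1 h
      rcases Relation.ReflTransGen.cases_head hz with rfl | ⟨z', h', -⟩
      · exact ⟨v, rfl, rfl, hne, hns⟩
      · obtain ⟨w, he, -⟩ := (unary_reduce_iff hT hR).1 h'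
        simp at he
  · rintro (rfl | h)
    · exact Relation.ReflTransGen.refl
    · exact Relation.ReflTransGen.single ((unary_reduce_iff hT hR).2 h)

variable [Fintype Q]

/-- A leaf that is not split absorbs its right son and takes over its label, while a leaf that is
split turns into an inner node and so loses its label. -/
lemma contract_label_inl (hT : T.Proper) (hR : ∀ v, (T.label v).Nonempty →
    ((T.expand A a).reduce.label (.inr (v, false))).Nonempty) {u : N} {q : Q} :
    q ∈ (T.expand A a).reduce.contract.label (.inl u) ↔ (T.label u).Nonempty ∧ ¬ T.Splits A a u ∧
      q ∈ (T.expand A a).reduce.label (.inr (u, false)) := by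
  simp only [contract, Finset.mem_filter, Finset.mem_univ, true_and, kept_reduce_inl hT hR,
    unary_path hT hR]
  constructor
  · rintro ⟨-, y, rfl | ⟨v, he, rfl, hne, hns⟩, hq⟩
    · exact absurd (reduce_subset _ hq) (Finset.notMem_empty _)
    · obtain rfl := Sum.inl.inj he
      exact ⟨hne, hns, hq⟩
  · rintro ⟨hne, hns, hq⟩
    exact ⟨⟨u, Relation.ReflTransGen.refl, hne⟩, _, Or.inr ⟨u, rfl, rfl, hne, hns⟩, hq⟩

lemma contract_label_inr (hT : T.Proper) (hR : ∀ v, (T.label v).Nonempty →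
    ((T.expand A a).reduce.label (.inr (v, false))).Nonempty) {v : N} {b : Bool} {q : Q} :
    q ∈ (T.expand A a).reduce.contract.label (.inr (v, b)) ↔ T.Splits A a v ∧
      q ∈ (T.expand A a).reduce.label (.inr (v, b)) := by
  simp only [contract, Finset.mem_filter, Finset.mem_univ, true_and, kept_reduce_inr hT hR,
    unary_path hT hR]
  simp

lemma contract_lson (hT : T.Proper) (hR : ∀ v, (T.label v).Nonempty →
    ((T.expand A a).reduce.label (.inr (v, false))).Nonempty) {x z : N ⊕ N × Bool} :
    (T.expand A a).reduce.contract.lson x z ↔ (∃ u v, x = .inl u ∧ z = .inl v ∧ T.lson u v) ∨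
      ∃ v, x = .inl v ∧ z = .inr (v, true) ∧ T.Splits A a v := by
  simp only [contract, unary_path hT hR]
  constructor
  · rintro ⟨-, hz, y, rfl | ⟨v, rfl, rfl, -⟩, hyz⟩
    · rcases y with u | y
      swap
      · exact hyz.elim
      rcases z with v | ⟨v, b⟩
      · exact Or.inl ⟨u, v, rfl, rfl, hyz⟩
      · obtain ⟨rfl, rfl, -⟩ := hyz
        exact Or.inr ⟨u, rfl, rfl, (kept_reduce_inr hT hR).1 hz⟩
    · exact hyz.elim
  · rintro (⟨u, v, rfl, rfl, h⟩ | ⟨v, rfl, rfl, h⟩)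
    · exact ⟨(kept_reduce_inl hT hR).2 (hT.present_iff_live.1 (Or.inr ⟨v, Or.inl h⟩)),
        (kept_reduce_inl hT hR).2 (hT.live u v (Or.inl h)), _, Or.inl rfl, h⟩
    · exact ⟨(kept_reduce_inl hT hR).2 ⟨v, Relation.ReflTransGen.refl, h.nonempty⟩,
        (kept_reduce_inr hT hR).2 h, _, Or.inl rfl, rfl, rfl, h.nonempty⟩

lemma contract_rson (hT : T.Proper) (hR : ∀ v, (T.label v).Nonempty →
    ((T.expand A a).reduce.label (.inr (v, false))).Nonempty) {x z : N ⊕ N × Bool} :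
    (T.expand A a).reduce.contract.rson x z ↔ (∃ u v, x = .inl u ∧ z = .inl v ∧ T.rson u v) ∨
      ∃ v, x = .inl v ∧ z = .inr (v, false) ∧ T.Splits A a v := by
  simp only [contract, unary_path hT hR]
  constructor
  · rintro ⟨-, hz, y, rfl | ⟨v, rfl, rfl, -⟩, hyz⟩
    · rcases y with u | y
      swap
      · exact hyz.elim
      rcases z with v | ⟨v, b⟩
      · exact Or.inl ⟨u, v, rfl, rfl, hyz⟩
      · obtain ⟨rfl, rfl, -⟩ := hyz
        exact Or.inr ⟨u, rfl, rfl, (kept_reduce_inr hT hR).1 hz⟩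
    · exact hyz.elim
  · rintro (⟨u, v, rfl, rfl, h⟩ | ⟨v, rfl, rfl, h⟩)
    · exact ⟨(kept_reduce_inl hT hR).2 (hT.present_iff_live.1 (Or.inr ⟨v, Or.inr h⟩)),
        (kept_reduce_inl hT hR).2 (hT.live u v (Or.inr h)), _, Or.inl rfl, h⟩
    · exact ⟨(kept_reduce_inl hT hR).2 ⟨v, Relation.ReflTransGen.refl, h.nonempty⟩,
        (kept_reduce_inr hT hR).2 h, _, Or.inl rfl, rfl, rfl, h.nonempty⟩

end Step

/-! ### The renamed tree when a single leaf is split -/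

section Next

variable {α Q : Type} [Fintype Q] [LinearOrder Q] {A : NBA α Q} {a : α} {m : ℕ}
  {T : SplitTree (Fin m) Q}

open scoped Classical in
/-- If exactly the leaf `s` is split, then the next tree arises by giving two sons to `s`. -/
lemma exists_isSplit_next (hT : T.Proper) (hR : ∀ v, (T.label v).Nonempty →
    ((T.expand A a).reduce.label (.inr (v, false))).Nonempty) {s : Fin m}
    (hs : ∀ v, T.Splits A a v ↔ v = s)
    (hkeep : ∀ v, v ≠ s → (T.label v).Nonempty →
      (T.expand A a).reduce.label (.inr (v, false)) = T.label v)
    (hcard : 2 * (Finset.univ.filter fun v => (T.label v).Nonempty).card +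
      (Finset.univ.filter fun v => T.Present v).card ≤ m) :
    ∃ k l, IsSplit T (T.next A a) s ((T.expand A a).reduce.label (.inr (s, true)))
      ((T.expand A a).reduce.label (.inr (s, false))) k l := by
  have hsp : T.Splits A a s := (hs s).2 rfl
  have hlt := card_filter_rel_lt_card (· < ·) (fun u => (T.label u).Nonempty) hsp.nonempty
  have hfree : (Finset.univ.filter fun v => T.Present v).card +
      (Finset.univ.filter fun v => ¬ T.Present v).card = m := by
    rw [Finset.card_filter_add_card_filter_not]
    simp
  have hname : ∀ b : Bool, ∃ k, ∀ k', T.name (.inr (s, b)) k' ↔ k' = k := by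
    intro b
    -- The leaf `s` is not counted among those before it, so the requested index is less than twice
    -- the number of leaves, and `hcard` provides that many free names.
    obtain ⟨k, hk, he⟩ := exists_card_filter_rel_eq (· < ·) (fun u => ¬ T.Present u)
      (j := 2 * (Finset.univ.filter fun u => u < s ∧ (T.label u).Nonempty).card +
        if b then 0 else 1) (by split_ifs <;> omega)
    refine ⟨k, fun k' => ⟨fun h => ?_, ?_⟩⟩
    · exact eq_of_card_filter_rel_eq (· < ·) (fun u => ¬ T.Present u) h.1 hk
        (h.2.2.symm.trans he.symm)
    · rintro rfl
      exact ⟨hk, hsp.nonempty, he.symm⟩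
  obtain ⟨k, hk⟩ := hname true
  obtain ⟨l, hl⟩ := hname false
  have hk' := (hk k).2 rfl
  have hl' := (hl l).2 rfl
  have hinl : ∀ v k, T.name (.inl v) k ↔ k = v := fun _ _ => Iff.rfl
  refine ⟨k, l, ⟨fun v q => ?_, fun u v => ?_, fun u v => ?_, hsp.nonempty, hsp,
    hR s hsp.nonempty, hk'.1, hl'.1, ?_⟩⟩
  · simp only [next, rename, Finset.mem_filter, Finset.mem_univ, true_and]
    constructor
    · rintro ⟨x | ⟨x, b⟩, hx, hq⟩
      · obtain rfl := (hinl _ _).1 hx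
        obtain ⟨hne, hns, hq⟩ := (contract_label_inl hT hR).1 hq
        have hvs : v ≠ s := fun h => hns ((hs v).2 h)
        rw [hkeep v hvs hne] at hq
        exact Or.inl ⟨hvs, hq⟩
      · obtain ⟨hxs, hq⟩ := (contract_label_inr hT hR).1 hq
        obtain rfl := (hs x).1 hxs
        cases b
        · exact Or.inr (Or.inr ⟨(hl v).1 hx, hq⟩)
        · exact Or.inr (Or.inl ⟨(hk v).1 hx, hq⟩)
    · rintro (⟨hvs, hq⟩ | ⟨rfl, hq⟩ | ⟨rfl, hq⟩)
      · refine ⟨.inl v, rfl, (contract_label_inl hT hR).2 ⟨⟨q, hq⟩, fun h => hvs ((hs v).1 h), ?_⟩⟩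
        rwa [hkeep v hvs ⟨q, hq⟩]
      · exact ⟨_, hk', (contract_label_inr hT hR).2 ⟨hsp, hq⟩⟩
      · exact ⟨_, hl', (contract_label_inr hT hR).2 ⟨hsp, hq⟩⟩
  · simp only [next, rename, contract_lson hT hR]
    constructor
    · rintro ⟨x, y, hx, hy, ⟨u', v', rfl, rfl, h⟩ | ⟨v', rfl, rfl, h⟩⟩
      · rw [(hinl _ _).1 hx, (hinl _ _).1 hy]
        exact Or.inl h
      · obtain rfl := (hs v').1 h
        exact Or.inr ⟨(hinl _ _).1 hx, (hk v).1 hy⟩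
    · rintro (h | ⟨rfl, rfl⟩)
      · exact ⟨.inl u, .inl v, rfl, rfl, Or.inl ⟨u, v, rfl, rfl, h⟩⟩
      · exact ⟨.inl u, .inr (u, true), rfl, hk', Or.inr ⟨u, rfl, rfl, hsp⟩⟩
  · simp only [next, rename, contract_rson hT hR]
    constructor
    · rintro ⟨x, y, hx, hy, ⟨u', v', rfl, rfl, h⟩ | ⟨v', rfl, rfl, h⟩⟩
      · rw [(hinl _ _).1 hx, (hinl _ _).1 hy]
        exact Or.inl h
      · obtain rfl := (hs v').1 h
        exact Or.inr ⟨(hinl _ _).1 hx, (hl v).1 hy⟩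
    · rintro (h | ⟨rfl, rfl⟩)
      · exact ⟨.inl u, .inl v, rfl, rfl, Or.inl ⟨u, v, rfl, rfl, h⟩⟩
      · exact ⟨.inl u, .inr (u, false), rfl, hl', Or.inr ⟨u, rfl, rfl, hsp⟩⟩
  -- A free name has only one index, but the two sons ask for consecutive ones.
  · rintro rfl
    have h1 := hk'.2.2
    have h2 := hl'.2.2
    simp only [if_true, Bool.false_eq_true, if_false] at h1 h2
    omega

end Next

/-! ### Combs: the split trees reached on permutation words -/

section Comb

variable {n : ℕ} {N : Type} [Fintype N]

open scoped Classical in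
/-- The leaves are, from left to right, `leaf j`, labelled by `{loopState j}`, for the entries `j` of
`l` in this order, and the leaf `s`, labelled by all other states. -/
structure CombInv (l : List (Fin n)) (T : SplitTree N (Fin (n + 2))) (s : N) (leaf : Fin n → N) :
    Prop where
  proper : T.Proper
  special : ∀ q, q ∈ T.label s ↔ ∀ j ∈ l, q ≠ loopState j
  entry : ∀ j ∈ l, T.label (leaf j) = {loopState j}
  cover : ∀ v, (T.label v).Nonempty → v = s ∨ ∃ j ∈ l, v = leaf j
  last : ∀ j ∈ l, T.leftOf (leaf j) s
  sorted : l.Pairwise fun i j => T.leftOf (leaf i) (leaf j)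
  -- A binary tree with `l.length + 1` leaves has `2 * l.length + 1` nodes; the bound guarantees
  -- free names.
  card : (Finset.univ.filter fun v => T.Present v).card ≤ 2 * l.length + 1

namespace CombInv

variable {l : List (Fin n)} {T : SplitTree N (Fin (n + 2))} {s : N} {leaf : Fin n → N}

lemma zero_mem (h : CombInv l T s leaf) : 0 ∈ T.label s :=
  (h.special 0).2 fun _ _ => (Fin.succ_ne_zero _).symm

lemma ne_special (h : CombInv l T s leaf) {j : Fin n} (hj : j ∈ l) : leaf j ≠ s := by
  intro he
  have := h.zero_mem
  rw [← he, h.entry j hj, Finset.mem_singleton] at this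
  exact Fin.succ_ne_zero _ this.symm

lemma eq_leaf (h : CombInv l T s leaf) {u : N} {j : Fin n} (hu : T.label u = {loopState j}) :
    u = leaf j := by
  rcases h.cover u (hu ▸ Finset.singleton_nonempty _) with rfl | ⟨i, hi, rfl⟩
  · have := h.zero_mem
    rw [hu, Finset.mem_singleton] at this
    exact absurd this.symm (Fin.succ_ne_zero _)
  · rw [h.entry i hi] at hu
    rw [Fin.succ_injective _ (Fin.succ_injective _ (Finset.singleton_injective hu))]

lemma card_nonempty_le (h : CombInv l T s leaf) :
    (Finset.univ.filter fun v => (T.label v).Nonempty).card ≤ l.length + 1 := by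
  classical
  calc _ ≤ (insert s (l.toFinset.image leaf)).card := Finset.card_le_card fun v hv => by
        rcases h.cover v (Finset.mem_filter.1 hv).2 with rfl | ⟨j, hj, rfl⟩
        · simp
        · exact Finset.mem_insert_of_mem (Finset.mem_image_of_mem _ (by simpa using hj))
    _ ≤ (l.toFinset.image leaf).card + 1 := Finset.card_insert_le _ _
    _ ≤ l.length + 1 := by
        have := Finset.card_image_le (s := l.toFinset) (f := leaf)
        have := l.toFinset_card_le
        omega

/-- The special leaf is the rightmost one. Its left son therefore comes after all earlier leaves,
and its right son, with the remaining states, is the new rightmost leaf. -/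
lemma split (h : CombInv l T s leaf) {i : Fin n} (hi : i ∉ l) {T' : SplitTree N (Fin (n + 2))}
    {K M : Finset (Fin (n + 2))} {k m : N} (hK : K = {loopState i})
    (hM : ∀ q, q ∈ M ↔ q ∈ T.label s ∧ q ≠ loopState i) (hs : IsSplit T T' s K M k m) :
    CombInv (l ++ [i]) T' m (fun j => if j = i then k else leaf j) := by
  classical
  have hmem : ∀ j ∈ l, j ≠ i := fun j hj he => hi (he ▸ hj)
  have hnew : ∀ v, T.Present v → v ≠ k ∧ v ≠ m := fun v hv =>
    ⟨by rintro rfl; exact hs.left_new hv, by rintro rfl; exact hs.right_new hv⟩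
  have hsnew := hnew s (Or.inl hs.nonempty)
  refine ⟨hs.proper h.proper, fun q => ?_, fun j hj => ?_, fun v hv => ?_, fun j hj => ?_, ?_, ?_⟩
  · rw [hs.label]
    have h1 : ¬ T.Present m := hs.right_new
    have h2 : q ∉ T.label m := fun hq => h1 (Or.inl ⟨q, hq⟩)
    simp only [h2, and_false, hs.ne.symm, false_and, false_or, true_and, hM, h.special,
      List.mem_append, List.mem_singleton]
    grind
  · ext q
    rw [hs.label]
    by_cases hji : j = i
    · have h1 : q ∉ T.label k := fun hq => hs.left_new (Or.inl ⟨q, hq⟩)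
      simp [hji, h1, hs.ne, hK]
    · have hj : j ∈ l := by simpa [hji] using hj
      have h1 := hnew (leaf j) (Or.inl (h.entry j hj ▸ Finset.singleton_nonempty _))
      simp [hji, h.ne_special hj, h1, h.entry j hj]
  · rcases hs.nonempty_cases hv with ⟨h1, -, -, h2⟩ | rfl | rfl
    · obtain ⟨j, hj, rfl⟩ := (h.cover v h2).resolve_left h1
      exact Or.inr ⟨j, by simp [hj], by simp [hmem j hj]⟩
    · exact Or.inr ⟨i, by simp, by simp⟩
    · exact Or.inl rfl
  · by_cases hji : j = i
    · simpa [hji] using hs.leftOf_sons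
    · simp only [if_neg hji]
      exact hs.leftOf_new (Or.inr rfl) (h.last j (by simpa [hji] using hj))
  · rw [List.pairwise_append]
    refine ⟨h.sorted.imp_of_mem fun {a b} ha hb hab => ?_, List.pairwise_singleton _ _,
      fun a ha b hb => ?_⟩
    · simp only [if_neg (hmem a ha), if_neg (hmem b hb)]
      exact hs.leftOf_mono hab
    · simp only [List.mem_singleton.1 hb, if_neg (hmem a ha), if_true]
      exact hs.leftOf_new (Or.inl rfl) (h.last a ha)
  · calc _ ≤ (insert k (insert m (Finset.univ.filter fun v => T.Present v))).card := by
          refine Finset.card_le_card fun v hv => ?_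
          simp only [Finset.mem_insert, Finset.mem_filter, Finset.mem_univ, true_and]
          rcases (Finset.mem_filter.1 hv).2 with hv | ⟨w, hv⟩
          · rcases hs.nonempty_cases hv with h1 | h1 | h1
            · exact Or.inr (Or.inr (Or.inl h1.2.2.2))
            · exact Or.inl h1
            · exact Or.inr (Or.inl h1)
          · rcases (hs.son v w).1 hv with h1 | ⟨rfl, -⟩
            · exact Or.inr (Or.inr (Or.inr ⟨w, h1⟩))
            · exact Or.inr (Or.inr (Or.inl hs.nonempty))
      _ ≤ (Finset.univ.filter fun v => T.Present v).card + 1 + 1 :=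
          (Finset.card_insert_le _ _).trans (Nat.succ_le_succ (Finset.card_insert_le _ _))
      _ ≤ 2 * (l ++ [i]).length + 1 := by
          have := h.card
          simp only [List.length_append, List.length_singleton]
          omega

end CombInv

/-- Reading `i + 1` splits `loopState i` off the special leaf. -/
lemma CombInv.next {m : ℕ} {l : List (Fin n)} {T : SplitTree (Fin m) (Fin (n + 2))} {s : Fin m}
    {leaf : Fin n → Fin m} (h : CombInv l T s leaf) {i : Fin n} (hi : i ∉ l)
    (hm : 4 * l.length + 3 ≤ m) :
    ∃ s' leaf', CombInv (l ++ [i]) (T.next (permNBA n) i.succ) s' leaf' := by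
  have hli : ∀ j ∈ l, loopState j ≠ loopState i := fun j hj he =>
    hi ((Fin.succ_injective _ (Fin.succ_injective _ he)) ▸ hj)
  have his : loopState i ∈ T.label s := (h.special _).2 fun j hj => (hli j hj).symm
  have hright : ∀ v, (T.label v).Nonempty →
      (T.expand (permNBA n) i.succ).label (.inr (v, false)) = T.label v := by
    intro v hv
    refine permNBA_post_succ fun h0 => ?_
    rcases h.cover v hv with rfl | ⟨j, hj, rfl⟩
    · exact his
    · rw [h.entry j hj, Finset.mem_singleton] at h0
      exact absurd h0.symm (Fin.succ_ne_zero _)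
  have hleft : (T.expand (permNBA n) i.succ).label (.inr (s, true)) = {loopState i} :=
    permNBA_accPost_of_mem his
  have hleft' : ∀ v, v ≠ s → (T.expand (permNBA n) i.succ).label (.inr (v, true)) = ∅ := by
    intro v hv
    refine permNBA_accPost_of_notMem fun hm => ?_
    obtain ⟨j, hj, rfl⟩ := (h.cover v ⟨_, hm⟩).resolve_left hv
    rw [h.entry j hj, Finset.mem_singleton] at hm
    exact hli j hj hm.symm
  -- Below one old leaf, the only instance of `leftOf` is the left son before the right son.
  have hirr : ∀ v, (T.label v).Nonempty → ∀ b c, (b = true → c ≠ false) →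
      ¬ (T.expand (permNBA n) i.succ).leftOf (.inr (v, b)) (.inr (v, c)) := by
    intro v hv b c hbc hl
    rcases leftOf_expand_cases h.proper hl with h1 | ⟨-, h1, h2⟩
    · exact h.proper.asymm v v hv hv h1 h1
    · exact hbc h1 h2
  have hwhere : ∀ y q, q ∈ (T.expand (permNBA n) i.succ).label y →
      ∃ w b, y = .inr (w, b) ∧ (T.label w).Nonempty ∧ q ∈ T.label w ∧
        (b = true → w = s ∧ q = loopState i) := by
    rintro (y | ⟨w, b⟩) q hq
    · exact absurd hq (Finset.notMem_empty _)
    · have hw := nonempty_of_expand ⟨q, hq⟩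
      refine ⟨w, b, rfl, hw, ?_⟩
      cases b
      · rw [hright w hw] at hq
        exact ⟨hq, by simp⟩
      · have hws : w = s := by
          by_contra hc
          rw [hleft' w hc] at hq
          exact Finset.notMem_empty _ hq
        subst hws
        rw [hleft, Finset.mem_singleton] at hq
        exact ⟨hq ▸ his, fun _ => ⟨rfl, hq⟩⟩
  have hdisj : ∀ v w q, q ∈ T.label v → q ∈ T.label w → v = w := by
    intro v w q hv hw
    rcases h.cover v ⟨q, hv⟩ with rfl | ⟨j, hj, rfl⟩ <;>
      rcases h.cover w ⟨q, hw⟩ with rfl | ⟨j', hj', rfl⟩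
    · rfl
    · rw [h.entry j' hj', Finset.mem_singleton] at hw
      exact absurd hw ((h.special q).1 hv j' hj')
    · rw [h.entry j hj, Finset.mem_singleton] at hv
      exact absurd hv ((h.special q).1 hw j hj)
    · rw [h.entry j hj, Finset.mem_singleton] at hv
      rw [h.entry j' hj', Finset.mem_singleton] at hw
      rw [Fin.succ_injective _ (Fin.succ_injective _ (hv.symm.trans hw))]
  -- The old leaves are disjoint, so a state can leave a right son only in favor of the left son of
  -- the same leaf. The only such state is `loopState i`.
  have hU : ∀ v q, q ∈ (T.expand (permNBA n) i.succ).reduce.label (.inr (v, false)) ↔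
      q ∈ T.label v ∧ q ≠ loopState i := by
    intro v q
    rw [mem_reduce]
    constructor
    · rintro ⟨hq, hn⟩
      have hv := nonempty_of_expand ⟨q, hq⟩
      rw [hright v hv] at hq
      refine ⟨hq, ?_⟩
      rintro rfl
      obtain rfl := hdisj v s _ hq his
      exact hn _ (leftOf_expand_sons hv) (by simp [hleft])
    · rintro ⟨hq, hne⟩
      rw [hright v ⟨q, hq⟩]
      refine ⟨hq, fun y hy hqy => ?_⟩
      obtain ⟨w, b, rfl, hw, hqw, hb⟩ := hwhere y q hqy
      obtain rfl := hdisj w v q hqw hq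
      exact hirr w hw b false (fun hb' => absurd (hb hb').2 hne) hy
  have hUl : (T.expand (permNBA n) i.succ).reduce.label (.inr (s, true)) = {loopState i} := by
    refine Finset.Subset.antisymm (hleft ▸ reduce_subset _) fun q hq => ?_
    obtain rfl := Finset.mem_singleton.1 hq
    refine mem_reduce.2 ⟨by simp [hleft], fun y hy hqy => ?_⟩
    obtain ⟨w, b, rfl, hw, hqw, -⟩ := hwhere y _ hqy
    obtain rfl := hdisj w s _ hqw his
    exact hirr w hw b true (by simp) hy
  have hkeep : ∀ v, v ≠ s → (T.label v).Nonempty →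
      (T.expand (permNBA n) i.succ).reduce.label (.inr (v, false)) = T.label v := by
    intro v hv _
    ext q
    rw [hU, and_iff_left_iff_imp]
    rintro hq rfl
    exact hv (hdisj v s _ hq his)
  have hR : ∀ v, (T.label v).Nonempty →
      ((T.expand (permNBA n) i.succ).reduce.label (.inr (v, false))).Nonempty := by
    intro v hv
    by_cases hvs : v = s
    · subst hvs
      -- The state `0` is never split off, which keeps the right son of the special leaf nonempty.
      exact ⟨0, (hU v 0).2 ⟨h.zero_mem, (Fin.succ_ne_zero _).symm⟩⟩
    · rwa [hkeep v hvs hv]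
  have hsp : ∀ v, T.Splits (permNBA n) i.succ v ↔ v = s := by
    intro v
    constructor
    · intro hv
      by_contra hc
      have := hv.mono (reduce_subset _)
      rw [hleft' v hc] at this
      exact Finset.not_nonempty_empty this
    · rintro rfl
      rw [Splits, hUl]
      exact Finset.singleton_nonempty _
  -- There are at most `l.length + 1` leaves and `2 * l.length + 1` used names; twice the former
  -- plus the latter is the bound `4 * l.length + 3`.
  obtain ⟨k, k', hk⟩ := exists_isSplit_next h.proper hR hsp hkeep (by
    have := h.card
    have := h.card_nonempty_le
    omega)
  exact ⟨_, _, h.split hi hUl (hU s) hk⟩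

/-- The tree says that `i` has been split off before `j`. -/
def Before (T : SplitTree N (Fin (n + 2))) (i j : Fin n) : Prop :=
  ∃ u v, T.label u = {loopState i} ∧ T.label v = {loopState j} ∧ T.leftOf u v

lemma CombInv.pairwise {l : List (Fin n)} {T : SplitTree N (Fin (n + 2))} {s : N}
    {leaf : Fin n → N} (h : CombInv l T s leaf) : l.Pairwise T.Before :=
  h.sorted.imp_of_mem fun {_ _} hi hj hij => ⟨_, _, h.entry _ hi, h.entry _ hj, hij⟩

lemma CombInv.before_asymm {l : List (Fin n)} {T : SplitTree N (Fin (n + 2))} {s : N}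
    {leaf : Fin n → N} (h : CombInv l T s leaf) (i j : Fin n) (hij : T.Before i j) :
    ¬ T.Before j i := by
  obtain ⟨u, v, hu, hv, huv⟩ := hij
  rintro ⟨v', u', hv', hu', hvu⟩
  rw [h.eq_leaf hu', ← h.eq_leaf hu, h.eq_leaf hv', ← h.eq_leaf hv] at hvu
  exact h.proper.asymm u v (hu ▸ Finset.singleton_nonempty _) (hv ▸ Finset.singleton_nonempty _)
    huv hvu

end Comb

end SplitTree

open SplitTree

section KahlerWilke

variable {n : ℕ}

/-- On the first letter of a permutation word, all states are reached. -/
lemma combInv_kahlerWilke_init : ∃ s leaf, CombInv []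
    ((kahlerWilke (permNBA n)).toDRA.step (kahlerWilke (permNBA n)).toDRA.init 0) s leaf := by
  set T : SplitTree (Fin (4 * Fintype.card (Fin (n + 2)))) (Fin (n + 2)) :=
    (kahlerWilke (permNBA n)).init with hTdef
  have hs : ∀ u v, ¬ T.son u v := by
    rintro u v (h | h) <;> exact h
  have hlab : ∀ u, T.label u = if u.val = 0 then {0} else ∅ := fun u => rfl
  have hne : ∀ u, (T.label u).Nonempty ↔ u.val = 0 := by
    intro u
    rw [hlab]
    split_ifs with hu <;> simp [hu]
  have hleft : ∀ x y, ¬ T.leftOf x y := by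
    rintro x y ⟨u, l, r, hl, -⟩
    exact hl
  have hT : T.Proper := ⟨fun u v _ => hs u v, fun u v h => absurd h (hs u v),
    fun u v h => absurd h (hs u v), fun x y _ _ h => absurd h (hleft x y)⟩
  have hacc : ∀ v, (T.expand (permNBA n) 0).label (.inr (v, true)) = ∅ := fun v =>
    permNBA_accPost_zero _
  have hU : ∀ v, v.val = 0 →
      (T.expand (permNBA n) 0).reduce.label (.inr (v, false)) = Finset.univ := by
    intro v hv
    refine Finset.eq_univ_of_forall fun q => mem_reduce.2 ⟨?_, fun y hy hq => ?_⟩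
    · have : (T.expand (permNBA n) 0).label (.inr (v, false)) = Finset.univ :=
        permNBA_post_zero (by simp [hlab, hv])
      rw [this]
      exact Finset.mem_univ _
    · rcases y with y | ⟨w, b⟩
      · exact absurd hq (Finset.notMem_empty _)
      · rcases leftOf_expand_cases hT hy with h1 | ⟨-, rfl, -⟩
        · exact hleft _ _ h1
        · rw [hacc] at hq
          exact Finset.notMem_empty _ hq
  have hR : ∀ v, (T.label v).Nonempty →
      ((T.expand (permNBA n) 0).reduce.label (.inr (v, false))).Nonempty := by
    intro v hv
    rw [hU v ((hne v).1 hv)]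
    exact Finset.univ_nonempty
  -- Without accepting transitions on the letter `0` the root is not split: it absorbs its right son
  -- and remains the only node.
  have hsp : ∀ v, ¬ T.Splits (permNBA n) 0 v := by
    intro v hv
    have := hv.mono (reduce_subset _)
    rw [hacc] at this
    exact Finset.not_nonempty_empty this
  have hlab' : ∀ k q, q ∈ (T.next (permNBA n) 0).label k ↔ k.val = 0 := by
    intro k q
    simp only [SplitTree.next, SplitTree.rename, Finset.mem_filter, Finset.mem_univ, true_and]
    constructor
    · rintro ⟨x | ⟨x, b⟩, hx, hq⟩
      · obtain ⟨h1, -, -⟩ := (contract_label_inl hT hR).1 hq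
        obtain rfl : k = x := hx
        exact (hne k).1 h1
      · exact absurd ((contract_label_inr hT hR).1 hq).1 (hsp x)
    · intro hk
      refine ⟨.inl k, rfl, (contract_label_inl hT hR).2 ⟨(hne k).2 hk, hsp k, ?_⟩⟩
      rw [hU k hk]
      exact Finset.mem_univ _
  have hl' : ∀ u v, ¬ (T.next (permNBA n) 0).lson u v := by
    rintro u v ⟨x, y, -, -, h⟩
    rcases (contract_lson hT hR).1 h with ⟨u', v', -, -, h⟩ | ⟨v', -, -, h⟩
    · exact h
    · exact hsp v' h
  have hr' : ∀ u v, ¬ (T.next (permNBA n) 0).rson u v := by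
    rintro u v ⟨x, y, -, -, h⟩
    rcases (contract_rson hT hR).1 h with ⟨u', v', -, -, h⟩ | ⟨v', -, -, h⟩
    · exact h
    · exact hsp v' h
  have hs' : ∀ u v, ¬ (T.next (permNBA n) 0).son u v := fun u v h => h.elim (hl' u v) (hr' u v)
  have hz : 0 < 4 * Fintype.card (Fin (n + 2)) := by simp
  refine ⟨⟨0, hz⟩, fun _ => ⟨0, hz⟩, ?_⟩
  change CombInv [] (T.next (permNBA n) 0) _ _
  refine ⟨⟨fun u v _ => hs' u v, fun u v h => absurd h (hs' u v),
    fun u v h => absurd h (hs' u v), ?_⟩, fun q => ?_, by simp, fun v hv => ?_, by simp,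
    List.Pairwise.nil, ?_⟩
  · rintro x y - - ⟨u, l, r, h, -⟩
    exact absurd h (hl' u l)
  · simp [hlab']
  · obtain ⟨q, hq⟩ := hv
    exact Or.inl (Fin.ext ((hlab' v q).1 hq))
  · classical
    refine Finset.card_le_one.2 fun u hu v hv => ?_
    have key : ∀ v, (T.next (permNBA n) 0).Present v → v.val = 0 := by
      rintro v (⟨q, hq⟩ | ⟨w, h⟩)
      · exact (hlab' v q).1 hq
      · exact absurd h (hs' v w)
    exact Fin.ext ((key u (Finset.mem_filter.1 hu).2).trans
      (key v (Finset.mem_filter.1 hv).2).symm)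

lemma kahlerWilke_toDRA_factorial_le (n : ℕ) :
    n.factorial ≤ (kahlerWilke (permNBA n)).toDRA.reachable.ncard := by
  refine factorial_le_ncard_reachable _ Fin.succ _ (DELA.step_init_mem_reachable _ 0)
    (fun l T => ∃ s leaf, CombInv l T s leaf) (fun T => SplitTree.Before T)
    combInv_kahlerWilke_init ?_ ?_ ?_
  · rintro l i T hl hi ⟨s, leaf, h⟩
    refine h.next hi ?_
    have := hl.length_le_card
    rw [Fintype.card_fin] at this
    have := Fintype.card_fin (n + 2)
    omega
  · rintro l T - ⟨s, leaf, h⟩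
    exact h.pairwise
  · rintro l T - ⟨s, leaf, h⟩
    exact h.before_asymm

end KahlerWilke

/-! ## The construction of Löding and Pirogov -/

namespace Slice

/-- The nonempty sets are strictly ordered from left to right. -/
structure Ordered {N Q : Type} (T : Slice N Q) : Prop where
  asymm : ∀ r s, T.before r s → ¬ T.before s r
  total : ∀ r s, (T.set r).Nonempty → (T.set s).Nonempty → r ≠ s → T.before r s ∨ T.before s r
  nonempty : ∀ r s, T.before r s → (T.set r).Nonempty ∧ (T.set s).Nonempty

/-! ### The split slice and its left-to-right order -/

section Split

variable {α Q N : Type} [LinearOrder Q] {A : NBA α Q} {a : α} {T : Slice N Q}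

lemma mem_split_inl {r : N} {q : Q} : q ∈ (T.split A a).set (.inl r) ↔ q ∈ A.post (T.set r) a ∧
    q ∉ A.accPost (T.set r) a ∧ ∀ s, T.before s r → q ∉ A.post (T.set s) a := by
  classical
  exact Finset.mem_filter

lemma mem_split_inr {r : N} {q : Q} : q ∈ (T.split A a).set (.inr r) ↔ q ∈ A.accPost (T.set r) a ∧
    ∀ s, T.before s r → q ∉ A.post (T.set s) a := by
  classical
  exact Finset.mem_filter

lemma nonempty_of_split {r : N} {x : N ⊕ N} (hx : x = .inl r ∨ x = .inr r)
    (h : ((T.split A a).set x).Nonempty) : (T.set r).Nonempty := by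
  obtain ⟨q, hq⟩ := h
  rcases hx with rfl | rfl
  · obtain ⟨p, hp, -⟩ := Finset.mem_biUnion.1 (mem_split_inl.1 hq).1
    exact ⟨p, hp⟩
  · obtain ⟨p, hp, -⟩ := Finset.mem_biUnion.1 (mem_split_inr.1 hq).1
    exact ⟨p, hp⟩

lemma Ordered.split_asymm (hT : T.Ordered) {x y : N ⊕ N} (h : (T.split A a).before x y) :
    ¬ (T.split A a).before y x := by
  intro h'
  rcases x with r | r <;> rcases y with s | s
  · exact hT.asymm r s h h'
  · rcases h' with rfl | h'
    · exact hT.asymm _ _ h h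
    · exact hT.asymm r s h h'
  · rcases h with rfl | h
    · exact hT.asymm _ _ h' h'
    · exact hT.asymm r s h h'
  · exact hT.asymm r s h h'

end Split

/-! ### Steps in which no set gets empty -/

section Quiet

variable {α Q : Type} [LinearOrder Q] {A : NBA α Q} {a : α} {m : ℕ}
  {T : Slice (Fin m) Q}

/-- The relation `before` involves only used ranks, so an unused rank has nothing nonempty in its
subtree. For a used rank the right part itself is nonempty by `hR`. -/
lemma alive_inl_iff (hT : T.Ordered)
    (hR : ∀ r, (T.set r).Nonempty → ((T.split A a).set (.inl r)).Nonempty) {r : Fin m} :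
    T.Alive A a (.inl r) ↔ (T.set r).Nonempty := by
  constructor
  · rintro ⟨y, rfl | ⟨hb, -⟩, hy⟩
    · exact nonempty_of_split (Or.inl rfl) hy
    · rcases y with s | s
      · exact (hT.nonempty s r hb).2
      · rcases hb with rfl | hb
        · exact nonempty_of_split (Or.inr rfl) hy
        · exact (hT.nonempty s r hb).2
  · exact fun h => ⟨_, Or.inl rfl, hR r h⟩

/-- Left parts rank behind all right parts and increase from left to right, so nothing to the left
of a left part has larger rank. Its subtree is the part alone. -/
lemma alive_inr_iff (hT : T.Ordered) {r : Fin m} :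
    T.Alive A a (.inr r) ↔ ((T.split A a).set (.inr r)).Nonempty := by
  constructor
  · rintro ⟨y, rfl | ⟨hb, hz⟩, hy⟩
    · exact hy
    · have := hz y (Or.inl rfl) hb
      rcases y with s | s
      · exact this.elim
      · exact absurd this (hT.asymm s r hb)
  · exact fun h => ⟨_, Or.inl rfl, h⟩

lemma not_bad_of_forall_nonempty (hT : T.Ordered)
    (hR : ∀ r, (T.set r).Nonempty → ((T.split A a).set (.inl r)).Nonempty) (r : Fin m) :
    ¬ T.Bad A a r := fun h => h.2 ((alive_inl_iff hT hR).2 h.1)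

lemma not_good_of_forall_nonempty
    (hR : ∀ r, (T.set r).Nonempty → ((T.split A a).set (.inl r)).Nonempty) (r : Fin m) :
    ¬ T.Good A a r := fun h => (hR r h.1).ne_empty h.2.1

lemma split_total (hT : T.Ordered)
    (hR : ∀ r, (T.set r).Nonempty → ((T.split A a).set (.inl r)).Nonempty) {x y : Fin m ⊕ Fin m}
    (hx : T.Alive A a x) (hy : T.Alive A a y) (hne : x ≠ y) :
    (T.split A a).before x y ∨ (T.split A a).before y x := by
  have key : ∀ r, T.Alive A a (.inl r) ∨ T.Alive A a (.inr r) → (T.set r).Nonempty := by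
    rintro r (h | h)
    · exact (alive_inl_iff hT hR).1 h
    · exact nonempty_of_split (Or.inr rfl) ((alive_inr_iff hT).1 h)
  rcases x with r | r <;> rcases y with s | s
  · exact hT.total r s (key r (Or.inl hx)) (key s (Or.inl hy)) (by rintro rfl; exact hne rfl)
  · by_cases hrs : r = s
    · exact Or.inr (Or.inl hrs.symm)
    · exact (hT.total r s (key r (Or.inl hx)) (key s (Or.inr hy)) hrs).imp id Or.inr
  · by_cases hrs : r = s
    · exact Or.inl (Or.inl hrs)
    · exact (hT.total r s (key r (Or.inr hx)) (key s (Or.inl hy)) hrs).imp Or.inr id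
  · exact hT.total r s (key r (Or.inr hx)) (key s (Or.inr hy)) (by rintro rfl; exact hne rfl)

/-- Without bad and good ranks there is nothing to merge, whatever the strategy proposes. -/
lemma merging_iff_eq (hT : T.Ordered)
    (hR : ∀ r, (T.set r).Nonempty → ((T.split A a).set (.inl r)).Nonempty)
    (μ : Fin m ⊕ Fin m → Fin m ⊕ Fin m → Prop) {x y : Fin m ⊕ Fin m}
    (hx : T.Alive A a x) (hy : T.Alive A a y) : T.merging A a μ x y ↔ x = y := by
  have hno : ∀ r, ¬ (T.Bad A a r ∨ T.Good A a r) := fun r h =>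
    h.elim (not_bad_of_forall_nonempty hT hR r) (not_good_of_forall_nonempty hR r)
  constructor
  · rintro (⟨ha, hm⟩ | ⟨-, h | ⟨r, h, -⟩⟩)
    · by_contra hne
      rcases split_total hT hR hx hy hne with h | h
      · obtain ⟨r, hr, -⟩ := ha.rank x y hx hy hm h
        exact hno r hr
      · obtain ⟨r, hr, -⟩ := ha.rank y x hy hx (ha.symm x y hx hy hm) h
        exact hno r hr
    · exact h
    · exact absurd (Or.inr h) (hno r)
  · rintro rfl
    by_cases ha : T.Admissible A a μ
    · exact Or.inl ⟨ha, ha.refl x hx⟩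
    · exact Or.inr ⟨ha, Or.inl rfl⟩

/-- All classes of alive sets are singletons, so ranking the classes by their least members just
counts the alive sets of smaller rank. -/
lemma newRank_iff (hT : T.Ordered)
    (hR : ∀ r, (T.set r).Nonempty → ((T.split A a).set (.inl r)).Nonempty)
    (μ : Fin m ⊕ Fin m → Fin m ⊕ Fin m → Prop) {z : Fin m ⊕ Fin m} {k : Fin m} :
    T.NewRank A a μ z k ↔
      T.Alive A a z ∧ {y | T.Alive A a y ∧ T.rankLT y z}.ncard = k.val := by
  have hmin : ∀ x, T.ClassMin A a μ x ↔ T.Alive A a x := fun x =>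
    ⟨fun h => h.1, fun h => ⟨h, fun y hy hxy =>
      Or.inl ((merging_iff_eq hT hR μ h hy).1 hxy).symm⟩⟩
  simp only [NewRank, hmin]
  refine and_congr_right fun hz => ⟨?_, fun h => ⟨z, hz, (merging_iff_eq hT hR μ hz hz).2 rfl, h⟩⟩
  rintro ⟨x, hx, hxz, hc⟩
  rwa [(merging_iff_eq hT hR μ hx hz).1 hxz] at hc

/-! ### New ranks when the used ranks form an initial segment -/

section Ranks

variable (hT : T.Ordered)
  (hR : ∀ r, (T.set r).Nonempty → ((T.split A a).set (.inl r)).Nonempty) {p : ℕ}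
  (hp : ∀ r, (T.set r).Nonempty ↔ r.val < p)
  (μ : Fin m ⊕ Fin m → Fin m ⊕ Fin m → Prop)

include hT hR hp

/-- All used ranks survive, they are the numbers below `p`, and left parts rank behind them. So
exactly `r` alive sets rank before the right part of `r`. -/
lemma newRank_inl_iff {r k : Fin m} :
    T.NewRank A a μ (.inl r) k ↔ r.val < p ∧ k = r := by
  rw [newRank_iff hT hR, alive_inl_iff hT hR, hp]
  refine and_congr_right fun hr => ?_
  have : {y | T.Alive A a y ∧ T.rankLT y (.inl r)} = Sum.inl '' (Set.Iio r) := by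
    ext y
    simp only [Set.mem_ofPred_eq, Set.mem_image, Set.mem_Iio]
    rcases y with s | s
    · rw [alive_inl_iff hT hR, hp]
      constructor
      · exact fun h => ⟨s, h.2, rfl⟩
      · rintro ⟨s', h, he⟩
        obtain rfl := Sum.inl.inj he
        exact ⟨lt_trans h hr, h⟩
    · exact iff_of_false (fun h => h.2) (by simp)
  rw [this, Set.ncard_image_of_injective _ Sum.inl_injective, ← Finset.coe_Iio,
    Set.ncard_coe_finset, Fin.card_Iio, Fin.ext_iff, eq_comm]

/-- The `p` right parts rank before any left part, and there is no second nonempty left part; the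
count is therefore `p`, the first unused rank. -/
lemma newRank_inr_iff {c : Fin m} (hc : ∀ r, ((T.split A a).set (.inr r)).Nonempty → r = c)
    (hpm : p ≤ m) {r k : Fin m} :
    T.NewRank A a μ (.inr r) k ↔
      r = c ∧ ((T.split A a).set (.inr c)).Nonempty ∧ k.val = p := by
  rw [newRank_iff hT hR, alive_inr_iff hT]
  have hcard : ∀ r, ((T.split A a).set (.inr r)).Nonempty →
      {y | T.Alive A a y ∧ T.rankLT y (.inr r)}.ncard = p := by
    intro r hr
    have : {y | T.Alive A a y ∧ T.rankLT y (.inr r)} =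
        Sum.inl '' (↑(Finset.univ.filter fun s : Fin m => s.val < p) : Set (Fin m)) := by
      ext y
      simp only [Set.mem_ofPred_eq, Set.mem_image, Finset.coe_filter, Finset.mem_univ, true_and]
      rcases y with s | s
      · rw [alive_inl_iff hT hR, hp]
        constructor
        · exact fun h => ⟨s, h.1, rfl⟩
        · rintro ⟨s', h, he⟩
          obtain rfl := Sum.inl.inj he
          exact ⟨h, trivial⟩
      · refine iff_of_false (fun h => ?_) (by simp)
        obtain rfl := (hc s ((alive_inr_iff hT).1 h.1)).trans (hc r hr).symm
        exact hT.asymm s s h.2 h.2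
    rw [this, Set.ncard_image_of_injective _ Sum.inl_injective, Set.ncard_coe_finset,
      Fin.card_filter_val_lt]
    omega
  constructor
  · rintro ⟨hr, hk⟩
    obtain rfl := hc r hr
    exact ⟨rfl, hr, hk.symm.trans (hcard r hr)⟩
  · rintro ⟨rfl, hr, hk⟩
    exact ⟨hr, (hcard r hr).trans hk.symm⟩

variable [Fintype Q]

/-- If no set gets empty, then the ranks are kept, and the only set that is split off gets the next
rank. -/
lemma mem_next_set {c : Fin m} (hc : ∀ r, ((T.split A a).set (.inr r)).Nonempty → r = c)
    (hpm : p ≤ m) {k : Fin m} {q : Q} :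
    q ∈ (T.next A a μ).set k ↔
      q ∈ (T.split A a).set (.inl k) ∨ k.val = p ∧ q ∈ (T.split A a).set (.inr c) := by
  classical
  rw [next]
  simp only [Finset.mem_filter, Finset.mem_univ, true_and]
  constructor
  · rintro ⟨z | z, hz, hq⟩
    · obtain rfl := ((newRank_inl_iff hT hR hp μ).1 hz).2
      exact Or.inl hq
    · obtain ⟨rfl, -, hk⟩ := (newRank_inr_iff hT hR hp μ hc hpm).1 hz
      exact Or.inr ⟨hk, hq⟩
  · rintro (hq | ⟨hk, hq⟩)
    · exact ⟨.inl k, (newRank_inl_iff hT hR hp μ).2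
        ⟨(hp k).1 (nonempty_of_split (Or.inl rfl) ⟨q, hq⟩), rfl⟩, hq⟩
    · exact ⟨.inr c, (newRank_inr_iff hT hR hp μ hc hpm).2 ⟨rfl, ⟨q, hq⟩, hk⟩, hq⟩

/-- Every new rank belongs to exactly one alive part, so the new order is the order of the split
slice, transported along a bijection. -/
lemma ordered_next {c : Fin m} (hc : ∀ r, ((T.split A a).set (.inr r)).Nonempty → r = c)
    (hpm : p ≤ m) : (T.next A a μ).Ordered := by
  have huniq : ∀ z z' k, T.NewRank A a μ z k → T.NewRank A a μ z' k → z = z' := by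
    rintro (z | z) (z' | z') k h h'
    · rw [← ((newRank_inl_iff hT hR hp μ).1 h).2, ← ((newRank_inl_iff hT hR hp μ).1 h').2]
    · obtain ⟨h1, rfl⟩ := (newRank_inl_iff hT hR hp μ).1 h
      exact absurd ((newRank_inr_iff hT hR hp μ hc hpm).1 h').2.2 h1.ne
    · obtain ⟨h1, rfl⟩ := (newRank_inl_iff hT hR hp μ).1 h'
      exact absurd ((newRank_inr_iff hT hR hp μ hc hpm).1 h).2.2 h1.ne
    · rw [((newRank_inr_iff hT hR hp μ hc hpm).1 h).1,
        ((newRank_inr_iff hT hR hp μ hc hpm).1 h').1]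
  have hne : ∀ z k, T.NewRank A a μ z k → ((T.next A a μ).set k).Nonempty := by
    rintro (z | z) k h
    · obtain ⟨h1, rfl⟩ := (newRank_inl_iff hT hR hp μ).1 h
      obtain ⟨q, hq⟩ := hR k ((hp k).2 h1)
      exact ⟨q, (mem_next_set hT hR hp μ hc hpm).2 (Or.inl hq)⟩
    · obtain ⟨rfl, ⟨q, hq⟩, hk⟩ := (newRank_inr_iff hT hR hp μ hc hpm).1 h
      exact ⟨q, (mem_next_set hT hR hp μ hc hpm).2 (Or.inr ⟨hk, hq⟩)⟩
  have hex : ∀ k, ((T.next A a μ).set k).Nonempty → ∃ z, T.NewRank A a μ z k := by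
    classical
    rintro k ⟨q, hq⟩
    obtain ⟨z, hz, -⟩ := (Finset.mem_filter.1 hq).2
    exact ⟨z, hz⟩
  refine ⟨?_, fun k l hk hl hkl => ?_, ?_⟩
  · rintro k l ⟨-, z, w, hz, hw, h⟩ ⟨-, w', z', hw', hz', h'⟩
    rw [huniq _ _ _ hw' hw, huniq _ _ _ hz' hz] at h'
    exact hT.split_asymm h h'
  · obtain ⟨z, hz⟩ := hex k hk
    obtain ⟨w, hw⟩ := hex l hl
    have hzw : z ≠ w := by
      rintro rfl
      exact hkl (Fin.ext (((newRank_iff hT hR μ).1 hz).2.symm.trans ((newRank_iff hT hR μ).1 hw).2))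
    rcases split_total hT hR ((newRank_iff hT hR μ).1 hz).1 ((newRank_iff hT hR μ).1 hw).1 hzw
      with h | h
    · exact Or.inl ⟨hkl, z, w, hz, hw, h⟩
    · exact Or.inr ⟨hkl.symm, w, z, hw, hz, h⟩
  · rintro k l ⟨-, z, w, hz, hw, -⟩
    exact ⟨hne z k hz, hne w l hw⟩

end Ranks

end Quiet

/-! ### Ranked slices reached on permutation words -/

section Family

variable {n m : ℕ}

/-- The set with rank `t + 1` consists of the state of the `t`-th entry of `l`, and the set with the
least rank consists of all other states. -/
structure SliceInv (l : List (Fin n)) (T : Slice (Fin m) (Fin (n + 2))) : Prop where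
  ordered : T.Ordered
  mem_set : ∀ k q, q ∈ T.set k ↔ (k.val = 0 ∧ ∀ j ∈ l, q ≠ loopState j) ∨
    ∃ t, ∃ h : t < l.length, k.val = t + 1 ∧ q = loopState l[t]

namespace SliceInv

variable {l : List (Fin n)} {T : Slice (Fin m) (Fin (n + 2))}

lemma zero_mem_iff (h : SliceInv l T) (k : Fin m) : 0 ∈ T.set k ↔ k.val = 0 := by
  rw [h.mem_set]
  constructor
  · rintro (h | ⟨t, ht, -, h0⟩)
    · exact h.1
    · exact absurd h0.symm (Fin.succ_ne_zero _)
  · exact fun hk => Or.inl ⟨hk, fun _ _ => (Fin.succ_ne_zero _).symm⟩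

lemma nonempty_iff (h : SliceInv l T) (k : Fin m) : (T.set k).Nonempty ↔ k.val < l.length + 1 := by
  constructor
  · rintro ⟨q, hq⟩
    rcases (h.mem_set k q).1 hq with h1 | ⟨t, ht, h1, -⟩ <;> omega
  · intro hk
    by_cases h0 : k.val = 0
    · exact ⟨0, (h.zero_mem_iff k).2 h0⟩
    · exact ⟨_, (h.mem_set k _).2 (Or.inr ⟨k.val - 1, by omega, by omega, rfl⟩)⟩

lemma disjoint (h : SliceInv l T) (hl : l.Nodup) {k k' : Fin m} {q : Fin (n + 2)}
    (hk : q ∈ T.set k) (hk' : q ∈ T.set k') : k = k' := by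
  rw [h.mem_set] at hk hk'
  apply Fin.ext
  rcases hk with ⟨h1, h2⟩ | ⟨t, ht, h1, h2⟩ <;> rcases hk' with ⟨h3, h4⟩ | ⟨t', ht', h3, h4⟩
  · omega
  · exact absurd h4 (h2 _ (List.getElem_mem ht'))
  · exact absurd h2 (h4 _ (List.getElem_mem ht))
  · have := (List.Nodup.getElem_inj_iff hl).1
      (Fin.succ_injective _ (Fin.succ_injective _ (h2.symm.trans h4)))
    omega

/-- Only the set of rank `0` contains `loopState i`, and it survives the split because it contains
`0`. No other set changes, so the split-off singleton receives the first unused rank, `l.length +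
1`. -/
lemma next (h : SliceInv l T) (hl : l.Nodup) {i : Fin n} (hi : i ∉ l) (hm : l.length + 1 ≤ m)
    (μ : Fin m ⊕ Fin m → Fin m ⊕ Fin m → Prop) :
    SliceInv (l ++ [i]) (T.next (permNBA n) i.succ μ) := by
  have hli : ∀ j ∈ l, loopState i ≠ loopState j := fun j hj he =>
    hi ((Fin.succ_injective _ (Fin.succ_injective _ he)) ▸ hj)
  have his : ∀ k, loopState i ∈ T.set k ↔ k.val = 0 := by
    intro k
    rw [h.mem_set]
    constructor
    · rintro (h | ⟨t, ht, -, h1⟩)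
      · exact h.1
      · exact absurd h1 (hli _ (List.getElem_mem ht))
    · exact fun hk => Or.inl ⟨hk, hli⟩
  have hpost : ∀ k, (permNBA n).post (T.set k) i.succ = T.set k := fun k =>
    permNBA_post_succ fun h0 => (his k).2 ((h.zero_mem_iff k).1 h0)
  have hother : ∀ k q, q ∈ T.set k → ∀ s, T.before s k → q ∉ (permNBA n).post (T.set s) i.succ := by
    intro k q hq s hs hqs
    rw [hpost] at hqs
    obtain rfl := h.disjoint hl hq hqs
    exact h.ordered.asymm k k hs hs
  have hinl : ∀ k q, q ∈ (T.split (permNBA n) i.succ).set (.inl k) ↔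
      q ∈ T.set k ∧ q ≠ loopState i := by
    intro k q
    rw [mem_split_inl, hpost, mem_permNBA_accPost_succ]
    constructor
    · rintro ⟨hq, h1, -⟩
      exact ⟨hq, by rintro rfl; exact h1 ⟨rfl, hq⟩⟩
    · exact fun hq => ⟨hq.1, fun h1 => hq.2 h1.1, hother k q hq.1⟩
  have hinr : ∀ k q, q ∈ (T.split (permNBA n) i.succ).set (.inr k) ↔
      k.val = 0 ∧ q = loopState i := by
    intro k q
    rw [mem_split_inr, mem_permNBA_accPost_succ, his]
    constructor
    · exact fun h => ⟨h.1.2, h.1.1⟩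
    · rintro ⟨hk, rfl⟩
      exact ⟨⟨rfl, hk⟩, hother k _ ((his k).2 hk)⟩
  have hR : ∀ r, (T.set r).Nonempty →
      ((T.split (permNBA n) i.succ).set (.inl r)).Nonempty := by
    rintro r ⟨q, hq⟩
    by_cases hr : r.val = 0
    · exact ⟨0, (hinl r 0).2 ⟨(h.zero_mem_iff r).2 hr, (Fin.succ_ne_zero _).symm⟩⟩
    · refine ⟨q, (hinl r q).2 ⟨hq, ?_⟩⟩
      rintro rfl
      exact hr ((his r).1 hq)
  have hc : ∀ r, ((T.split (permNBA n) i.succ).set (.inr r)).Nonempty →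
      r = (⟨0, by omega⟩ : Fin m) := by
    rintro r ⟨q, hq⟩
    exact Fin.ext ((hinr r q).1 hq).1
  refine ⟨ordered_next h.ordered hR h.nonempty_iff μ hc hm, fun k q => ?_⟩
  rw [mem_next_set h.ordered hR h.nonempty_iff μ hc hm, hinl, hinr, h.mem_set]
  constructor
  · rintro (⟨⟨hk, hq⟩ | ⟨t, ht, hk, rfl⟩, hqi⟩ | ⟨hk, -, rfl⟩)
    · refine Or.inl ⟨hk, fun j hj => ?_⟩
      rcases List.mem_append.1 hj with hj | hj
      · exact hq j hj
      · rwa [List.mem_singleton.1 hj]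
    · exact Or.inr ⟨t, by rw [List.length_append]; omega, hk, by rw [List.getElem_append_left ht]⟩
    · exact Or.inr ⟨l.length, by simp, hk, by simp⟩
  · rintro (⟨hk, hq⟩ | ⟨t, ht, hk, rfl⟩)
    · exact Or.inl ⟨Or.inl ⟨hk, fun j hj => hq j (by simp [hj])⟩, hq i (by simp)⟩
    · rw [List.length_append, List.length_singleton] at ht
      rcases (Nat.lt_succ_iff_lt_or_eq.1 ht) with ht' | rfl
      · rw [List.getElem_append_left ht']
        exact Or.inl ⟨Or.inr ⟨t, ht', hk, rfl⟩, (hli _ (List.getElem_mem ht')).symm⟩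
      · exact Or.inr ⟨hk, rfl, by simp⟩

/-- The ranks alone reveal the permutation; the left-to-right order of the slice is not consulted.
-/
lemma pairwise (h : SliceInv l T) (hm : l.length + 1 ≤ m) : l.Pairwise fun i j =>
    ∃ k k', k < k' ∧ T.set k = {loopState i} ∧ T.set k' = {loopState j} := by
  rw [List.pairwise_iff_getElem]
  intro u v hu hv huv
  have key : ∀ t (ht : t < l.length), T.set ⟨t + 1, by omega⟩ = {loopState l[t]} := by
    intro t ht
    ext q
    rw [h.mem_set, Finset.mem_singleton]
    constructor
    · rintro (⟨h1, -⟩ | ⟨t', ht', h1, rfl⟩)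
      · simp at h1
      · simp only [Nat.add_right_cancel_iff] at h1
        subst h1
        rfl
    · rintro rfl
      exact Or.inr ⟨t, ht, rfl, rfl⟩
  exact ⟨_, _, by simpa using huv, key u hu, key v hv⟩

end SliceInv

end Family

end Slice

section LodingPirogov

variable {n : ℕ}

open Slice

/-- On the first letter of a permutation word, all states are reached. -/
lemma sliceInv_lodingPirogov_init (σ : MergeStrategy (Fin (n + 1)) (Fin (n + 2))) :
    SliceInv [] ((lodingPirogovDPA (permNBA n) σ).step (lodingPirogovDPA (permNBA n) σ).init 0) := by
  set T : Slice (Fin (Fintype.card (Fin (n + 2)))) (Fin (n + 2)) :=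
    (lodingPirogovDPA (permNBA n) σ).init with hTdef
  have hset : ∀ k, T.set k = if k.val = 0 then {0} else ∅ := fun _ => rfl
  have hbefore : ∀ r s, ¬ T.before r s := fun _ _ h => h
  have hne : ∀ r, (T.set r).Nonempty ↔ r.val < 1 := by
    intro r
    rw [hset]
    split_ifs with hr <;> simp [hr]
  have hT : T.Ordered := ⟨fun r s h => absurd h (hbefore r s), fun r s hr hs hrs =>
    absurd (Fin.ext (by rw [hne] at hr hs; omega)) hrs, fun r s h => absurd h (hbefore r s)⟩
  have hinl : ∀ k q, q ∈ (T.split (permNBA n) 0).set (.inl k) ↔ k.val = 0 := by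
    intro k q
    rw [mem_split_inl, permNBA_accPost_zero, hset]
    constructor
    · rintro ⟨hq, -⟩
      by_contra hk
      rw [if_neg hk] at hq
      simp [NBA.post] at hq
    · intro hk
      refine ⟨?_, Finset.notMem_empty _, fun s h => absurd h (hbefore s k)⟩
      rw [if_pos hk, permNBA_post_zero (by simp)]
      exact Finset.mem_univ _
  have hR : ∀ r, (T.set r).Nonempty → ((T.split (permNBA n) 0).set (.inl r)).Nonempty := by
    intro r hr
    exact ⟨0, (hinl r 0).2 (by rw [hne] at hr; omega)⟩
  have hinr : ∀ k q, q ∉ (T.split (permNBA n) 0).set (.inr k) := by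
    intro k q hq
    rw [mem_split_inr, permNBA_accPost_zero] at hq
    exact Finset.notMem_empty _ hq.1
  have hpm : 1 ≤ Fintype.card (Fin (n + 2)) := by simp
  -- No left part is nonempty on the letter `0`, so any rank could be named here.
  have hc : ∀ r, ((T.split (permNBA n) 0).set (.inr r)).Nonempty →
      r = (⟨0, hpm⟩ : Fin (Fintype.card (Fin (n + 2)))) := by
    rintro r ⟨q, hq⟩
    exact absurd hq (hinr r q)
  refine ⟨ordered_next hT hR hne (σ T 0) hc hpm, fun k q => ?_⟩
  refine (mem_next_set hT hR hne (σ T 0) hc hpm).trans ?_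
  simp [hinl, hinr]

lemma lodingPirogovDPA_factorial_le (σ : MergeStrategy (Fin (n + 1)) (Fin (n + 2))) :
    n.factorial ≤ (lodingPirogovDPA (permNBA n) σ).reachable.ncard := by
  have hlen : ∀ l : List (Fin n), l.Nodup → l.length + 1 ≤ Fintype.card (Fin (n + 2)) := by
    intro l hl
    have := hl.length_le_card
    rw [Fintype.card_fin] at this ⊢
    omega
  refine factorial_le_ncard_reachable _ Fin.succ _ (DELA.step_init_mem_reachable _ 0)
    (fun l T => SliceInv l T) (fun T i j => ∃ k k', k < k' ∧ Slice.set T k = {loopState i} ∧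
      Slice.set T k' = {loopState j}) (sliceInv_lodingPirogov_init σ)
    (fun l i T hl hi h => h.next hl hi (hlen l hl) _)
    (fun l T hl h => h.pairwise (hlen l hl)) ?_
  rintro l T hl h i j ⟨k, k', hlt, hi, hj⟩ ⟨k₁', k₁, hlt', hj', hi'⟩
  obtain rfl := h.disjoint hl (q := loopState i) (k := k) (k' := k₁) (by simp [hi]) (by simp [hi'])
  obtain rfl := h.disjoint hl (q := loopState j) (k := k') (k' := k₁') (by simp [hj])
    (by simp [hj'])
  exact lt_asymm hlt hlt'

lemma lodingPirogovDPA_isDPA {α Q : Type} [Fintype Q] [LinearOrder Q] (A : NBA α Q)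
    (σ : MergeStrategy α Q) : (lodingPirogovDPA A σ).IsDPA :=
  ⟨⟨Fintype.card Q + 1, by change 2 * Fintype.card Q + 2 = _; omega⟩, rfl⟩

end LodingPirogov

end BuchiDet

theorem mainTheorem3 :
    ∃ A : (n : ℕ) → BuchiDet.NBA (Fin (n + 1)) (Fin (n + 2)), ∀ n : ℕ,
      (A n).Complete ∧
      -- the deterministic part that is needed by the construction of Esparza et al. exists
      (∃ D, (A n).IsLimitDeterministic D) ∧
      -- Esparza et al.
      (∀ D, (A n).IsLimitDeterministic D →
        (BuchiDet.esparzaDPA (A n) D).IsDPA ∧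
        n.factorial ≤ (BuchiDet.esparzaDPA (A n) D).reachable.ncard) ∧
      -- Redziejowski
      ((BuchiDet.redziejowskiDPA (A n)).IsDPA ∧
        n.factorial ≤ (BuchiDet.redziejowskiDPA (A n)).reachable.ncard) ∧
      -- Safra, as a Rabin automaton and as a parity automaton
      ((BuchiDet.safra (A n)).toDRA.IsDRA ∧
        n.factorial ≤ (BuchiDet.safra (A n)).toDRA.reachable.ncard ∧
        (BuchiDet.safra (A n)).toDPA.IsDPA ∧
        n.factorial ≤ (BuchiDet.safra (A n)).toDPA.reachable.ncard) ∧
      -- Piterman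
      ((BuchiDet.pitermanDPA (A n)).IsDPA ∧
        n.factorial ≤ (BuchiDet.pitermanDPA (A n)).reachable.ncard) ∧
      -- Kaehler and Wilke, as a Rabin automaton and as a parity automaton
      ((BuchiDet.kahlerWilke (A n)).toDRA.IsDRA ∧
        n.factorial ≤ (BuchiDet.kahlerWilke (A n)).toDRA.reachable.ncard ∧
        (BuchiDet.kahlerWilke (A n)).toDPA.IsDPA ∧
        n.factorial ≤ (BuchiDet.kahlerWilke (A n)).toDPA.reachable.ncard) ∧
      -- Loeding and Pirogov, with any merging strategy
      (∀ σ, (BuchiDet.lodingPirogovDPA (A n) σ).IsDPA ∧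
        n.factorial ≤ (BuchiDet.lodingPirogovDPA (A n) σ).reachable.ncard) ∧
      -- the divide-and-conquer construction; all macrostates are counted
      Nat.card (BuchiDet.divideDELA (A n)).State ≤ 2 ^ (n + 2) := by
  exact ⟨BuchiDet.permNBA, fun n =>
    ⟨BuchiDet.permNBA_complete n, ⟨_, BuchiDet.permNBA_isLimitDeterministic n⟩,
      fun D hD => ⟨BuchiDet.esparzaDPA_isDPA _ D, BuchiDet.esparzaDPA_factorial_le hD⟩,
      ⟨BuchiDet.redziejowskiDPA_isDPA _, BuchiDet.redziejowskiDPA_factorial_le n⟩,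
      ⟨BuchiDet.RabinSystem.isDRA_toDRA _, BuchiDet.safra_toDRA_factorial_le n,
        BuchiDet.RabinSystem.isDPA_toDPA _, (BuchiDet.safra_toDRA_factorial_le n).trans
          (BuchiDet.RabinSystem.ncard_reachable_toDRA_le _)⟩,
      ⟨BuchiDet.pitermanDPA_isDPA _, BuchiDet.pitermanDPA_factorial_le n⟩,
      ⟨BuchiDet.RabinSystem.isDRA_toDRA _, BuchiDet.kahlerWilke_toDRA_factorial_le n,
        BuchiDet.RabinSystem.isDPA_toDPA _, (BuchiDet.kahlerWilke_toDRA_factorial_le n).trans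
          (BuchiDet.RabinSystem.ncard_reachable_toDRA_le _)⟩,
      fun σ => ⟨BuchiDet.lodingPirogovDPA_isDPA _ σ, BuchiDet.lodingPirogovDPA_factorial_le σ⟩,
      BuchiDet.permNBA_card_macroState⟩⟩
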